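/- Let $m,n\ge 1$, $\alpha>-1$, and let $\omega_0,\dots,\omega_m$ be real numbers, not all zero, with $\sum_{k=0}^{\ell}\omega_k\ge 0$ for $\ell=0,\dots,m$. For $\vec t=(t_1,\dots,t_m)$ with $0<t_1<\dots<t_m$ let $$w(x;\vec t)=x^{\alpha}e^{-x}\Big(\omega_0+\sum_{k=1}^m\omega_k\theta(x-t_k)\Big),\qquad D_n(\vec t)=\det\Big(\int_0^\infty x^{i+j}w(x;\vec t)\,dx\Big)_{i,j=0}^{n-1},$$ where $\theta=1$ on $(0,\infty)$ and $\theta=0$ elsewhere, and let $$\sigma_n(\vec t)=\delta\ln D_n(\vec t),\qquad \delta=\sum_{k=1}^m t_k\frac{\partial}{\partial t_k}.$$ (Here $D_n(\vec t)>0$ and $\ln D_n$ is differentiable.) Let $P_j(x)=P_j(x;\vec t)$ be the monic polynomials of degree $j$ orthogonal with respect to $w$ on $(0,\infty)$, let $h_j=\int_0^\infty P_j^2w\,dx$, and put, with $\sigma_3=\mathrm{diag}(1,-1)$, $$Y(z)=\begin{pmatrix}P_n(z)&\frac1{2\pi i}\int_0^\infty\frac{P_n(x)w(x)}{x-z}dx\\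 -\frac{2\pi i}{h_{n-1}}P_{n-1}(z)&-\frac1{h_{n-1}}\int_0^\infty\frac{P_{n-1}(x)w(x)}{x-z}dx\end{pmatrix},\qquad \Psi(z)=t_1^{-(n+\frac\alpha2)\sigma_3}\,Y(t_1z)\,(t_1z)^{\frac\alpha2\sigma_3}e^{-\frac{t_1}2z\sigma_3},$$ where $(t_1 z)^{\frac{\alpha}{2}\sigma_3}$ is defined with the principal branch. Let $tH_V(t,u,v)=u^2v(v-1)^2+tuv+(n+\alpha)u(v-1)^2-\alpha uv(v-1)$ (the Hamiltonian of the fifth Painlevé equation with parameters $\frac{n^2}2,-\frac{(n+\alpha)^2}2,\alpha+1,-\frac12$), and $$\mathcal H(\vec t,u,v)=\sum_{k=1}^m t_kH_V(t_k,u_k,v_k)+\frac12\sum_{j\ne k}u_ju_k(v_j+v_k)(v_j-1)(v_k-1),$$ the last sum being over ordered pairs. (i) There are real functions $u_k(\vec t)$, $v_k(\vec t)$, $k=1,\dots,m$, and a complex function $y(\vec t)$ such that the following holds for every $\vec t$ with $0<t_1<\dots<t_m$ and $P_n(t_k;\vec t)\ne0$ for all $k$. First, $y\neq 0$ and $u_k,v_k,y$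 parametrize the Lax matrix of $\Psi$: for all non-real $z$, $\frac{d}{dz}\Psi(z)=L(z)\Psi(z)$ with $$L(z)=-\frac{t_1}2\sigma_3+\frac1z\begin{pmatrix}a&-(a-\frac\alpha2)y\\(a+\frac\alpha2)/y&-a\end{pmatrix}+\sum_{k=1}^m\frac1{z-t_k/t_1}\begin{pmatrix}-u_kv_k&u_ky\\-u_kv_k^2/y&u_kv_k\end{pmatrix},\qquad a=\sum_{k=1}^m u_kv_k+n+\frac\alpha2.$$ Secondly, $$\sigma_n(\vec t)=\mathcal H(\vec t,u(\vec t),v(\vec t)).$$ Thirdly, $u_k$ and $v_k$ are differentiable at $\vec t$ and satisfy there, for $k=1,\dots,m$, the coupled Painlevé V system $$\begin{aligned}\delta u_k&=-t_ku_k-u_k\sum_{j=1}^mu_j(v_j-1)(2v_k+v_j-1)-2nu_kv_k+(2n+\alpha)u_k,\\ \delta v_k&=t_kv_k+(v_k-1)\sum_{j=1}^mu_j(v_j-1)(v_k+v_j)+(n+\alpha)(v_k-1)^2-\alpha v_k(v_k-1).\end{aligned}$$ (ii) For functions $u_k,v_k$ that are differentiable at $\vec t$, where $0<t_1<\dots<t_m$,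 the coupled Painlevé V system holds at $\vec t$ if and only if the Hamiltonian equations $$\delta v_k=\frac{\partial\mathcal H}{\partial u_k},\qquad \delta u_k=-\frac{\partial\mathcal H}{\partial v_k},\qquad k=1,\dots,m,$$ hold at $\vec t$ (that is, $\delta v_k=\partial\sigma_n/\partial u_k$ and $\delta u_k=-\partial\sigma_n/\partial v_k$ with $\sigma_n$ regarded as the function $\mathcal H$ of $u$ and $v$). -/

import Mathlib

open scoped BigOperators

namespace LaguerreJump

noncomputable section

/-- The step function `θ`, equal to `1` on `(0, ∞)` and to `0` elsewhere. -/
def theta (x : ℝ) : ℝ := if 0 < x then 1 else 0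

/-- The Laguerre weight with jumps, `x ^ α e ^ (-x) (ω₀ + ∑ₖ ωₖ θ(x - tₖ))`. The jump points
`t₁, …, tₘ` are `t 0, …, t (m - 1)`; the constants `ω₀, ω₁, …, ωₘ` are `ω 0, …, ω m`. -/
def weight {m : ℕ} (α : ℝ) (ω : Fin (m + 1) → ℝ) (t : Fin m → ℝ) (x : ℝ) : ℝ :=
  x ^ α * Real.exp (-x) * (ω 0 + ∑ k : Fin m, ω k.succ * theta (x - t k))

/-- The `n`-dimensional Hankel determinant of the moments of the weight on `(0, ∞)`. -/
def hankelDet {m : ℕ} (n : ℕ) (α : ℝ) (ω : Fin (m + 1) → ℝ) (t : Fin m → ℝ) : ℝ :=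
  Matrix.det (Matrix.of fun i j : Fin n =>
    ∫ x in Set.Ioi (0 : ℝ), x ^ ((i : ℕ) + (j : ℕ)) * weight α ω t x)

/-- The operator `δ = ∑ₖ tₖ ∂/∂tₖ`. -/
def delta {m : ℕ} (f : (Fin m → ℝ) → ℝ) (t : Fin m → ℝ) : ℝ :=
  ∑ k : Fin m, t k * fderiv ℝ f t (Pi.single k 1)

/-- `σₙ = δ ln Dₙ`. -/
def sigma {m : ℕ} (n : ℕ) (α : ℝ) (ω : Fin (m + 1) → ℝ) (t : Fin m → ℝ) : ℝ :=
  delta (fun s => Real.log (hankelDet n α ω s)) t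

/-- `P 0, P 1, P 2, …` are monic polynomials, `P n` of degree `n`, which are orthogonal with
respect to the weight `w` on `(0, ∞)`. -/
def IsMonicOrthogonal (w : ℝ → ℝ) (P : ℕ → Polynomial ℝ) : Prop :=
  (∀ n, (P n).Monic ∧ (P n).natDegree = n) ∧
    ∀ j k, j ≠ k → ∫ x in Set.Ioi (0 : ℝ), (P j).eval x * (P k).eval x * w x = 0

/-- The monic orthogonal polynomials `Pₙ(·; t)` of the weight with jumps (for a nonzero weight
`w ≥ 0` they exist and are unique). -/
def orthoPoly {m : ℕ} (α : ℝ) (ω : Fin (m + 1) → ℝ) (t : Fin m → ℝ) : ℕ → Polynomial ℝ :=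
  Classical.epsilon (IsMonicOrthogonal (weight α ω t))

/-- `hₙ = ∫ Pₙ² w`, the squared norm of the `n`-th monic orthogonal polynomial. -/
def sqNorm {m : ℕ} (n : ℕ) (α : ℝ) (ω : Fin (m + 1) → ℝ) (t : Fin m → ℝ) : ℝ :=
  ∫ x in Set.Ioi (0 : ℝ), (orthoPoly α ω t n).eval x ^ 2 * weight α ω t x

/-- The integral `∫ Pₙ(x) w(x) / (x - z) dx` over `(0, ∞)`. -/
def cauchyTransform {m : ℕ} (n : ℕ) (α : ℝ) (ω : Fin (m + 1) → ℝ) (t : Fin m → ℝ) (z : ℂ) : ℂ :=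
  ∫ x in Set.Ioi (0 : ℝ),
    (((orthoPoly α ω t n).eval x * weight α ω t x : ℝ) : ℂ) / ((x : ℂ) - z)

/-- The solution `Y` of the Riemann-Hilbert problem for the orthogonal polynomials (`n ≥ 1`). -/
def matY {m : ℕ} (n : ℕ) (α : ℝ) (ω : Fin (m + 1) → ℝ) (t : Fin m → ℝ) (z : ℂ) :
    Matrix (Fin 2) (Fin 2) ℂ :=
  !![Polynomial.aeval z (orthoPoly α ω t n),
      1 / (2 * Real.pi * Complex.I) * cauchyTransform n α ω t z;
    -(2 * Real.pi * Complex.I) / (sqNorm (n - 1) α ω t : ℂ) *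
        Polynomial.aeval z (orthoPoly α ω t (n - 1)),
      -1 / (sqNorm (n - 1) α ω t : ℂ) * cauchyTransform (n - 1) α ω t z]

/-- `Ψ(z) = t₁ ^ (-(n + α/2) σ₃) Y(t₁ z) (t₁ z) ^ ((α/2) σ₃) e ^ (-(t₁ z/2) σ₃)`, where
`σ₃ = diag(1, -1)` and where powers of `t₁ z` have their principal values. -/
def matPsi {m : ℕ} [NeZero m] (n : ℕ) (α : ℝ) (ω : Fin (m + 1) → ℝ) (t : Fin m → ℝ) (z : ℂ) :
    Matrix (Fin 2) (Fin 2) ℂ :=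
  !![((t 0 ^ (-((n : ℝ) + α / 2)) : ℝ) : ℂ), 0; 0, ((t 0 ^ ((n : ℝ) + α / 2) : ℝ) : ℂ)] *
    matY n α ω t (t 0 * z) *
    !![((t 0 : ℂ) * z) ^ ((α : ℂ) / 2), 0; 0, ((t 0 : ℂ) * z) ^ (-((α : ℂ) / 2))] *
    !![Complex.exp (-((t 0 : ℂ) * z / 2)), 0; 0, Complex.exp ((t 0 : ℂ) * z / 2)]

/-- `a = ∑ₖ uₖ vₖ + n + α/2`. -/
def laxA {m : ℕ} (n : ℕ) (α : ℝ) (u v : Fin m → ℝ) : ℝ := ∑ k, u k * v k + n + α / 2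

/-- The residue `Â₀` of the Lax matrix at `0`. -/
def resZero {m : ℕ} (n : ℕ) (α : ℝ) (u v : Fin m → ℝ) (y : ℂ) : Matrix (Fin 2) (Fin 2) ℂ :=
  !![(laxA n α u v : ℂ), -((laxA n α u v - α / 2 : ℝ) : ℂ) * y;
    ((laxA n α u v + α / 2 : ℝ) : ℂ) / y, -(laxA n α u v : ℂ)]

/-- The residue `Âₖ` of the Lax matrix at `tₖ / t₁`, as a function of `uₖ`, `vₖ` and `y`. -/
def resJump (u v : ℝ) (y : ℂ) : Matrix (Fin 2) (Fin 2) ℂ :=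
  !![-((u * v : ℝ) : ℂ), (u : ℂ) * y; -((u * v ^ 2 : ℝ) : ℂ) / y, ((u * v : ℝ) : ℂ)]

/-- The Lax matrix `L(z) = -(t₁/2) σ₃ + Â₀ / z + ∑ₖ Âₖ / (z - tₖ/t₁)`. -/
def laxMatrix {m : ℕ} [NeZero m] (n : ℕ) (α : ℝ) (t : Fin m → ℝ) (u v : Fin m → ℝ) (y : ℂ)
    (z : ℂ) : Matrix (Fin 2) (Fin 2) ℂ :=
  !![-((t 0 : ℂ) / 2), 0; 0, (t 0 : ℂ) / 2] + z⁻¹ • resZero n α u v y +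
    ∑ k : Fin m, (z - (t k : ℂ) / (t 0 : ℂ))⁻¹ • resJump (u k) (v k) y

/-- The numbers `u₁, …, uₘ`, `v₁, …, vₘ` and `y ≠ 0` parametrize the Lax matrix of `Ψ` at `t`:
`dΨ/dz = L Ψ` off the real axis. -/
def IsLaxParam {m : ℕ} [NeZero m] (n : ℕ) (α : ℝ) (ω : Fin (m + 1) → ℝ) (t : Fin m → ℝ)
    (u v : Fin m → ℝ) (y : ℂ) : Prop :=
  y ≠ 0 ∧ ∀ z : ℂ, z.im ≠ 0 → ∀ i j : Fin 2,
    HasDerivAt (fun ζ => matPsi n α ω t ζ i j)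
      ((laxMatrix n α t u v y z * matPsi n α ω t z) i j) z

/-- The Hamiltonian `H_V` of the fifth Painlevé equation with parameters
`n²/2, -(n + α)²/2, α + 1, -1/2`. -/
def hamV (n : ℕ) (α t u v : ℝ) : ℝ :=
  (u ^ 2 * v * (v - 1) ^ 2 + t * u * v + (n + α) * u * (v - 1) ^ 2 - α * u * v * (v - 1)) / t

/-- `∑ₖ tₖ H_V(tₖ, uₖ, vₖ) + ½ ∑_{j ≠ k} uⱼ uₖ (vⱼ + vₖ) (vⱼ - 1) (vₖ - 1)`, the second sum being
over ordered pairs. -/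
def coupledHam {m : ℕ} (n : ℕ) (α : ℝ) (t u v : Fin m → ℝ) : ℝ :=
  ∑ k, t k * hamV n α (t k) (u k) (v k) +
    1 / 2 * ∑ j, ∑ k ∈ Finset.univ.erase j,
      u j * u k * (v j + v k) * (v j - 1) * (v k - 1)

/-- The functions `uₖ`, `vₖ` are differentiable at `t` and satisfy the coupled Painlevé V system
there. -/
def CoupledPVAt {m : ℕ} (n : ℕ) (α : ℝ) (u v : (Fin m → ℝ) → Fin m → ℝ) (t : Fin m → ℝ) : Prop :=
  DifferentiableAt ℝ u t ∧ DifferentiableAt ℝ v t ∧ ∀ k : Fin m,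
    delta (fun s => u s k) t =
        -(t k * u t k) - u t k * ∑ j, u t j * (v t j - 1) * (2 * v t k + v t j - 1)
          - 2 * n * u t k * v t k + (2 * n + α) * u t k ∧
    delta (fun s => v s k) t =
        t k * v t k + (v t k - 1) * ∑ j, u t j * (v t j - 1) * (v t k + v t j)
          + (n + α) * (v t k - 1) ^ 2 - α * v t k * (v t k - 1)

/-- The functions `uₖ`, `vₖ` are differentiable at `t` and satisfy there Hamilton's equations
`δ vₖ = ∂H/∂uₖ`, `δ uₖ = -∂H/∂vₖ`, with `H = coupledHam`. -/
def HamiltonianAt {m : ℕ} (n : ℕ) (α : ℝ) (u v : (Fin m → ℝ) → Fin m → ℝ) (t : Fin m → ℝ) :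
    Prop :=
  DifferentiableAt ℝ u t ∧ DifferentiableAt ℝ v t ∧ ∀ k : Fin m,
    delta (fun s => v s k) t =
        deriv (fun x => coupledHam n α t (Function.update (u t) k x) (v t)) (u t k) ∧
    delta (fun s => u s k) t =
        -deriv (fun x => coupledHam n α t (u t) (Function.update (v t) k x)) (v t k)

end

end LaguerreJump

/-! The theorem's `n` appears as `n + 1` in the lemmas. Write p = P_{n+1}, q = P_n, h = ∫ q² w, ρ =
p(0)/q(0), let r_k be the jump of w at t_k, and let K(·, s) be the Christoffel-Darboux kernel of p
and q, of degree at most n.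

Everything flows from one identity, the Pearson equation: x w' = (α - x) w away from the jumps, plus
point masses r_k t_k at t_k. Tested against polynomials (`IsPearson`), it shows that p' and q' - q,
which have degree at most n, represent combinations of point evaluations at 0 and the t_k. So they
are combinations of K(·, 0) and K(·, t_k) (`derivative_succ_eq`, `derivative_sub_self_eq`). The
Christoffel-Darboux formula turns this into a linear system for (p, q) with simple poles at 0 and
the t_k. The Cauchy transforms of p and q satisfy the same system up to the scalar term α/z - 1
(`hasDerivAt_polyCauchy_of_derivative_eq`), and the diagonal factors in Ψ even that term out between
the two columns. This is the Lax equation (`isLaxParam_param`). Reading off its residues gives u_k =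
r_k p(t_k)² / (h ρ) and v_k = ρ q(t_k) / p(t_k), so that u_k v_k = r_k p(t_k) q(t_k) / h and u_k
v_k² = ρ r_k q(t_k)² / h.

For the dependence on t, Gram-Schmidt gives differentiability, and differentiating the orthogonality
relations gives δP_j = ∑ r_k t_k P_j(t_k) K_j(·, t_k), where K_j is the kernel of degree below j.
Adding x d/dx to δ cancels all the poles: the values of p and q at t_k and at 0 then satisfy a
closed system. Hence δu_k and δv_k are polynomials in t_k, u, v and ρ. Two formulas for the
coefficient of K(·, 0) in q' - q express ρ through u and v (`ratioZero_eq`), and the coupled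
Painlevé V system results.

For σ, the factorization D = ∏ h_j gives δ ln D = -∑ r_k t_k K(t_k, t_k). The confluent
Christoffel-Darboux formula, the formulas for p' and q', and a symmetrization of the resulting
double sum make this a polynomial in u, v and t, which is the Hamiltonian
(`sum_mul_eval_cdKernel_self`, `sigma_eq_coupledHam`).

Part (ii) is algebra: written with sums over a single index (`coupledHam_eq`), the Hamiltonian has
as partial derivatives exactly the right-hand sides of the system. -/

namespace LaguerreJump
-- Orthogonal polynomials of an abstract positive functional.
open Polynomial Finset

noncomputable section

/-- A sequence of monic polynomials, `P n` of degree `n`, that is orthogonal with respect to a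
linear functional. -/
structure IsOrthoSeq (L : ℝ[X] →ₗ[ℝ] ℝ) (P : ℕ → ℝ[X]) : Prop where
  monic : ∀ n, (P n).Monic
  natDegree : ∀ n, (P n).natDegree = n
  orth : ∀ j k, j ≠ k → L (P j * P k) = 0

/-- Gram-Schmidt orthogonalization of the monomials with respect to a linear functional. -/
def gramSchmidtPoly (L : ℝ[X] →ₗ[ℝ] ℝ) (n : ℕ) : ℝ[X] :=
  X ^ n - ∑ j : Fin n, C (L (X ^ n * gramSchmidtPoly L j) /
    L (gramSchmidtPoly L j * gramSchmidtPoly L j)) * gramSchmidtPoly L j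
termination_by n
decreasing_by all_goals exact j.2

theorem degree_sum_C_mul_lt {n : ℕ} (c : ℕ → ℝ) (P : ℕ → ℝ[X]) (hP : ∀ j < n, (P j).natDegree = j) :
    (∑ j ∈ range n, C (c j) * P j).degree < (n : WithBot ℕ) := by
  rw [degree_lt_iff_coeff_zero]
  intro i hi
  rw [finsetSum_coeff]
  refine sum_eq_zero fun j hj => ?_
  rw [coeff_C_mul, coeff_eq_zero_of_natDegree_lt, mul_zero]
  rw [hP j (mem_range.1 hj)]
  have := mem_range.1 hj
  omega

theorem gramSchmidtPoly_eq (L : ℝ[X] →ₗ[ℝ] ℝ) (n : ℕ) :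
    gramSchmidtPoly L n = X ^ n - ∑ j ∈ range n, C (L (X ^ n * gramSchmidtPoly L j) /
      L (gramSchmidtPoly L j * gramSchmidtPoly L j)) * gramSchmidtPoly L j := by
  rw [gramSchmidtPoly, ← Fin.sum_univ_eq_sum_range (fun j => C (L (X ^ n * gramSchmidtPoly L j) /
      L (gramSchmidtPoly L j * gramSchmidtPoly L j)) * gramSchmidtPoly L j)]

theorem gramSchmidtPoly_monic_natDegree (L : ℝ[X] →ₗ[ℝ] ℝ) (n : ℕ) :
    (gramSchmidtPoly L n).Monic ∧ (gramSchmidtPoly L n).natDegree = n := by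
  induction n using Nat.strong_induction_on with
  | _ n ih =>
    have hlt := degree_sum_C_mul_lt (n := n) (fun j => L (X ^ n * gramSchmidtPoly L j) /
      L (gramSchmidtPoly L j * gramSchmidtPoly L j)) (gramSchmidtPoly L) fun j hj => (ih j hj).2
    have hlt' : (∑ j ∈ range n, C (L (X ^ n * gramSchmidtPoly L j) /
      L (gramSchmidtPoly L j * gramSchmidtPoly L j)) * gramSchmidtPoly L j).degree <
        (X ^ n : ℝ[X]).degree := by
      rwa [degree_X_pow]
    rw [gramSchmidtPoly_eq]
    refine ⟨?_, ?_⟩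
    · exact (monic_X_pow n).sub_of_left hlt'
    · rw [natDegree_eq_of_degree_eq (degree_sub_eq_left_of_degree_lt hlt'), natDegree_X_pow]

theorem map_sum_C_mul_mul (L : ℝ[X] →ₗ[ℝ] ℝ) {ι : Type*} (s : Finset ι) (c : ι → ℝ) (P : ι → ℝ[X])
    (f : ℝ[X]) : L ((∑ j ∈ s, C (c j) * P j) * f) = ∑ j ∈ s, c j * L (P j * f) := by
  rw [sum_mul, map_sum]
  refine sum_congr rfl fun j _ => ?_
  rw [mul_assoc, ← smul_eq_C_mul, map_smul, smul_eq_mul]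

theorem map_C_mul (L : ℝ[X] →ₗ[ℝ] ℝ) (c : ℝ) (f : ℝ[X]) : L (C c * f) = c * L f := by
  rw [← smul_eq_C_mul, map_smul, smul_eq_mul]

theorem isOrthoSeq_gramSchmidtPoly (L : ℝ[X] →ₗ[ℝ] ℝ) (hL : ∀ p : ℝ[X], p ≠ 0 → 0 < L (p * p)) :
    IsOrthoSeq L (gramSchmidtPoly L) := by
  have hne : ∀ n, gramSchmidtPoly L n ≠ 0 := fun n => (gramSchmidtPoly_monic_natDegree L n).1.ne_zero
  have key : ∀ n, ∀ j < n, L (gramSchmidtPoly L n * gramSchmidtPoly L j) = 0 := by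
    intro n
    induction n using Nat.strong_induction_on with
    | _ n ih =>
      intro j hj
      rw [gramSchmidtPoly_eq, sub_mul, map_sub, map_sum_C_mul_mul,
        sum_eq_single_of_mem j (mem_range.2 hj)]
      · rw [div_mul_cancel₀ _ (hL _ (hne j)).ne', sub_self]
      · intro i hi hij
        rcases lt_or_gt_of_ne hij with h | h
        · rw [mul_comm (gramSchmidtPoly L i) (gramSchmidtPoly L j), ih j hj i h, mul_zero]
        · rw [ih i (mem_range.1 hi) j h, mul_zero]
  refine ⟨fun n => (gramSchmidtPoly_monic_natDegree L n).1,
    fun n => (gramSchmidtPoly_monic_natDegree L n).2, fun j k hjk => ?_⟩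
  rcases lt_or_gt_of_ne hjk with h | h
  · rw [mul_comm, key k j h]
  · exact key j k h

namespace IsOrthoSeq

variable {L : ℝ[X] →ₗ[ℝ] ℝ} {P : ℕ → ℝ[X]}

theorem coeff_self (hP : IsOrthoSeq L P) (n : ℕ) : (P n).coeff n = 1 := by
  have := (hP.monic n).coeff_natDegree
  rwa [hP.natDegree] at this

theorem coeff_of_lt (hP : IsOrthoSeq L P) {n i : ℕ} (h : n < i) : (P n).coeff i = 0 :=
  coeff_eq_zero_of_natDegree_lt (by rwa [hP.natDegree])

theorem degree_lt (hP : IsOrthoSeq L P) {n i : ℕ} (h : n < i) : (P n).degree < i := by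
  rw [degree_eq_natDegree (hP.monic n).ne_zero, hP.natDegree]
  exact_mod_cast h

theorem degree_sub_lt (hP : IsOrthoSeq L P) {n : ℕ} {f : ℝ[X]} (hf : f.degree < ((n + 1 : ℕ) : WithBot ℕ)) :
    (f - C (f.coeff n) * P n).degree < (n : WithBot ℕ) := by
  rw [degree_lt_iff_coeff_zero] at hf ⊢
  intro i hi
  rw [coeff_sub, coeff_C_mul]
  rcases hi.eq_or_lt with rfl | h
  · rw [hP.coeff_self, mul_one, sub_self]
  · rw [hf i h, hP.coeff_of_lt h, mul_zero, sub_zero]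

/-- A property that is closed under linear combinations and holds for the first `n` polynomials of
an orthogonal sequence holds for all polynomials of degree less than `n`. -/
theorem induction_degree_lt (hP : IsOrthoSeq L P) {n : ℕ} {p : ℝ[X] → Prop} (h0 : p 0)
    (hadd : ∀ f g, p f → p g → p (f + g)) (hmul : ∀ c f, p f → p (C c * f))
    (hp : ∀ j < n, p (P j)) {f : ℝ[X]} (hf : f.degree < n) : p f := by
  induction n generalizing f with
  | zero =>
    have : f = 0 := by
      rw [← degree_eq_bot]
      simpa [Nat.WithBot.lt_zero_iff] using hf
    exact this ▸ h0
  | succ n ih =>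
    have := hadd _ _ (ih (fun j hj => hp j (by omega)) (hP.degree_sub_lt hf))
      (hmul (f.coeff n) _ (hp n (by omega)))
    simpa using this

theorem map_mul_of_degree_lt (hP : IsOrthoSeq L P) {n : ℕ} {f : ℝ[X]} (hf : f.degree < n) :
    L (P n * f) = 0 := by
  refine hP.induction_degree_lt (n := n) (p := fun f => L (P n * f) = 0) (by simp) ?_ ?_ ?_ hf
  · intro f g h1 h2
    rw [mul_add, map_add, h1, h2, add_zero]
  · intro c f h
    rw [mul_left_comm, map_C_mul, h, mul_zero]
  · intro j hj
    exact hP.orth n j hj.ne'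

theorem map_mul_of_degree_lt_succ (hP : IsOrthoSeq L P) {n : ℕ} {f : ℝ[X]}
    (hf : f.degree < ((n + 1 : ℕ) : WithBot ℕ)) : L (P n * f) = f.coeff n * L (P n * P n) := by
  have h := hP.map_mul_of_degree_lt (hP.degree_sub_lt hf)
  rw [mul_sub, map_sub, mul_left_comm, map_C_mul] at h
  linarith

/-- A polynomial of degree less than `n` vanishes if it is orthogonal to all polynomials of degree
less than `n` with respect to a positive functional. -/
theorem eq_zero_of_orth (hL : ∀ p : ℝ[X], p ≠ 0 → 0 < L (p * p)) {n : ℕ} {f : ℝ[X]}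
    (hf : f.degree < n) (h : ∀ g : ℝ[X], g.degree < n → L (f * g) = 0) : f = 0 := by
  by_contra hne
  exact (hL f hne).ne' (h f hf)

theorem eq_zero_of_orth_self (hP : IsOrthoSeq L P) (hL : ∀ p : ℝ[X], p ≠ 0 → 0 < L (p * p)) {n : ℕ}
    {f : ℝ[X]} (hf : f.degree < n) (h : ∀ j < n, L (f * P j) = 0) : f = 0 := by
  refine eq_zero_of_orth hL hf fun g hg => ?_
  refine hP.induction_degree_lt (n := n) (p := fun g => L (f * g) = 0) (by simp) ?_ ?_ h hg
  · intro f g h1 h2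
    rw [mul_add, map_add, h1, h2, add_zero]
  · intro c f h
    rw [mul_left_comm, map_C_mul, h, mul_zero]

/-- The recursion determines P_n from the functional and the earlier polynomials. It transfers
smoothness in the parameters from the moments to the P_n. -/
theorem eq_gramSchmidt (hP : IsOrthoSeq L P) (hL : ∀ p : ℝ[X], p ≠ 0 → 0 < L (p * p)) (n : ℕ) :
    P n = X ^ n - ∑ j ∈ range n, C (L (X ^ n * P j) / L (P j * P j)) * P j := by
  rw [eq_sub_iff_add_eq, ← sub_eq_zero]
  have hd : (P n + ∑ j ∈ range n, C (L (X ^ n * P j) / L (P j * P j)) * P j - X ^ n).degree <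
      ((n : ℕ) : WithBot ℕ) := by
    have h1 := degree_sum_C_mul_lt (n := n) (fun j => L (X ^ n * P j) / L (P j * P j)) P
      fun j _ => hP.natDegree j
    rw [degree_lt_iff_coeff_zero] at h1 ⊢
    intro i hi
    rw [coeff_sub, coeff_add, h1 i hi, coeff_X_pow]
    rcases hi.eq_or_lt with rfl | h
    · simp [hP.coeff_self]
    · simp [hP.coeff_of_lt h, h.ne']
  refine hP.eq_zero_of_orth_self hL hd ?_
  · intro j hj
    rw [sub_mul, add_mul, map_sub, map_add, map_sum_C_mul_mul, sum_eq_single_of_mem j (mem_range.2 hj),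
      hP.orth n j hj.ne', div_mul_cancel₀ _ (hL _ (hP.monic j).ne_zero).ne']
    · ring
    · intro i _ hij
      rw [hP.orth i j hij, mul_zero]

/-- If P_n = X g, then g has degree below n, so L(X g²) = L(P_n g) = 0, against positivity on (0,
∞). -/
theorem eval_zero_ne_zero (hP : IsOrthoSeq L P) (hX : ∀ p : ℝ[X], p ≠ 0 → 0 < L (X * (p * p)))
    (n : ℕ) : (P n).eval 0 ≠ 0 := by
  intro h
  obtain ⟨g, hg⟩ : X ∣ P n := by rwa [X_dvd_iff, coeff_zero_eq_eval_zero]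
  have hg0 : g ≠ 0 := by
    rintro rfl
    exact (hP.monic n).ne_zero (by simpa using hg)
  have hd : g.degree < (n : WithBot ℕ) := by
    have h1 : (P n).degree = n := by
      rw [degree_eq_natDegree (hP.monic n).ne_zero, hP.natDegree]
    rw [hg, degree_mul, degree_X, degree_eq_natDegree hg0] at h1
    rw [degree_eq_natDegree hg0]
    have h2 : 1 + g.natDegree = n := by exact_mod_cast h1
    exact_mod_cast (by omega : g.natDegree < n)
  have := hP.map_mul_of_degree_lt hd
  rw [hg, mul_assoc] at this
  exact (hX g hg0).ne' this

end IsOrthoSeq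

/-! ### Christoffel-Darboux kernel and its reproducing property. -/

/-- The Christoffel-Darboux kernel `K(·, s) = ∑_{j < n} P_j(s) P_j / h_j`. -/
def cdKernel (L : ℝ[X] →ₗ[ℝ] ℝ) (P : ℕ → ℝ[X]) (n : ℕ) (s : ℝ) : ℝ[X] :=
  ∑ j ∈ range n, C ((P j).eval s / L (P j * P j)) * P j

namespace IsOrthoSeq

variable {L : ℝ[X] →ₗ[ℝ] ℝ} {P : ℕ → ℝ[X]}

theorem degree_cdKernel_lt (hP : IsOrthoSeq L P) (n : ℕ) (s : ℝ) : (cdKernel L P n s).degree < n :=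
  degree_sum_C_mul_lt _ _ fun j _ => hP.natDegree j

theorem coeff_cdKernel_succ (hP : IsOrthoSeq L P) (n : ℕ) (s : ℝ) :
    (cdKernel L P (n + 1) s).coeff n = (P n).eval s / L (P n * P n) := by
  have h := hP.degree_cdKernel_lt n s
  rw [degree_lt_iff_coeff_zero] at h
  have h' : cdKernel L P (n + 1) s =
      cdKernel L P n s + C ((P n).eval s / L (P n * P n)) * P n := by
    rw [cdKernel, sum_range_succ, cdKernel]
  rw [h', coeff_add, h n le_rfl, coeff_C_mul, hP.coeff_self, mul_one, zero_add]

theorem cdKernel_reproducing (hP : IsOrthoSeq L P) (hL : ∀ p : ℝ[X], p ≠ 0 → 0 < L (p * p)) {n : ℕ}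
    (s : ℝ) {f : ℝ[X]} (hf : f.degree < n) : L (cdKernel L P n s * f) = f.eval s := by
  refine hP.induction_degree_lt (n := n) (p := fun f => L (cdKernel L P n s * f) = f.eval s)
    (by simp) ?_ ?_ ?_ hf
  · intro f g h1 h2
    rw [mul_add, map_add, h1, h2, eval_add]
  · intro c f h
    rw [mul_left_comm, map_C_mul, h, eval_mul, eval_C]
  · intro j hj
    rw [cdKernel, map_sum_C_mul_mul, sum_eq_single_of_mem j (mem_range.2 hj),
      div_mul_cancel₀ _ (hL _ (hP.monic j).ne_zero).ne']
    intro i _ hij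
    rw [hP.orth i j hij, mul_zero]

/-- The leading terms agree, so the difference of the two sides has degree at most n and need only
be tested against P_0, …, P_n. There the reproducing property applies to (X - s) P_j, which vanishes
at s. No three-term recurrence is needed. -/
theorem christoffel_darboux (hP : IsOrthoSeq L P) (hL : ∀ p : ℝ[X], p ≠ 0 → 0 < L (p * p)) (n : ℕ)
    (s : ℝ) : (X - C s) * cdKernel L P (n + 1) s =
      C ((L (P n * P n))⁻¹) * (C ((P n).eval s) * P (n + 1) - C ((P (n + 1)).eval s) * P n) := by
  have hh : L (P n * P n) ≠ 0 := (hL _ (hP.monic n).ne_zero).ne'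
  have hK := hP.degree_cdKernel_lt (n + 1) s
  have hXd : ∀ (f : ℝ[X]) (k i : ℕ), f.degree < (k : ℕ) → k < i → ((X - C s) * f).coeff i = 0 := by
    intro f k i hf hi
    rw [degree_lt_iff_coeff_zero] at hf
    obtain ⟨i, rfl⟩ : ∃ l, i = l + 1 := ⟨i - 1, by omega⟩
    rw [sub_mul, coeff_sub, coeff_X_mul, coeff_C_mul, hf i (by omega), hf (i + 1) (by omega)]
    simp
  rw [← sub_eq_zero]
  have hd : ((X - C s) * cdKernel L P (n + 1) s - C ((L (P n * P n))⁻¹) *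
      (C ((P n).eval s) * P (n + 1) - C ((P (n + 1)).eval s) * P n)).degree <
      ((n + 1 : ℕ) : WithBot ℕ) := by
    rw [degree_lt_iff_coeff_zero]
    intro i hi
    rcases hi.eq_or_lt with rfl | h
    · have hK' := hK
      rw [degree_lt_iff_coeff_zero] at hK'
      rw [coeff_sub, sub_mul, coeff_sub, coeff_X_mul, coeff_C_mul, coeff_C_mul, coeff_sub,
        coeff_C_mul, coeff_C_mul, hP.coeff_self, hP.coeff_of_lt (Nat.lt_succ_self n),
        hK' (n + 1) le_rfl, hP.coeff_cdKernel_succ]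
      ring
    · rw [coeff_sub, hXd _ _ _ hK h, coeff_C_mul, coeff_sub, coeff_C_mul, coeff_C_mul,
        hP.coeff_of_lt h, hP.coeff_of_lt (by omega : n < i)]
      simp
  refine hP.eq_zero_of_orth_self hL hd ?_
  · intro j hj
    have hrhs : L (C ((L (P n * P n))⁻¹) * (C ((P n).eval s) * P (n + 1) -
        C ((P (n + 1)).eval s) * P n) * P j) =
        (L (P n * P n))⁻¹ * (-((P (n + 1)).eval s) * L (P n * P j)) := by
      rw [mul_assoc, map_C_mul, sub_mul, map_sub, mul_assoc, mul_assoc, map_C_mul, map_C_mul,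
        hP.orth (n + 1) j hj.ne']
      ring
    have hcomm : (X - C s) * cdKernel L P (n + 1) s * P j =
      cdKernel L P (n + 1) s * ((X - C s) * P j) := by ring
    rw [sub_mul, map_sub, hrhs, hcomm]
    rcases (Nat.lt_succ_iff.1 hj).eq_or_lt with rfl | hjn
    -- For j = n the polynomial (X - s) P_n has degree n + 1, out of reach of the reproducing
    -- property. Subtracting P_{n+1}, which is orthogonal to the kernel, brings it back in range,
    -- and the value of P_{n+1} at s is what remains.
    · have hd2 : ((X - C s) * P j - P (j + 1)).degree < ((j + 1 : ℕ) : WithBot ℕ) := by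
        rw [degree_lt_iff_coeff_zero]
        intro i hi
        rcases hi.eq_or_lt with rfl | h
        · rw [coeff_sub, sub_mul, coeff_sub, coeff_X_mul, coeff_C_mul, hP.coeff_self,
            hP.coeff_self, hP.coeff_of_lt (Nat.lt_succ_self j)]
          ring
        · rw [coeff_sub, hXd _ _ _ (hP.degree_lt (Nat.lt_succ_self j)) h, hP.coeff_of_lt h, sub_zero]
      have h1 := hP.cdKernel_reproducing hL s hd2
      have h2 := hP.map_mul_of_degree_lt hK
      rw [mul_sub, map_sub, mul_comm _ (P (j + 1)), h2] at h1
      rw [sub_zero] at h1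
      rw [h1]
      simp only [eval_sub, eval_mul, eval_X, eval_C, sub_self, zero_mul]
      field_simp
      ring
    · have hd2 : ((X - C s) * P j).degree < ((n + 1 : ℕ) : WithBot ℕ) := by
        rw [degree_lt_iff_coeff_zero]
        intro i hi
        exact hXd _ _ _ (hP.degree_lt (Nat.lt_succ_self j)) (by omega)
      rw [hP.cdKernel_reproducing hL s hd2, hP.orth n j hjn.ne']
      simp

/-- A polynomial of degree less than `n` that represents a combination of point evaluations is the
same combination of Christoffel-Darboux kernels. -/
theorem eq_cdKernel_of_map (hP : IsOrthoSeq L P) (hL : ∀ p : ℝ[X], p ≠ 0 → 0 < L (p * p)) {n : ℕ}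
    {ι : Type*} [Fintype ι] (c : ℝ) (d x : ι → ℝ) {f : ℝ[X]} (hf : f.degree < n)
    (h : ∀ g : ℝ[X], g.degree < n → L (f * g) = c * g.eval 0 - ∑ k, d k * g.eval (x k)) :
    f = C c * cdKernel L P n 0 - ∑ k, C (d k) * cdKernel L P n (x k) := by
  rw [← sub_eq_zero]
  refine eq_zero_of_orth hL (n := n) ?_ fun g hg => ?_
  · rw [degree_lt_iff_coeff_zero] at hf ⊢
    intro i hi
    have hK : ∀ s, (cdKernel L P n s).coeff i = 0 := fun s =>
      (degree_lt_iff_coeff_zero _ _).1 (hP.degree_cdKernel_lt n s) i hi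
    rw [coeff_sub, coeff_sub, finsetSum_coeff, coeff_C_mul, hK, hf i hi]
    simp [coeff_C_mul, hK]
  · rw [sub_mul, sub_mul, map_sub, map_sub, map_sum_C_mul_mul, mul_assoc, map_C_mul, h g hg]
    simp only [hP.cdKernel_reproducing hL _ hg, sub_self]

end IsOrthoSeq

/-! ### Pearson equation and derivatives of the orthogonal polynomials. -/

/-- The functional `L` satisfies the integrated form of the Pearson equation of the Laguerre weight
with jumps of sizes `r k` at the points `t k`. -/
def IsPearson {m : ℕ} (L : ℝ[X] →ₗ[ℝ] ℝ) (α : ℝ) (r t : Fin m → ℝ) : Prop :=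
  ∀ f : ℝ[X], L (X * derivative f + (C (1 + α) - X) * f) + ∑ k, r k * t k * f.eval (t k) = 0

namespace IsOrthoSeq

variable {L : ℝ[X] →ₗ[ℝ] ℝ} {P : ℕ → ℝ[X]} {m : ℕ} {α : ℝ} {r t : Fin m → ℝ}

theorem _root_.LaguerreJump.IsPearson.map_derivative_mul (hD : IsPearson L α r t) (f g : ℝ[X]) :
    L (derivative f * (X * g)) = -L (f * (X * derivative g + C (1 + α) * g)) + L (f * (X * g)) -
      ∑ k, r k * t k * (f.eval (t k) * g.eval (t k)) := by
  have h := hD (f * g)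
  have e : X * derivative (f * g) + (C (1 + α) - X) * (f * g) = derivative f * (X * g) +
      f * (X * derivative g + C (1 + α) * g) - f * (X * g) := by
    rw [derivative_mul]
    ring
  rw [e, map_sub, map_add] at h
  simp only [eval_mul] at h
  linarith

theorem _root_.LaguerreJump.coeff_X_mul_derivative (f : ℝ[X]) (i : ℕ) :
    (X * derivative f).coeff i = i * f.coeff i := by
  cases i with
  | zero => simp
  | succ i =>
    rw [coeff_X_mul, coeff_derivative]
    push_cast
    ring

theorem degree_X_mul_derivative_add_lt {n : ℕ} {f : ℝ[X]} (hf : f.degree < n) (β : ℝ) :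
    (X * derivative f + C β * f).degree < (n : WithBot ℕ) := by
  rw [degree_lt_iff_coeff_zero] at hf ⊢
  intro i hi
  rw [coeff_add, coeff_X_mul_derivative, coeff_C_mul, hf i hi]
  simp

theorem degree_X_mul_lt {n : ℕ} {f : ℝ[X]} (hf : f.degree < n) : (X * f).degree < ((n + 1 : ℕ) : WithBot ℕ) := by
  rw [degree_lt_iff_coeff_zero] at hf ⊢
  intro i hi
  obtain ⟨i, rfl⟩ : ∃ l, i = l + 1 := ⟨i - 1, by omega⟩
  rw [coeff_X_mul, hf i (by omega)]

theorem degree_divX_lt {n : ℕ} {f : ℝ[X]} (hf : f.degree < ((n + 1 : ℕ) : WithBot ℕ)) : f.divX.degree < (n : WithBot ℕ) := by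
  rw [degree_lt_iff_coeff_zero] at hf ⊢
  intro i hi
  rw [coeff_divX, hf (i + 1) (by omega)]

theorem degree_lt_succ {n : ℕ} {f : ℝ[X]} (hf : f.degree < n) : f.degree < ((n + 1 : ℕ) : WithBot ℕ) :=
  hf.trans (by exact_mod_cast Nat.lt_succ_self n)

theorem eq_C_add_X_mul_divX (f : ℝ[X]) : f = C (f.eval 0) + X * f.divX := by
  rw [add_comm, ← coeff_zero_eq_eval_zero, X_mul_divX_add]

/-- The Pearson equation only controls test polynomials divisible by X. Split g = g(0) + X g₁ and
use t g₁(t) = g(t) - g(0): the pairing with g becomes a combination of g(0) and the g(t_k), and the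
kernels represent these evaluations. The unknown pairing with 1 is absorbed in the coefficient of
K(·, 0). -/
theorem derivative_sub_eq_cdKernel (hP : IsOrthoSeq L P) (hL : ∀ p : ℝ[X], p ≠ 0 → 0 < L (p * p))
    {n : ℕ} {f : ℝ[X]} (ε : ℝ)
    (hf : (derivative f - C ε * f).degree < ((n + 1 : ℕ) : WithBot ℕ))
    (h : ∀ g : ℝ[X], g.degree < n → L ((derivative f - C ε * f) * (X * g)) =
      -∑ k, r k * t k * (f.eval (t k) * g.eval (t k))) :
    derivative f - C ε * f =
      C (L (derivative f - C ε * f) + ∑ k, r k * f.eval (t k)) * cdKernel L P (n + 1) 0 -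
        ∑ k, C (r k * f.eval (t k)) * cdKernel L P (n + 1) (t k) := by
  refine hP.eq_cdKernel_of_map hL _ _ _ hf fun g hg => ?_
  have h1 : L ((derivative f - C ε * f) * g) = g.eval 0 * L (derivative f - C ε * f) +
      L ((derivative f - C ε * f) * (X * g.divX)) := by
    conv_lhs => rw [eq_C_add_X_mul_divX g]
    rw [mul_add, map_add, mul_comm _ (C (g.eval 0)), map_C_mul]
  have h2 : ∀ k, r k * f.eval (t k) * g.eval (t k) = g.eval 0 * (r k * f.eval (t k)) +
      r k * t k * (f.eval (t k) * g.divX.eval (t k)) := by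
    intro k
    conv_lhs => rw [eq_C_add_X_mul_divX g]
    simp only [eval_add, eval_mul, eval_C, eval_X]
    ring
  rw [h1, h _ (degree_divX_lt hg), sum_congr rfl fun k _ => h2 k, sum_add_distrib, ← mul_sum]
  ring

/-- Here ε = 0 suffices: P_{n+1} is orthogonal to X g for deg g < n, so the term L(f X g) of the
Pearson equation drops out. -/
theorem derivative_succ_eq (hP : IsOrthoSeq L P) (hL : ∀ p : ℝ[X], p ≠ 0 → 0 < L (p * p))
    (hD : IsPearson L α r t) (n : ℕ) :
    derivative (P (n + 1)) =
      C (L (derivative (P (n + 1))) + ∑ k, r k * (P (n + 1)).eval (t k)) * cdKernel L P (n + 1) 0 -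
        ∑ k, C (r k * (P (n + 1)).eval (t k)) * cdKernel L P (n + 1) (t k) := by
  have h := hP.derivative_sub_eq_cdKernel (n := n) (f := P (n + 1)) (r := r) (t := t) hL 0 ?_ ?_
  · simpa using h
  · rw [C_0, zero_mul, sub_zero, degree_lt_iff_coeff_zero]
    intro i hi
    rw [coeff_derivative, hP.coeff_of_lt (by omega), zero_mul]
  · intro g hg
    have h1 := degree_lt_succ (degree_X_mul_derivative_add_lt hg (1 + α))
    rw [C_0, zero_mul, sub_zero, hD.map_derivative_mul, hP.map_mul_of_degree_lt h1,
      hP.map_mul_of_degree_lt (degree_X_mul_lt hg)]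
    ring

/-- For P_n paired with X g of degree n the term L(P_n X g) survives. Taking ε = 1 cancels it and
allows the same kernel, of degree n, as for P_{n+1}. -/
theorem derivative_sub_self_eq (hP : IsOrthoSeq L P) (hL : ∀ p : ℝ[X], p ≠ 0 → 0 < L (p * p))
    (hD : IsPearson L α r t) (n : ℕ) :
    derivative (P n) - P n =
      C (L (derivative (P n) - P n) + ∑ k, r k * (P n).eval (t k)) * cdKernel L P (n + 1) 0 -
        ∑ k, C (r k * (P n).eval (t k)) * cdKernel L P (n + 1) (t k) := by
  have h := hP.derivative_sub_eq_cdKernel (n := n) (f := P n) (r := r) (t := t) hL 1 ?_ ?_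
  · simpa using h
  · rw [C_1, one_mul, degree_lt_iff_coeff_zero]
    intro i hi
    rw [coeff_sub, coeff_derivative, hP.coeff_of_lt (by omega), hP.coeff_of_lt (by omega)]
    ring
  · intro g hg
    have h1 := degree_X_mul_derivative_add_lt hg (1 + α)
    rw [C_1, one_mul, sub_mul, map_sub, hD.map_derivative_mul, hP.map_mul_of_degree_lt h1]
    ring

/-- Comparison of the leading coefficients in the formula for `P'`. -/
theorem coeff_derivative_succ (hP : IsOrthoSeq L P) (hL : ∀ p : ℝ[X], p ≠ 0 → 0 < L (p * p))
    (hD : IsPearson L α r t) (n : ℕ) :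
    (L (derivative (P (n + 1))) + ∑ k, r k * (P (n + 1)).eval (t k)) * (P n).eval 0 =
      (n + 1) * L (P n * P n) + ∑ k, r k * (P (n + 1)).eval (t k) * (P n).eval (t k) := by
  have hh : L (P n * P n) ≠ 0 := (hL _ (hP.monic n).ne_zero).ne'
  have h := congrArg (fun f => coeff f n) (hP.derivative_succ_eq hL hD n)
  simp only [coeff_derivative, coeff_sub, coeff_C_mul, finsetSum_coeff, hP.coeff_self,
    hP.coeff_cdKernel_succ, ← mul_div_assoc, ← sum_div] at h
  rw [← sub_div, eq_div_iff hh] at h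
  linarith

/-- Comparison of the leading coefficients in the formula for `P' - P`. -/
theorem coeff_derivative_sub_self (hP : IsOrthoSeq L P) (hL : ∀ p : ℝ[X], p ≠ 0 → 0 < L (p * p))
    (hD : IsPearson L α r t) (n : ℕ) :
    (L (derivative (P n) - P n) + ∑ k, r k * (P n).eval (t k)) * (P n).eval 0 =
      -L (P n * P n) + ∑ k, r k * (P n).eval (t k) * (P n).eval (t k) := by
  have hh : L (P n * P n) ≠ 0 := (hL _ (hP.monic n).ne_zero).ne'
  have h := congrArg (fun f => coeff f n) (hP.derivative_sub_self_eq hL hD n)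
  simp only [coeff_derivative, coeff_sub, coeff_C_mul, finsetSum_coeff, hP.coeff_self,
    hP.coeff_cdKernel_succ, ← mul_div_assoc, ← sum_div, hP.coeff_of_lt (Nat.lt_succ_self n)] at h
  rw [← sub_div, eq_div_iff hh] at h
  linarith

/-- A second formula for the coefficient of K(·, 0) in P_n' - P_n, from pairing with P_{n+1} =
P_{n+1}(0) + X g. The pairing is zero by degree, and in the Pearson equation X g' + (1 + α) g has
coefficient n + 1 + α at X^n because g is monic of degree n. Together with the comparison of leading
coefficients it determines P_{n+1}(0) / P_n(0). -/
theorem derivative_sub_self_mul_succ (hP : IsOrthoSeq L P) (hD : IsPearson L α r t) (n : ℕ) :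
    (L (derivative (P n) - P n) + ∑ k, r k * (P n).eval (t k)) * (P (n + 1)).eval 0 =
      (n + 1 + α) * L (P n * P n) + ∑ k, r k * (P n).eval (t k) * (P (n + 1)).eval (t k) := by
  set g := (P (n + 1)).divX with hg
  have hPg : P (n + 1) = C ((P (n + 1)).eval 0) + X * g := eq_C_add_X_mul_divX _
  have hd : (X * derivative g + C (1 + α) * g).degree < ((n + 1 : ℕ) : WithBot ℕ) :=
    degree_X_mul_derivative_add_lt (degree_divX_lt (hP.degree_lt (by omega))) _
  have hgn : g.coeff n = 1 := by rw [hg, coeff_divX, hP.coeff_self]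
  have h1 := hP.map_mul_of_degree_lt_succ hd
  rw [coeff_add, coeff_X_mul_derivative, coeff_C_mul, hgn] at h1
  have h2 : L ((derivative (P n) - P n) * P (n + 1)) = 0 := by
    rw [mul_comm]
    refine hP.map_mul_of_degree_lt ?_
    rw [degree_lt_iff_coeff_zero]
    intro i hi
    rw [coeff_sub, coeff_derivative, hP.coeff_of_lt (by omega), hP.coeff_of_lt (by omega)]
    ring
  have h3 : L ((derivative (P n) - P n) * P (n + 1)) =
      (P (n + 1)).eval 0 * L (derivative (P n) - P n) +
        L ((derivative (P n) - P n) * (X * g)) := by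
    conv_lhs => rw [hPg]
    rw [mul_add, map_add, mul_comm _ (C _), map_C_mul]
  rw [h2, sub_mul (derivative (P n)), map_sub L (derivative (P n) * (X * g)),
    hD.map_derivative_mul, h1] at h3
  have h4 : ∀ k, r k * (P n).eval (t k) * (P (n + 1)).eval (t k) =
      (P (n + 1)).eval 0 * (r k * (P n).eval (t k)) +
        r k * t k * ((P n).eval (t k) * g.eval (t k)) := by
    intro k
    conv_lhs => rw [hPg]
    simp only [eval_add, eval_mul, eval_C, eval_X]
    ring
  rw [sum_congr rfl fun k _ => h4 k, sum_add_distrib, ← mul_sum]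
  linarith

end IsOrthoSeq
end
end LaguerreJump

/-! ### Integration against the Laguerre weight with jumps. -/

namespace LaguerreJump
open Polynomial Finset MeasureTheory Set Filter Topology

noncomputable section

/-- The Laguerre density `x ^ α e ^ (-x)`. -/
def laguerre (α x : ℝ) : ℝ := x ^ α * Real.exp (-x)

theorem laguerre_pos {α x : ℝ} (hx : 0 < x) : 0 < laguerre α x :=
  mul_pos (Real.rpow_pos_of_pos hx _) (Real.exp_pos _)

theorem continuousOn_laguerre (α : ℝ) : ContinuousOn (laguerre α) (Ioi 0) := by
  intro x hx
  have : ContinuousAt (fun x : ℝ => x ^ α) x :=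
    Real.continuousAt_rpow_const _ _ (Or.inl (ne_of_gt hx))
  exact (this.mul (by fun_prop)).continuousWithinAt

theorem integrableOn_eval_mul_laguerre {α : ℝ} (hα : -1 < α) (p : ℝ[X]) :
    IntegrableOn (fun x => p.eval x * laguerre α x) (Ioi 0) := by
  induction p using Polynomial.induction_on' with
  | add p q hp hq =>
    refine (hp.add hq).congr (ae_of_all _ fun x => ?_)
    simp only [Pi.add_apply, eval_add]
    ring
  | monomial i a =>
    have hi : 0 < α + i + 1 := by
      have : (0 : ℝ) ≤ i := i.cast_nonneg
      linarith
    refine ((Real.GammaIntegral_convergent hi).const_mul a).congr ?_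
    filter_upwards [ae_restrict_mem measurableSet_Ioi] with x hx
    rw [add_sub_cancel_right, Real.rpow_add_natCast (ne_of_gt hx), laguerre, eval_monomial]
    ring

variable {E : Type*} [NormedAddCommGroup E]

/-- Continuous functions of at most polynomial growth on `(0, ∞)`. -/
def PolyGrowth (f : ℝ → E) : Prop :=
  Continuous f ∧ ∃ p : ℝ[X], ∀ x > 0, ‖f x‖ ≤ p.eval x

theorem PolyGrowth.add {f g : ℝ → E} (hf : PolyGrowth f) (hg : PolyGrowth g) :
    PolyGrowth (fun x => f x + g x) := by
  obtain ⟨hc, p, hp⟩ := hf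
  obtain ⟨hc', q, hq⟩ := hg
  refine ⟨hc.add hc', p + q, fun x hx => ?_⟩
  rw [eval_add]
  exact (norm_add_le _ _).trans (add_le_add (hp x hx) (hq x hx))

theorem polyGrowth_const (c : E) : PolyGrowth (fun _ : ℝ => c) :=
  ⟨continuous_const, C ‖c‖, fun x _ => by simp⟩

variable [NormedSpace ℝ E]

theorem PolyGrowth.integrableOn {α : ℝ} (hα : -1 < α) {f : ℝ → E} (hf : PolyGrowth f) :
    IntegrableOn (fun x => laguerre α x • f x) (Ioi 0) := by
  obtain ⟨hc, p, hp⟩ := hf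
  refine (integrableOn_eval_mul_laguerre hα p).mono'
    (((continuousOn_laguerre α).smul hc.continuousOn).aestronglyMeasurable measurableSet_Ioi) ?_
  filter_upwards [ae_restrict_mem measurableSet_Ioi] with x hx
  rw [norm_smul, Real.norm_of_nonneg (laguerre_pos hx).le, mul_comm]
  exact mul_le_mul_of_nonneg_right (hp x hx) (laguerre_pos hx).le

/-- The bound |a| ≤ a² + 1 keeps the majorant polynomial. -/
theorem exists_abs_eval_le (p : ℝ[X]) : ∃ q : ℝ[X], ∀ x > 0, |p.eval x| ≤ q.eval x := by
  refine ⟨p ^ 2 + 1, fun x _ => ?_⟩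
  rw [eval_add, eval_pow, eval_one]
  nlinarith [sq_abs (p.eval x), sq_nonneg (|p.eval x| - 1), abs_nonneg (p.eval x)]

theorem PolyGrowth.eval_smul {f : ℝ → E} (hf : PolyGrowth f) (q : ℝ[X]) :
    PolyGrowth (fun x => q.eval x • f x) := by
  obtain ⟨hc, p, hp⟩ := hf
  obtain ⟨q', hq'⟩ := exists_abs_eval_le q
  refine ⟨q.continuous.smul hc, q' * p, fun x hx => ?_⟩
  rw [norm_smul, eval_mul]
  exact mul_le_mul (hq' x hx) (hp x hx) (norm_nonneg _) ((abs_nonneg _).trans (hq' x hx))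

theorem polyGrowth_eval (p : ℝ[X]) : PolyGrowth (fun x : ℝ => p.eval x) := by
  simpa using (polyGrowth_const (1 : ℝ)).eval_smul p

/-- Integration by parts for the Laguerre density on a half-line. -/
theorem integral_Ioi_pearson [CompleteSpace E] {α : ℝ} (hα : -1 < α) {f f' : ℝ → E}
    (hf : PolyGrowth f) (hf' : PolyGrowth f') (hd : ∀ x, HasDerivAt f (f' x) x) {s : ℝ} (hs : 0 ≤ s) :
    ∫ x in Ioi s, laguerre α x • (x • f' x + (1 + α - x) • f x) =
      -((s ^ (α + 1) * Real.exp (-s)) • f s) := by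
  have hsub : Ioi s ⊆ Ioi 0 := Ioi_subset_Ioi hs
  have hder : ∀ x ∈ Ioi s, HasDerivAt (fun x => (x ^ (α + 1) * Real.exp (-x)) • f x)
      (laguerre α x • (x • f' x + (1 + α - x) • f x)) x := by
    intro x hx
    have hx0 : 0 < x := hsub hx
    have h1 := Real.hasDerivAt_rpow_const (x := x) (p := α + 1) (Or.inl hx0.ne')
    have h2 : HasDerivAt (fun x : ℝ => Real.exp (-x)) (Real.exp (-x) * -1) x :=
      (hasDerivAt_neg x).exp
    have h3 := (h1.mul h2).smul (hd x)
    refine h3.congr_deriv ?_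
    rw [add_sub_cancel_right, Real.rpow_add_one hx0.ne', laguerre, smul_add, smul_smul, smul_smul]
    simp only [Pi.mul_apply]
    rw [Real.rpow_add_one hx0.ne']
    congr 1
    · congr 1
      ring
    · congr 1
      ring
  have hF : IntegrableOn (fun x => (x ^ (α + 1) * Real.exp (-x)) • f x) (Ioi s) := by
    refine (IntegrableOn.mono_set ((hf.eval_smul X).integrableOn hα) hsub).congr ?_
    filter_upwards [ae_restrict_mem measurableSet_Ioi] with x hx
    rw [laguerre, eval_X, smul_smul, Real.rpow_add_one (ne_of_gt (hsub hx))]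
    congr 1
    ring
  have hF' : IntegrableOn (fun x => laguerre α x • (x • f' x + (1 + α - x) • f x)) (Ioi s) := by
    have h := ((hf'.eval_smul X).add (hf.eval_smul (C (1 + α) - X))).integrableOn hα
    refine IntegrableOn.mono_set (h.congr (ae_of_all _ fun x => ?_)) hsub
    simp
  have hcont : ContinuousWithinAt (fun x => (x ^ (α + 1) * Real.exp (-x)) • f x) (Ici s) s := by
    have h1 : ContinuousAt (fun x : ℝ => x ^ (α + 1)) s :=
      Real.continuousAt_rpow_const _ _ (Or.inr (by linarith))
    exact ((h1.mul (by fun_prop)).smul hf.1.continuousAt).continuousWithinAt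
  -- The boundary term at infinity vanishes because the function and its derivative are both
  -- integrable; no explicit decay estimate is required.
  have hlim := tendsto_zero_of_hasDerivAt_of_integrableOn_Ioi hder hF' hF
  rw [integral_Ioi_of_hasDerivAt_of_tendsto hcont hder hF' hlim, zero_sub]

variable {m : ℕ}

theorem weight_smul_eq (α : ℝ) (ω : Fin (m + 1) → ℝ) (t : Fin m → ℝ) (f : ℝ → E) (x : ℝ) :
    weight α ω t x • f x = ω 0 • (laguerre α x • f x) +
      ∑ k : Fin m, ω k.succ • (Ioi (t k)).indicator (fun x => laguerre α x • f x) x := by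
  have h : ∀ k : Fin m, ω k.succ • (Ioi (t k)).indicator (fun x => laguerre α x • f x) x =
      (ω k.succ * theta (x - t k) * laguerre α x) • f x := by
    intro k
    by_cases hx : t k < x
    · rw [indicator_of_mem (by exact hx), theta, if_pos (sub_pos.2 hx), smul_smul, mul_one]
    · rw [indicator_of_notMem (by exact hx), theta, if_neg (by simpa using hx)]
      simp
  simp only [h]
  rw [← Finset.sum_smul, smul_smul, ← add_smul, weight, laguerre, ← Finset.sum_mul]
  congr 1
  ring

theorem PolyGrowth.integrableOn_weight {α : ℝ} (hα : -1 < α) (ω : Fin (m + 1) → ℝ) (t : Fin m → ℝ)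
    {f : ℝ → E} (hf : PolyGrowth f) :
    IntegrableOn (fun x => weight α ω t x • f x) (Ioi 0) := by
  simp only [weight_smul_eq]
  refine Integrable.add ((hf.integrableOn hα).smul _) (integrable_finsetSum _ fun k _ => ?_)
  exact ((hf.integrableOn hα).indicator measurableSet_Ioi).smul _

theorem PolyGrowth.integral_weight {α : ℝ} (hα : -1 < α) (ω : Fin (m + 1) → ℝ) {t : Fin m → ℝ}
    (ht : ∀ k, 0 < t k) {f : ℝ → E} (hf : PolyGrowth f) :
    ∫ x in Ioi 0, weight α ω t x • f x = (ω 0 • ∫ x in Ioi 0, laguerre α x • f x) +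
      ∑ k : Fin m, ω k.succ • ∫ x in Ioi (t k), laguerre α x • f x := by
  simp only [weight_smul_eq]
  have hk : ∀ k : Fin m, IntegrableOn (fun x => ω k.succ •
      (Ioi (t k)).indicator (fun x => laguerre α x • f x) x) (Ioi 0) := fun k =>
    ((hf.integrableOn hα).indicator measurableSet_Ioi).smul _
  have h0 : IntegrableOn (fun x => ω 0 • (laguerre α x • f x)) (Ioi 0) :=
    (hf.integrableOn hα).smul _
  rw [integral_add h0 (integrable_finsetSum _ fun k _ => hk k),
    integral_finsetSum _ fun k _ => hk k, integral_smul]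
  congr 1
  refine Finset.sum_congr rfl fun k _ => ?_
  rw [integral_smul, setIntegral_indicator measurableSet_Ioi,
    inter_eq_right.2 (Ioi_subset_Ioi (ht k).le)]

/-- The jump `ω_k t_k ^ α e ^ (-t_k)` of the weight at `t_k`. -/
def jump (α : ℝ) (ω : Fin (m + 1) → ℝ) (t : Fin m → ℝ) (k : Fin m) : ℝ :=
  ω k.succ * laguerre α (t k)

/-- The weight is a combination of Laguerre densities cut off to half-lines (t_k, ∞), so the jumps
appear as boundary terms of the integrations by parts. The boundary term at 0 vanishes since α > -1.
Vector values let the same statement serve polynomials and Cauchy kernels. -/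
theorem integral_weight_pearson [CompleteSpace E] {α : ℝ} (hα : -1 < α) (ω : Fin (m + 1) → ℝ)
    {t : Fin m → ℝ} (ht : ∀ k, 0 < t k) {f f' : ℝ → E}
    (hf : PolyGrowth f) (hf' : PolyGrowth f') (hd : ∀ x, HasDerivAt f (f' x) x) :
    ∫ x in Ioi 0, weight α ω t x • (x • f' x + (1 + α - x) • f x) =
      -∑ k, (jump α ω t k * t k) • f (t k) := by
  have hg : PolyGrowth (fun x => x • f' x + (1 + α - x) • f x) := by
    have h := (hf'.eval_smul X).add (hf.eval_smul (C (1 + α) - X))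
    have e : ∀ x : ℝ, (C (1 + α) - X : ℝ[X]).eval x = 1 + α - x := fun x => by
      rw [eval_sub, eval_C, eval_X]
    simpa only [e, eval_X] using h
  rw [hg.integral_weight hα ω ht, integral_Ioi_pearson hα hf hf' hd le_rfl,
    Real.zero_rpow (by linarith), zero_mul, zero_smul, neg_zero, smul_zero, zero_add,
    ← Finset.sum_neg_distrib]
  refine Finset.sum_congr rfl fun k _ => ?_
  rw [integral_Ioi_pearson hα hf hf' hd (ht k).le, smul_neg, smul_smul,
    Real.rpow_add_one (ht k).ne', jump, laguerre]
  congr 2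
  ring

/-- The functional `p ↦ ∫ p w` on polynomials. -/
def momentFunctional (α : ℝ) (ω : Fin (m + 1) → ℝ) (t : Fin m → ℝ) : ℝ[X] →ₗ[ℝ] ℝ :=
  Polynomial.lsum fun i => (∫ x in Ioi (0 : ℝ), x ^ i * weight α ω t x) • LinearMap.id

theorem integrableOn_eval_mul_weight {α : ℝ} (hα : -1 < α) (ω : Fin (m + 1) → ℝ) (t : Fin m → ℝ)
    (p : ℝ[X]) : IntegrableOn (fun x => p.eval x * weight α ω t x) (Ioi 0) :=
  ((polyGrowth_eval p).integrableOn_weight hα ω t).congr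
    (ae_of_all _ fun x => by simp [mul_comm])

/-- The functional is defined through its moments so that linearity is automatic; integrability,
hence α > -1, enters only in identifying it with the integral. -/
theorem momentFunctional_apply {α : ℝ} (hα : -1 < α) (ω : Fin (m + 1) → ℝ) (t : Fin m → ℝ)
    (p : ℝ[X]) : momentFunctional α ω t p = ∫ x in Ioi (0 : ℝ), p.eval x * weight α ω t x := by
  induction p using Polynomial.induction_on' with
  | add p q hp hq =>
    rw [map_add, hp, hq, ← integral_add (integrableOn_eval_mul_weight hα ω t p)
      (integrableOn_eval_mul_weight hα ω t q)]
    simp only [eval_add, add_mul]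
  | monomial i a =>
    simp only [momentFunctional, lsum_apply, eval_monomial, mul_assoc, integral_const_mul]
    rw [sum_monomial_index _ _ (by simp)]
    simp [mul_comm]

theorem isPearson_momentFunctional {α : ℝ} (hα : -1 < α) (ω : Fin (m + 1) → ℝ)
    {t : Fin m → ℝ} (ht : ∀ k, 0 < t k) :
    IsPearson (momentFunctional α ω t) α (jump α ω t) t := by
  intro f
  have h := integral_weight_pearson hα ω ht (polyGrowth_eval f) (polyGrowth_eval (derivative f))
    (fun x => f.hasDerivAt x)
  rw [momentFunctional_apply hα]
  simp only [smul_eq_mul] at h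
  simp only [eval_add, eval_mul, eval_sub, eval_X, eval_C, mul_comm _ (weight _ _ _ _), h]
  rw [neg_add_cancel]

end
end LaguerreJump

/-! ### Cauchy transforms of polynomials. -/

namespace LaguerreJump
open Polynomial Finset MeasureTheory Set Filter Topology

noncomputable section

variable {m : ℕ}

theorem sub_ne_zero_of_im_ne_zero {z : ℂ} (hz : z.im ≠ 0) (x : ℝ) : (x : ℂ) - z ≠ 0 := by
  intro h
  apply hz
  have := congrArg Complex.im h
  simpa using this

theorem norm_inv_sub_le {z : ℂ} (hz : z.im ≠ 0) (x : ℝ) : ‖((x : ℂ) - z)⁻¹‖ ≤ |z.im|⁻¹ := by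
  rw [norm_inv]
  refine inv_anti₀ (abs_pos.2 hz) ?_
  simpa using Complex.abs_im_le_norm ((x : ℂ) - z)

theorem polyGrowth_inv_sub {z : ℂ} (hz : z.im ≠ 0) : PolyGrowth (fun x : ℝ => ((x : ℂ) - z)⁻¹) :=
  ⟨by
    have := sub_ne_zero_of_im_ne_zero hz
    fun_prop (disch := assumption), C |z.im|⁻¹, fun x _ => by
    rw [eval_C]
    exact norm_inv_sub_le hz x⟩

theorem polyGrowth_inv_sub_sq {z : ℂ} (hz : z.im ≠ 0) :
    PolyGrowth (fun x : ℝ => (((x : ℂ) - z) ^ 2)⁻¹) :=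
  ⟨by
    have : ∀ x : ℝ, ((x : ℂ) - z) ^ 2 ≠ 0 := fun x => pow_ne_zero 2 (sub_ne_zero_of_im_ne_zero hz x)
    fun_prop (disch := assumption), C (|z.im|⁻¹ ^ 2), fun x _ => by
    rw [eval_C]
    change ‖(((x : ℂ) - z) ^ 2)⁻¹‖ ≤ _
    rw [← inv_pow, norm_pow]
    exact pow_le_pow_left₀ (norm_nonneg _) (norm_inv_sub_le hz x) 2⟩

/-- The Cauchy transform `∫ p(x) w(x) / (x - z) dx` of a polynomial. -/
def polyCauchy (α : ℝ) (ω : Fin (m + 1) → ℝ) (t : Fin m → ℝ) (p : ℝ[X]) (z : ℂ) : ℂ :=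
  ∫ x in Ioi (0 : ℝ), ((p.eval x * weight α ω t x : ℝ) : ℂ) / ((x : ℂ) - z)

theorem eval_mul_weight_div (α : ℝ) (ω : Fin (m + 1) → ℝ) (t : Fin m → ℝ) (p : ℝ[X]) (z : ℂ) (x : ℝ) :
    ((p.eval x * weight α ω t x : ℝ) : ℂ) / ((x : ℂ) - z) =
      weight α ω t x • (p.eval x • ((x : ℂ) - z)⁻¹) := by
  rw [Complex.real_smul, Complex.real_smul, Complex.ofReal_mul]
  ring

theorem integrableOn_polyCauchy {α : ℝ} (hα : -1 < α) (ω : Fin (m + 1) → ℝ) (t : Fin m → ℝ)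
    (p : ℝ[X]) {z : ℂ} (hz : z.im ≠ 0) :
    IntegrableOn (fun x : ℝ => ((p.eval x * weight α ω t x : ℝ) : ℂ) / ((x : ℂ) - z)) (Ioi 0) := by
  simp only [eval_mul_weight_div]
  exact ((polyGrowth_inv_sub hz).eval_smul p).integrableOn_weight hα ω t

theorem polyCauchy_add {α : ℝ} (hα : -1 < α) (ω : Fin (m + 1) → ℝ) (t : Fin m → ℝ) (p q : ℝ[X])
    {z : ℂ} (hz : z.im ≠ 0) :
    polyCauchy α ω t (p + q) z = polyCauchy α ω t p z + polyCauchy α ω t q z := by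
  rw [polyCauchy, polyCauchy, polyCauchy, ← integral_add (integrableOn_polyCauchy hα ω t p hz)
    (integrableOn_polyCauchy hα ω t q hz)]
  refine integral_congr_ae (ae_of_all _ fun x => ?_)
  simp only [eval_add]
  push_cast
  ring

theorem polyCauchy_C_mul (α : ℝ) (ω : Fin (m + 1) → ℝ) (t : Fin m → ℝ) (c : ℝ) (p : ℝ[X]) (z : ℂ) :
    polyCauchy α ω t (C c * p) z = c * polyCauchy α ω t p z := by
  rw [polyCauchy, polyCauchy, ← integral_const_mul]
  refine integral_congr_ae (ae_of_all _ fun x => ?_)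
  simp only [eval_mul, eval_C]
  push_cast
  ring

theorem polyCauchy_sub {α : ℝ} (hα : -1 < α) (ω : Fin (m + 1) → ℝ) (t : Fin m → ℝ) (p q : ℝ[X])
    {z : ℂ} (hz : z.im ≠ 0) :
    polyCauchy α ω t (p - q) z = polyCauchy α ω t p z - polyCauchy α ω t q z := by
  have h : p - q = p + C (-1) * q := by simp [sub_eq_add_neg]
  rw [h, polyCauchy_add hα ω t _ _ hz, polyCauchy_C_mul]
  push_cast
  ring

theorem polyCauchy_sum {α : ℝ} (hα : -1 < α) (ω : Fin (m + 1) → ℝ) (t : Fin m → ℝ) {ι : Type*}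
    (s : Finset ι) (p : ι → ℝ[X]) {z : ℂ} (hz : z.im ≠ 0) :
    polyCauchy α ω t (∑ i ∈ s, p i) z = ∑ i ∈ s, polyCauchy α ω t (p i) z := by
  induction s using Finset.cons_induction with
  | empty => simp [polyCauchy]
  | cons a s ha ih => rw [Finset.sum_cons, Finset.sum_cons, polyCauchy_add hα ω t _ _ hz, ih]

theorem polyCauchy_X_sub_C_mul {α : ℝ} (hα : -1 < α) (ω : Fin (m + 1) → ℝ) (t : Fin m → ℝ) (s : ℝ)
    (p : ℝ[X]) {z : ℂ} (hz : z.im ≠ 0) :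
    polyCauchy α ω t ((X - C s) * p) z =
      (momentFunctional α ω t p : ℂ) + (z - s) * polyCauchy α ω t p z := by
  have i1 : IntegrableOn (fun x => ((p.eval x * weight α ω t x : ℝ) : ℂ)) (Ioi 0) :=
    (integrableOn_eval_mul_weight hα ω t p).ofReal
  rw [momentFunctional_apply hα, polyCauchy, polyCauchy, ← integral_const_mul, ← integral_complex_ofReal,
    ← integral_add i1 ((integrableOn_polyCauchy hα ω t p hz).const_mul _)]
  refine integral_congr_ae (ae_of_all _ fun x => ?_)
  have := sub_ne_zero_of_im_ne_zero hz x
  simp only [eval_mul, eval_sub, eval_X, eval_C]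
  push_cast
  field_simp
  ring

theorem hasDerivAt_polyCauchy {α : ℝ} (hα : -1 < α) (ω : Fin (m + 1) → ℝ) (t : Fin m → ℝ)
    (p : ℝ[X]) {z : ℂ} (hz : z.im ≠ 0) :
    HasDerivAt (polyCauchy α ω t p)
      (∫ x in Ioi (0 : ℝ), weight α ω t x • (p.eval x • (((x : ℂ) - z) ^ 2)⁻¹)) z := by
  -- On the disc of radius |Im z| / 2 the imaginary part stays at least |Im z| / 2 in modulus, which
  -- bounds the differentiated kernel uniformly.
  have hz' : 0 < |z.im| / 2 := half_pos (abs_pos.2 hz)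
  have him : ∀ ζ ∈ Metric.ball z (|z.im| / 2), |z.im| / 2 ≤ |ζ.im| := by
    intro ζ hζ
    have h1 : |ζ.im - z.im| < |z.im| / 2 :=
      (Complex.abs_im_le_norm (ζ - z)).trans_lt (by simpa [dist_eq_norm] using hζ)
    have h2 := abs_sub_abs_le_abs_sub z.im ζ.im
    rw [abs_sub_comm] at h2
    linarith
  have him0 : ∀ ζ ∈ Metric.ball z (|z.im| / 2), ζ.im ≠ 0 := fun ζ hζ =>
    abs_pos.1 (hz'.trans_le (him ζ hζ))
  have hball := Metric.ball_mem_nhds z hz'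
  refine (hasDerivAt_integral_of_dominated_loc_of_deriv_le (s := Metric.ball z (|z.im| / 2))
    (bound := fun x => |p.eval x * weight α ω t x| * ((|z.im| / 2)⁻¹) ^ 2)
    (F' := fun ζ x => weight α ω t x • (p.eval x • (((x : ℂ) - ζ) ^ 2)⁻¹)) hball ?_ ?_ ?_ ?_ ?_ ?_).2
  · filter_upwards [hball] with ζ hζ
    exact (integrableOn_polyCauchy hα ω t p (him0 ζ hζ)).aestronglyMeasurable
  · exact integrableOn_polyCauchy hα ω t p hz
  · exact (((polyGrowth_inv_sub_sq hz).eval_smul p).integrableOn_weight hα ω t).aestronglyMeasurable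
  · refine ae_of_all _ fun x ζ hζ => ?_
    rw [smul_smul, norm_smul, Real.norm_eq_abs, mul_comm (p.eval x), ← inv_pow, norm_pow]
    refine mul_le_mul_of_nonneg_left (pow_le_pow_left₀ (norm_nonneg _) ?_ 2) (abs_nonneg _)
    exact (norm_inv_sub_le (him0 ζ hζ) x).trans (inv_anti₀ hz' (him ζ hζ))
  · exact (integrableOn_eval_mul_weight hα ω t p).abs.mul_const _
  · refine ae_of_all _ fun x ζ hζ => ?_
    have hne := sub_ne_zero_of_im_ne_zero (him0 ζ hζ) x
    have h := ((hasDerivAt_id ζ).const_sub (x : ℂ)).inv hne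
    have h2 := h.const_mul (((p.eval x * weight α ω t x : ℝ) : ℂ))
    simp only [div_eq_mul_inv]
    refine h2.congr_deriv ?_
    rw [Complex.real_smul, Complex.real_smul]
    simp only [id]
    push_cast
    field_simp

/-- Integration by parts with f(x) = p(x) / (x - z). Since x (x - z)⁻² = (x - z)⁻¹ + z (x - z)⁻²,
the derivative of the Cauchy kernel yields z times the derivative of the transform and lowers 1 + α
to α. -/
theorem polyCauchy_pearson {α : ℝ} (hα : -1 < α) (ω : Fin (m + 1) → ℝ) {t : Fin m → ℝ}
    (ht : ∀ k, 0 < t k) (p : ℝ[X]) {z : ℂ} (hz : z.im ≠ 0) :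
    z * (∫ x in Ioi (0 : ℝ), weight α ω t x • (p.eval x • (((x : ℂ) - z) ^ 2)⁻¹)) =
      polyCauchy α ω t (X * derivative p) z + α * polyCauchy α ω t p z -
        polyCauchy α ω t (X * p) z +
        ∑ k, ((jump α ω t k * t k * p.eval (t k) : ℝ) : ℂ) / ((t k : ℂ) - z) := by
  have hd : ∀ x : ℝ, HasDerivAt (fun x : ℝ => p.eval x • ((x : ℂ) - z)⁻¹)
      ((derivative p).eval x • ((x : ℂ) - z)⁻¹ + (-p).eval x • (((x : ℂ) - z) ^ 2)⁻¹) x := by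
    intro x
    have h1 : HasDerivAt (fun x : ℝ => ((x : ℂ) - z)) 1 x :=
      (Complex.ofRealCLM.hasDerivAt (x := x)).sub_const z
    have h2 := h1.inv (sub_ne_zero_of_im_ne_zero hz x)
    refine ((p.hasDerivAt x).smul h2).congr_deriv ?_
    simp only [Complex.real_smul, eval_neg, Pi.inv_apply]
    push_cast
    ring
  have h := integral_weight_pearson hα ω ht ((polyGrowth_inv_sub hz).eval_smul p)
    (((polyGrowth_inv_sub hz).eval_smul (derivative p)).add
      ((polyGrowth_inv_sub_sq hz).eval_smul (-p))) hd
  have i2 := ((polyGrowth_inv_sub_sq hz).eval_smul p).integrableOn_weight hα ω t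
  have i1 := integrableOn_polyCauchy hα ω t (X * derivative p + C α * p - X * p) hz
  have e : ∀ x : ℝ, weight α ω t x • (x • ((derivative p).eval x • ((x : ℂ) - z)⁻¹ +
      (-p).eval x • (((x : ℂ) - z) ^ 2)⁻¹) + (1 + α - x) • (p.eval x • ((x : ℂ) - z)⁻¹)) =
      (((X * derivative p + C α * p - X * p).eval x * weight α ω t x : ℝ) : ℂ) / ((x : ℂ) - z) -
        z * (weight α ω t x • (p.eval x • (((x : ℂ) - z) ^ 2)⁻¹)) := by
    intro x
    have := sub_ne_zero_of_im_ne_zero hz x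
    simp only [Complex.real_smul, eval_neg, eval_add, eval_sub, eval_mul, eval_X, eval_C]
    push_cast
    field_simp
    ring
  simp only [e] at h
  rw [integral_sub i1 (i2.const_mul z), integral_const_mul] at h
  have h3 : polyCauchy α ω t (X * derivative p + C α * p - X * p) z =
      polyCauchy α ω t (X * derivative p) z + α * polyCauchy α ω t p z -
        polyCauchy α ω t (X * p) z := by
    rw [polyCauchy_sub hα ω t _ _ hz, polyCauchy_add hα ω t _ _ hz, polyCauchy_C_mul]
  rw [← h3, polyCauchy]
  have h4 : ∑ k, (jump α ω t k * t k) • (p.eval (t k) • ((t k : ℂ) - z)⁻¹) =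
      ∑ k, ((jump α ω t k * t k * p.eval (t k) : ℝ) : ℂ) / ((t k : ℂ) - z) := by
    refine Finset.sum_congr rfl fun k _ => ?_
    simp only [Complex.real_smul]
    push_cast
    ring
  rw [h4] at h
  rw [eq_neg_iff_add_eq_zero] at h
  linear_combination -h

/-! ### Positivity of the weight and of its functional. -/

/-- The jump factor `ω₀ + ∑ ωₖ θ(x - tₖ)` is one of the partial sums of the `ωₖ`. -/
theorem weight_eq_of_iff (α : ℝ) (ω : Fin (m + 1) → ℝ) {t : Fin m → ℝ} {x : ℝ} {l : Fin (m + 1)}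
    (h : ∀ k : Fin m, t k < x ↔ k.succ ≤ l) :
    weight α ω t x = laguerre α x * ∑ k ∈ Finset.Iic l, ω k := by
  have h1 : ∑ k ∈ Finset.Iic l, ω k = ∑ k, if k ≤ l then ω k else 0 := by
    rw [← Finset.sum_filter]
    refine Finset.sum_congr ?_ fun _ _ => rfl
    ext k
    simp
  rw [weight, laguerre, h1, Fin.sum_univ_succ, if_pos (Fin.zero_le l)]
  congr 2
  refine Finset.sum_congr rfl fun k _ => ?_
  by_cases hk : t k < x
  · rw [theta, if_pos (sub_pos.2 hk), if_pos ((h k).1 hk), mul_one]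
  · rw [theta, if_neg (by simpa using hk), if_neg fun h' => hk ((h k).2 h'), mul_zero]

theorem weight_nonneg {α : ℝ} {ω : Fin (m + 1) → ℝ} (hω : ∀ l, 0 ≤ ∑ k ∈ Finset.Iic l, ω k)
    {t : Fin m → ℝ} (ht : StrictMono t) {x : ℝ} (hx : 0 < x) : 0 ≤ weight α ω t x := by
  -- The partial sum in force at x ends at the last jump below x. If there is none, the supremum of
  -- the empty set is 0, which leaves ω₀ alone.
  let s : Finset (Fin m) := Finset.univ.filter fun k => t k < x
  have h : ∀ k : Fin m, t k < x ↔ k.succ ≤ s.sup Fin.succ := by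
    intro k
    refine ⟨fun hk => Finset.le_sup (f := Fin.succ) (by simpa [s] using hk), fun hk => ?_⟩
    have hne : s.Nonempty := by
      by_contra hs
      rw [Finset.not_nonempty_iff_eq_empty] at hs
      rw [hs, Finset.sup_empty] at hk
      exact (Fin.succ_ne_zero k) (le_antisymm hk bot_le)
    obtain ⟨i, hi, hi'⟩ := Finset.exists_mem_eq_sup s hne Fin.succ
    rw [hi', Fin.succ_le_succ_iff] at hk
    exact (ht.monotone hk).trans_lt (by simpa [s] using hi)
  rw [weight_eq_of_iff α ω h]
  exact mul_nonneg (laguerre_pos hx).le (hω _)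

theorem exists_interval_weight_pos [NeZero m] (α : ℝ) {ω : Fin (m + 1) → ℝ}
    (hω : ∀ l, 0 ≤ ∑ k ∈ Finset.Iic l, ω k) (hω' : ω ≠ 0) {t : Fin m → ℝ} (ht0 : ∀ k, 0 < t k)
    (ht : StrictMono t) : ∃ a b : ℝ, 0 ≤ a ∧ a < b ∧ ∀ x ∈ Ioo a b, 0 < weight α ω t x := by
  -- If all partial sums vanished, their successive differences, which are the ω_k, would vanish
  -- too.
  obtain ⟨l, hl⟩ : ∃ l, ∑ k ∈ Finset.Iic l, ω k ≠ 0 := by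
    by_contra! h
    apply hω'
    funext l
    induction l using WellFoundedLT.induction with
    | _ l ih =>
      have h1 := h l
      rwa [Finset.sum_eq_single_of_mem l (by simp) fun k hk hkl =>
        ih k (lt_of_le_of_ne (Finset.mem_Iic.1 hk) hkl)] at h1
  have hl' : 0 < ∑ k ∈ Finset.Iic l, ω k := lt_of_le_of_ne (hω l) hl.symm
  suffices h : ∃ a b : ℝ, 0 ≤ a ∧ a < b ∧ ∀ x ∈ Ioo a b, ∀ k : Fin m, t k < x ↔ k.succ ≤ l by
    obtain ⟨a, b, ha, hab, h⟩ := h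
    refine ⟨a, b, ha, hab, fun x hx => ?_⟩
    rw [weight_eq_of_iff α ω (h x hx)]
    exact mul_pos (laguerre_pos (ha.trans_lt hx.1)) hl'
  induction l using Fin.cases with
  | zero =>
    refine ⟨0, t 0, le_rfl, ht0 0, fun x hx k => ⟨fun hk => ?_, fun hk => ?_⟩⟩
    · exact absurd (ht.monotone (Fin.zero_le k)) (not_le.2 (hk.trans hx.2))
    · exact absurd (le_antisymm hk (Fin.zero_le _)) (Fin.succ_ne_zero k)
  | succ i =>
    -- The interval ends at the next jump; after the last jump any length will do.
    by_cases hi : (i : ℕ) + 1 < m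
    · refine ⟨t i, t ⟨i + 1, hi⟩, (ht0 i).le, ht (by simp [Fin.lt_def]), fun x hx k => ?_⟩
      rw [Fin.succ_le_succ_iff]
      refine ⟨fun hk => ?_, fun hk => (ht.monotone hk).trans_lt hx.1⟩
      have h1 := ht.lt_iff_lt.1 (hk.trans hx.2)
      rw [Fin.lt_def] at h1
      exact Fin.le_def.2 (Nat.lt_succ_iff.1 h1)
    · refine ⟨t i, t i + 1, (ht0 i).le, by linarith, fun x hx k => ?_⟩
      rw [Fin.succ_le_succ_iff]
      refine ⟨fun _ => Fin.le_def.2 ?_, fun hk => (ht.monotone hk).trans_lt hx.1⟩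
      have := k.2
      omega

/-- The functional of the weight is positive on nonzero polynomials that are nonnegative on
`(0, ∞)`. -/
theorem momentFunctional_pos [NeZero m] {α : ℝ} (hα : -1 < α) {ω : Fin (m + 1) → ℝ}
    (hω : ∀ l, 0 ≤ ∑ k ∈ Finset.Iic l, ω k) (hω' : ω ≠ 0) {t : Fin m → ℝ} (ht0 : ∀ k, 0 < t k)
    (ht : StrictMono t) {p : ℝ[X]} (hp : p ≠ 0) (hp0 : ∀ x > 0, 0 ≤ p.eval x) :
    0 < momentFunctional α ω t p := by
  rw [momentFunctional_apply hα, setIntegral_pos_iff_support_of_nonneg_ae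
    ((ae_restrict_mem measurableSet_Ioi).mono fun x hx =>
      mul_nonneg (hp0 x hx) (weight_nonneg hω ht hx)) (integrableOn_eval_mul_weight hα ω t p)]
  obtain ⟨a, b, ha, hab, h⟩ := exists_interval_weight_pos α hω hω' ht0 ht
  -- Removing the finitely many roots of p from an interval where w > 0 leaves a set of positive
  -- measure in the support.
  have hsub : Ioo a b \ {x | p.IsRoot x} ⊆
      Function.support (fun x => p.eval x * weight α ω t x) ∩ Ioi 0 := fun x hx =>
    ⟨mul_ne_zero hx.2 (h x hx.1).ne', ha.trans_lt hx.1.1⟩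
  refine lt_of_lt_of_le ?_ (measure_mono hsub)
  rw [measure_sdiff_null ((finite_setOfPred_isRoot hp).measure_zero _), Real.volume_Ioo,
    ENNReal.ofReal_pos]
  linarith

end
end LaguerreJump

/-! ### Calculus of the operator δ on functions and on families of polynomials. -/

namespace LaguerreJump
open Polynomial Finset MeasureTheory Set Filter Topology

noncomputable section

variable {m : ℕ}

/-- δ at t is the derivative in the direction of t itself, so its calculus is that of a single
directional derivative. -/
theorem delta_eq_fderiv_self (f : (Fin m → ℝ) → ℝ) (t : Fin m → ℝ) : delta f t = fderiv ℝ f t t := by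
  rw [delta, ← ContinuousLinearMap.coe_coe,
    LinearMap.pi_apply_eq_sum_univ (fderiv ℝ f t : (Fin m → ℝ) →ₗ[ℝ] ℝ) t]
  refine Finset.sum_congr rfl fun k _ => ?_
  rw [smul_eq_mul]
  congr 2
  ext j
  simp [Pi.single_apply, eq_comm]

/-- `f` is differentiable at `t` with `δ f = c` there. -/
def HasDelta (f : (Fin m → ℝ) → ℝ) (c : ℝ) (t : Fin m → ℝ) : Prop :=
  ∃ f' : (Fin m → ℝ) →L[ℝ] ℝ, HasFDerivAt f f' t ∧ f' t = c

namespace HasDelta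

variable {f g : (Fin m → ℝ) → ℝ} {a b : ℝ} {t : Fin m → ℝ}

theorem differentiableAt (hf : HasDelta f a t) : DifferentiableAt ℝ f t := by
  obtain ⟨f', hf, -⟩ := hf
  exact hf.differentiableAt

theorem delta_eq (hf : HasDelta f a t) : delta f t = a := by
  obtain ⟨f', hf, rfl⟩ := hf
  rw [delta_eq_fderiv_self, hf.fderiv]

theorem unique (hf : HasDelta f a t) (hf' : HasDelta f b t) : a = b :=
  hf.delta_eq.symm.trans hf'.delta_eq

theorem congr (hf : HasDelta f a t) (h : g =ᶠ[𝓝 t] f) : HasDelta g a t := by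
  obtain ⟨f', hf, rfl⟩ := hf
  exact ⟨f', hf.congr_of_eventuallyEq h, rfl⟩

theorem congr_delta (hf : HasDelta f a t) (h : a = b) : HasDelta f b t := h ▸ hf

theorem const (c : ℝ) (t : Fin m → ℝ) : HasDelta (fun _ => c) 0 t :=
  ⟨0, hasFDerivAt_const c t, rfl⟩

theorem coord (t : Fin m → ℝ) (k : Fin m) : HasDelta (fun s => s k) (t k) t :=
  ⟨ContinuousLinearMap.proj k, hasFDerivAt_apply k t, rfl⟩

theorem add (hf : HasDelta f a t) (hg : HasDelta g b t) : HasDelta (fun s => f s + g s) (a + b) t := by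
  obtain ⟨f', hf, rfl⟩ := hf
  obtain ⟨g', hg, rfl⟩ := hg
  exact ⟨f' + g', hf.add hg, rfl⟩

theorem mul (hf : HasDelta f a t) (hg : HasDelta g b t) :
    HasDelta (fun s => f s * g s) (a * g t + f t * b) t := by
  obtain ⟨f', hf, rfl⟩ := hf
  obtain ⟨g', hg, rfl⟩ := hg
  exact ⟨_, hf.mul hg, by simp [mul_comm, add_comm]⟩

theorem sum {ι : Type*} {u : Finset ι} {f : ι → (Fin m → ℝ) → ℝ} {a : ι → ℝ}
    (hf : ∀ i ∈ u, HasDelta (f i) (a i) t) : HasDelta (fun s => ∑ i ∈ u, f i s) (∑ i ∈ u, a i) t := by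
  choose! f' hf hf' using hf
  refine ⟨∑ i ∈ u, f' i, HasFDerivAt.fun_sum hf, ?_⟩
  rw [_root_.sum_apply]
  exact Finset.sum_congr rfl hf'

/-- The chain rule for `δ`. -/
theorem comp (hf : HasDelta f a t) {φ : ℝ → ℝ} {φ' : ℝ} (hφ : HasDerivAt φ φ' (f t)) :
    HasDelta (fun s => φ (f s)) (φ' * a) t := by
  obtain ⟨f', hf, rfl⟩ := hf
  exact ⟨_, hφ.comp_hasFDerivAt t hf, rfl⟩

theorem pow (hf : HasDelta f a t) (i : ℕ) : HasDelta (fun s => f s ^ i) (i * f t ^ (i - 1) * a) t :=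
  hf.comp (hasDerivAt_pow i (f t))

theorem div (hf : HasDelta f a t) (hg : HasDelta g b t) (h : g t ≠ 0) :
    HasDelta (fun s => f s / g s) ((a * g t - f t * b) / g t ^ 2) t := by
  have h1 := hf.mul (hg.comp (hasDerivAt_inv h))
  simp only [div_eq_mul_inv] at h1 ⊢
  refine h1.congr_delta ?_
  field_simp
  ring

theorem log (hf : HasDelta f a t) (h : f t ≠ 0) : HasDelta (fun s => Real.log (f s)) (a / f t) t := by
  rw [div_eq_inv_mul]
  exact hf.comp (Real.hasDerivAt_log h)

end HasDelta

theorem isOpen_setOf_pos_strictMono :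
    IsOpen {s : Fin m → ℝ | (∀ k, 0 < s k) ∧ StrictMono s} := by
  have h : {s : Fin m → ℝ | (∀ k, 0 < s k) ∧ StrictMono s} =
      (⋂ k, {s | 0 < s k}) ∩ ⋂ j, ⋂ k, ⋂ _ : j < k, {s | s j < s k} := by
    ext s
    simp only [Set.mem_inter_iff, Set.mem_iInter, Set.mem_ofPred_eq]
    exact Iff.rfl
  rw [h]
  refine (isOpen_iInter_of_finite fun k => isOpen_lt continuous_const (continuous_apply k)).inter ?_
  exact isOpen_iInter_of_finite fun j => isOpen_iInter_of_finite fun k =>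
    isOpen_iInter_of_finite fun _ => isOpen_lt (continuous_apply j) (continuous_apply k)

/-- Only the lower limit moves; the extra factor t_k is the weight of ∂/∂t_k in δ. -/
theorem hasDelta_integral_Ioi {α : ℝ} (hα : -1 < α) (p : ℝ[X]) {t : Fin m → ℝ}
    (ht : ∀ k, 0 < t k) (k : Fin m) :
    HasDelta (fun s => ∫ x in Ioi (s k), laguerre α x • p.eval x)
      (-(laguerre α (t k) * t k * p.eval (t k))) t := by
  have hint := (polyGrowth_eval p).integrableOn hα
  have hcont : ContinuousOn (fun x => laguerre α x • p.eval x) (Ioi 0) :=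
    (continuousOn_laguerre α).smul p.continuous.continuousOn
  have hI : ∀ s : ℝ, 0 < s → IntervalIntegrable (fun x => laguerre α x • p.eval x) volume 0 s :=
    fun s hs => (intervalIntegrable_iff_integrableOn_Ioc_of_le hs.le).2
      (hint.mono_set Ioc_subset_Ioi_self)
  have hd : HasDerivAt (fun s => (∫ x in Ioi 0, laguerre α x • p.eval x) -
      ∫ x in (0 : ℝ)..s, laguerre α x • p.eval x) (-(laguerre α (t k) • p.eval (t k))) (t k) := by
    refine (intervalIntegral.integral_hasDerivAt_right (hI _ (ht k)) ?_
      (hcont.continuousAt (Ioi_mem_nhds (ht k)))).const_sub _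
    exact hcont.stronglyMeasurableAtFilter isOpen_Ioi _ (ht k)
  have h := ((HasDelta.coord t k).comp hd).congr_delta
    (b := -(laguerre α (t k) * t k * p.eval (t k))) (by rw [smul_eq_mul]; ring)
  refine h.congr ?_
  have hev : ∀ᶠ s : Fin m → ℝ in 𝓝 t, 0 < s k :=
    (continuous_apply k).continuousAt.eventually (lt_mem_nhds (ht k))
  filter_upwards [hev] with s hs
  rw [← intervalIntegral.integral_interval_add_Ioi hint (hint.mono_set (Ioi_subset_Ioi hs.le))]
  ring

theorem hasDelta_momentFunctional_const {α : ℝ} (hα : -1 < α) (ω : Fin (m + 1) → ℝ) (p : ℝ[X])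
    {t : Fin m → ℝ} (ht : ∀ k, 0 < t k) :
    HasDelta (fun s => momentFunctional α ω s p) (-∑ k, jump α ω t k * t k * p.eval (t k)) t := by
  have h := (HasDelta.const (ω 0 • ∫ x in Ioi 0, laguerre α x • p.eval x) t).add
    (HasDelta.sum (u := Finset.univ) fun k _ =>
      (HasDelta.const (ω (Fin.succ k)) t).mul (hasDelta_integral_Ioi hα p ht k))
  refine (h.congr ?_).congr_delta ?_
  · have hev : ∀ᶠ s : Fin m → ℝ in 𝓝 t, ∀ k, 0 < s k := eventually_all.2 fun k =>
      (continuous_apply k).continuousAt.eventually (lt_mem_nhds (ht k))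
    filter_upwards [hev] with s hs
    rw [momentFunctional_apply hα]
    have := (polyGrowth_eval p).integral_weight hα ω hs
    simp only [smul_eq_mul] at this ⊢
    simp only [← this, mul_comm]
  · rw [zero_add, ← Finset.sum_neg_distrib]
    refine Finset.sum_congr rfl fun k _ => ?_
    rw [jump]
    ring

/-- The coefficients of the polynomials `p s` are differentiable at `t`, the degrees are bounded
near `t`, and `q` is the polynomial whose coefficients are the images of those of `p` under `δ`. -/
structure HasDeltaPoly (p : (Fin m → ℝ) → ℝ[X]) (q : ℝ[X]) (t : Fin m → ℝ) : Prop where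
  bound : ∃ N : ℕ, ∀ᶠ s in 𝓝 t, ∀ i, N ≤ i → (p s).coeff i = 0
  coeff : ∀ i, HasDelta (fun s => (p s).coeff i) (q.coeff i) t

namespace HasDeltaPoly

variable {p p' : (Fin m → ℝ) → ℝ[X]} {q q' : ℝ[X]} {t : Fin m → ℝ}

theorem congr (hp : HasDeltaPoly p q t) (h : p' =ᶠ[𝓝 t] p) : HasDeltaPoly p' q t := by
  obtain ⟨N, hN⟩ := hp.bound
  refine ⟨⟨N, ?_⟩, fun i => (hp.coeff i).congr ?_⟩
  · filter_upwards [hN, h] with s h1 h2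
    rwa [h2]
  · filter_upwards [h] with s hs
    rw [hs]

theorem const (p : ℝ[X]) (t : Fin m → ℝ) : HasDeltaPoly (fun _ => p) 0 t :=
  ⟨⟨p.natDegree + 1, Eventually.of_forall fun _ _ hi => coeff_eq_zero_of_natDegree_lt hi⟩,
    fun i => by
      rw [coeff_zero]
      exact HasDelta.const _ t⟩

theorem C_family {f : (Fin m → ℝ) → ℝ} {a : ℝ} (hf : HasDelta f a t) :
    HasDeltaPoly (fun s => C (f s)) (C a) t := by
  refine ⟨⟨1, Eventually.of_forall fun s i hi => ?_⟩, fun i => ?_⟩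
  · rw [coeff_C, if_neg (by omega)]
  · simp only [coeff_C]
    split_ifs
    · exact hf
    · exact HasDelta.const _ t

theorem add (hp : HasDeltaPoly p q t) (hp' : HasDeltaPoly p' q' t) :
    HasDeltaPoly (fun s => p s + p' s) (q + q') t := by
  obtain ⟨N, hN⟩ := hp.bound
  obtain ⟨N', hN'⟩ := hp'.bound
  refine ⟨⟨max N N', ?_⟩, fun i => ?_⟩
  · filter_upwards [hN, hN'] with s h1 h2 i hi
    rw [coeff_add, h1 i (le_of_max_le_left hi), h2 i (le_of_max_le_right hi), add_zero]
  · simp only [coeff_add]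
    exact (hp.coeff i).add (hp'.coeff i)

theorem mul (hp : HasDeltaPoly p q t) (hp' : HasDeltaPoly p' q' t) :
    HasDeltaPoly (fun s => p s * p' s) (q * p' t + p t * q') t := by
  obtain ⟨N, hN⟩ := hp.bound
  obtain ⟨N', hN'⟩ := hp'.bound
  refine ⟨⟨N + N', ?_⟩, fun i => ?_⟩
  · filter_upwards [hN, hN'] with s h1 h2 i hi
    rw [coeff_mul]
    refine Finset.sum_eq_zero fun x hx => ?_
    have hx' := Finset.HasAntidiagonal.mem_antidiagonal.1 hx
    rcases le_or_gt N x.1 with h | h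
    · rw [h1 _ h, zero_mul]
    · rw [h2 _ (by omega), mul_zero]
  · simp only [coeff_mul, coeff_add, ← Finset.sum_add_distrib]
    exact HasDelta.sum fun x _ => (hp.coeff x.1).mul (hp'.coeff x.2)

theorem sub (hp : HasDeltaPoly p q t) (hp' : HasDeltaPoly p' q' t) :
    HasDeltaPoly (fun s => p s - p' s) (q - q') t := by
  have h := hp.add ((const (-1) t).mul hp')
  simpa [sub_eq_add_neg] using h

theorem sum {ι : Type*} {u : Finset ι} {p : ι → (Fin m → ℝ) → ℝ[X]} {q : ι → ℝ[X]}
    (hp : ∀ i ∈ u, HasDeltaPoly (p i) (q i) t) :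
    HasDeltaPoly (fun s => ∑ i ∈ u, p i s) (∑ i ∈ u, q i) t := by
  induction u using Finset.cons_induction with
  | empty => simpa using const 0 t
  | cons a u ha ih =>
    simp only [Finset.sum_cons]
    exact (hp a (Finset.mem_cons_self a u)).add
      (ih fun i hi => hp i (Finset.mem_cons_of_mem hi))

theorem exists_natDegree_lt (hp : HasDeltaPoly p q t) :
    ∃ N, (∀ᶠ s in 𝓝 t, (p s).natDegree < N) ∧ q.natDegree < N := by
  obtain ⟨N, hN⟩ := hp.bound
  refine ⟨N + 1, ?_, ?_⟩
  · filter_upwards [hN] with s hs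
    exact Nat.lt_succ_of_le (natDegree_le_iff_coeff_eq_zero.2 fun i hi => hs i hi.le)
  · refine Nat.lt_succ_of_le (natDegree_le_iff_coeff_eq_zero.2 fun i hi => ?_)
    refine (hp.coeff i).unique ((HasDelta.const 0 t).congr ?_)
    filter_upwards [hN] with s hs
    exact hs i hi.le

/-- The moving evaluation point adds a derivative term. For x = t_k the result is (δ + x d/dx) p at
t_k, the combination in which the poles later cancel. -/
theorem eval (hp : HasDeltaPoly p q t) {x : (Fin m → ℝ) → ℝ} {a : ℝ} (hx : HasDelta x a t) :
    HasDelta (fun s => (p s).eval (x s)) (q.eval (x t) + a * (derivative (p t)).eval (x t)) t := by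
  obtain ⟨N, hN, hq⟩ := hp.exists_natDegree_lt
  have h := HasDelta.sum (u := Finset.range N) fun i _ => (hp.coeff i).mul (hx.pow i)
  refine (h.congr ?_).congr_delta ?_
  · filter_upwards [hN] with s hs
    exact eval_eq_sum_range' hs _
  · have h1 : derivative (p t) = ∑ i ∈ Finset.range N, derivative (monomial i ((p t).coeff i)) := by
      conv_lhs => rw [as_sum_range' (p t) N hN.self_of_nhds]
      rw [derivative_sum]
    rw [Finset.sum_add_distrib, eval_eq_sum_range' hq, h1, eval_finsetSum, Finset.mul_sum]
    congr 1
    refine Finset.sum_congr rfl fun i _ => ?_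
    rw [derivative_monomial, eval_monomial]
    ring

/-- Product rule: the coefficients of the polynomial vary, and so does the weight, whose variation
consists of point masses at the jumps. -/
theorem momentFunctional {α : ℝ} (hα : -1 < α) (ω : Fin (m + 1) → ℝ) (ht : ∀ k, 0 < t k)
    (hp : HasDeltaPoly p q t) :
    HasDelta (fun s => momentFunctional α ω s (p s))
      (LaguerreJump.momentFunctional α ω t q -
        ∑ k, jump α ω t k * t k * (p t).eval (t k)) t := by
  obtain ⟨N, hN, hq⟩ := hp.exists_natDegree_lt
  have hL : ∀ (s : Fin m → ℝ) (f : ℝ[X]), f.natDegree < N → LaguerreJump.momentFunctional α ω s f =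
      ∑ i ∈ Finset.range N, f.coeff i * LaguerreJump.momentFunctional α ω s (X ^ i) := by
    intro s f hf
    conv_lhs => rw [as_sum_range_C_mul_X_pow' f hf]
    rw [map_sum]
    exact Finset.sum_congr rfl fun i _ => map_C_mul _ _ _
  have h := HasDelta.sum (u := Finset.range N) fun i _ => (hp.coeff i).mul
    (hasDelta_momentFunctional_const hα ω (X ^ i) ht)
  refine (h.congr ?_).congr_delta ?_
  · filter_upwards [hN] with s hs
    exact hL s _ hs
  · rw [Finset.sum_add_distrib, hL t q hq, sub_eq_add_neg]
    congr 1
    simp only [eval_eq_sum_range' hN.self_of_nhds, mul_neg, Finset.sum_neg_distrib, Finset.mul_sum]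
    rw [Finset.sum_comm]
    congr 1
    refine Finset.sum_congr rfl fun i _ => Finset.sum_congr rfl fun k _ => ?_
    rw [eval_pow, eval_X]
    ring

end HasDeltaPoly

/-! ### The polynomials of the weight as an orthogonal sequence. -/

theorem isMonicOrthogonal_iff {α : ℝ} {ω : Fin (m + 1) → ℝ} {t : Fin m → ℝ} (hα : -1 < α) (P : ℕ → ℝ[X]) :
    IsMonicOrthogonal (weight α ω t) P ↔ IsOrthoSeq (momentFunctional α ω t) P := by
  have h : ∀ j k, ∫ x in Set.Ioi (0 : ℝ), (P j).eval x * (P k).eval x * weight α ω t x =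
      momentFunctional α ω t (P j * P k) := fun j k => by
    rw [momentFunctional_apply hα]
    simp only [eval_mul]
  simp only [IsMonicOrthogonal, h]
  exact ⟨fun H => ⟨fun n => (H.1 n).1, fun n => (H.1 n).2, H.2⟩,
    fun H => ⟨fun n => ⟨H.monic n, H.natDegree n⟩, H.orth⟩⟩

section Ortho

variable [NeZero m] {α : ℝ} {ω : Fin (m + 1) → ℝ} {t : Fin m → ℝ}

theorem momentFunctional_sq_pos (hα : -1 < α) (hω : ∀ l, 0 ≤ ∑ k ∈ Finset.Iic l, ω k) (hω' : ω ≠ 0)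
    (ht0 : ∀ k, 0 < t k) (ht : StrictMono t) (p : ℝ[X]) (hp : p ≠ 0) :
    0 < momentFunctional α ω t (p * p) :=
  momentFunctional_pos hα hω hω' ht0 ht (mul_ne_zero hp hp) fun x _ => by
    rw [eval_mul]
    exact mul_self_nonneg _

theorem momentFunctional_X_mul_sq_pos (hα : -1 < α) (hω : ∀ l, 0 ≤ ∑ k ∈ Finset.Iic l, ω k)
    (hω' : ω ≠ 0) (ht0 : ∀ k, 0 < t k) (ht : StrictMono t) (p : ℝ[X]) (hp : p ≠ 0) :
    0 < momentFunctional α ω t (X * (p * p)) :=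
  momentFunctional_pos hα hω hω' ht0 ht (mul_ne_zero X_ne_zero (mul_ne_zero hp hp)) fun x hx => by
    rw [eval_mul, eval_mul, eval_X]
    exact mul_nonneg (le_of_lt hx) (mul_self_nonneg _)

/-- The epsilon choice has the defining property once some such sequence exists; Gram-Schmidt
supplies one. -/
theorem isOrthoSeq_orthoPoly (hα : -1 < α) (hω : ∀ l, 0 ≤ ∑ k ∈ Finset.Iic l, ω k) (hω' : ω ≠ 0)
    (ht0 : ∀ k, 0 < t k) (ht : StrictMono t) :
    IsOrthoSeq (momentFunctional α ω t) (orthoPoly α ω t) := by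
  rw [← isMonicOrthogonal_iff hα]
  exact Classical.epsilon_spec (p := IsMonicOrthogonal (weight α ω t)) ⟨_,
    (isMonicOrthogonal_iff hα _).2 (isOrthoSeq_gramSchmidtPoly _
      (momentFunctional_sq_pos hα hω hω' ht0 ht))⟩

end Ortho
end
end LaguerreJump

/-! ### Hankel determinant and derivatives with respect to the jump points. -/

namespace LaguerreJump
open Polynomial Finset MeasureTheory Set Filter Topology

noncomputable section

/-- The Gram matrix of the monomials has determinant `∏ h_j`. -/
theorem IsOrthoSeq.det_hankel {L : ℝ[X] →ₗ[ℝ] ℝ} {P : ℕ → ℝ[X]} (hP : IsOrthoSeq L P) (n : ℕ) :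
    Matrix.det (Matrix.of fun i j : Fin n => L (X ^ ((i : ℕ) + (j : ℕ)))) =
      ∏ j ∈ Finset.range n, L (P j * P j) := by
  set H : Matrix (Fin n) (Fin n) ℝ := Matrix.of fun i j : Fin n => L (X ^ ((i : ℕ) + (j : ℕ)))
    with hH
  set A : Matrix (Fin n) (Fin n) ℝ := Matrix.of fun i j : Fin n => (P i).coeff j with hA
  have hAdet : A.det = 1 := by
    rw [Matrix.det_of_isLowerTriangular A fun i j hij => ?_]
    · simp [hA, hP.coeff_self]
    · exact hP.coeff_of_lt hij
  -- The unitriangular matrix of coefficients of the P_i changes the Gram matrix of the monomials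
  -- into the diagonal Gram matrix of the P_i.
  have hmul : A * H * A.transpose = Matrix.diagonal fun j : Fin n => L (P j * P j) := by
    have hentry : ∀ i j : Fin n, (A * H * A.transpose) i j = L (P i * P j) := by
      intro i j
      have hexp : ∀ i : Fin n, P i = ∑ k : Fin n, C ((P i).coeff k) * X ^ (k : ℕ) := fun i => by
        rw [Fin.sum_univ_eq_sum_range (fun k => C ((P i).coeff k) * X ^ k)]
        exact as_sum_range_C_mul_X_pow' _ (by rw [hP.natDegree]; exact i.2)
      conv_rhs => rw [hexp j, mul_comm]
      rw [map_sum_C_mul_mul, Matrix.mul_apply]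
      refine Finset.sum_congr rfl fun l _ => ?_
      rw [mul_comm (X ^ (l : ℕ))]
      conv_rhs => rw [hexp i]
      rw [map_sum_C_mul_mul, Matrix.mul_apply, mul_comm, Matrix.transpose_apply]
      congr 1
      refine Finset.sum_congr rfl fun k _ => ?_
      rw [← pow_add]
      rfl
    ext i j
    rw [hentry]
    rcases eq_or_ne i j with rfl | hij
    · rw [Matrix.diagonal_apply_eq]
    · rw [Matrix.diagonal_apply_ne _ hij, hP.orth _ _ fun h => hij (Fin.ext h)]
  have hdet := congrArg Matrix.det hmul
  rw [Matrix.det_mul, Matrix.det_mul, Matrix.det_transpose, hAdet, Matrix.det_diagonal, one_mul,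
    mul_one] at hdet
  rw [hdet, Fin.prod_univ_eq_prod_range (fun j => L (P j * P j))]

variable {m : ℕ}

theorem hankelDet_eq_det {α : ℝ} (hα : -1 < α) (ω : Fin (m + 1) → ℝ) (t : Fin m → ℝ) (n : ℕ) :
    hankelDet n α ω t = Matrix.det (Matrix.of fun i j : Fin n =>
      momentFunctional α ω t (X ^ ((i : ℕ) + (j : ℕ)))) := by
  simp only [hankelDet, momentFunctional_apply hα, eval_pow, eval_X]

theorem sqNorm_eq {α : ℝ} (hα : -1 < α) (ω : Fin (m + 1) → ℝ) (t : Fin m → ℝ) (n : ℕ) :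
    sqNorm n α ω t = momentFunctional α ω t (orthoPoly α ω t n * orthoPoly α ω t n) := by
  simp only [sqNorm, momentFunctional_apply hα, eval_mul, pow_two]

variable [NeZero m] {α : ℝ} {ω : Fin (m + 1) → ℝ} {t : Fin m → ℝ}

theorem eventually_isOrthoSeq_orthoPoly (hα : -1 < α) (hω : ∀ l, 0 ≤ ∑ k ∈ Finset.Iic l, ω k)
    (hω' : ω ≠ 0) (ht0 : ∀ k, 0 < t k) (ht : StrictMono t) :
    ∀ᶠ s in 𝓝 t, IsOrthoSeq (momentFunctional α ω s) (orthoPoly α ω s) := by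
  filter_upwards [isOpen_setOf_pos_strictMono.mem_nhds (show t ∈ {s : Fin m → ℝ |
    (∀ k, 0 < s k) ∧ StrictMono s} from ⟨ht0, ht⟩)] with s hs
  exact isOrthoSeq_orthoPoly hα hω hω' hs.1 hs.2

/-- Only the existence of the derivative is extracted from the Gram-Schmidt recursion; its value is
found afterwards from orthogonality. -/
theorem exists_hasDeltaPoly_orthoPoly (hα : -1 < α) (hω : ∀ l, 0 ≤ ∑ k ∈ Finset.Iic l, ω k)
    (hω' : ω ≠ 0) (ht0 : ∀ k, 0 < t k) (ht : StrictMono t) (n : ℕ) :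
    ∃ q, HasDeltaPoly (fun s => orthoPoly α ω s n) q t := by
  induction n using Nat.strong_induction_on with
  | _ n ih =>
    choose! q hq using ih
    have hP := isOrthoSeq_orthoPoly hα hω hω' ht0 ht
    have h := (HasDeltaPoly.const (X ^ n) t).sub (HasDeltaPoly.sum (u := Finset.range n)
      fun j hj => (HasDeltaPoly.C_family
        ((((HasDeltaPoly.const (X ^ n) t).mul (hq j (Finset.mem_range.1 hj))).momentFunctional
            hα ω ht0).div
          (((hq j (Finset.mem_range.1 hj)).mul (hq j (Finset.mem_range.1 hj))).momentFunctional
            hα ω ht0)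
          (momentFunctional_sq_pos hα hω hω' ht0 ht _ (hP.monic j).ne_zero).ne')).mul
        (hq j (Finset.mem_range.1 hj)))
    refine ⟨_, h.congr ?_⟩
    filter_upwards [isOpen_setOf_pos_strictMono.mem_nhds (show t ∈ {s : Fin m → ℝ |
      (∀ k, 0 < s k) ∧ StrictMono s} from ⟨ht0, ht⟩)] with s hs
    exact (isOrthoSeq_orthoPoly hα hω hω' hs.1 hs.2).eq_gramSchmidt
      (momentFunctional_sq_pos hα hω hω' hs.1 hs.2) n

/-- The formula `δ P_n = ∑ t_k r_k P_n(t_k) K(·, t_k)`. -/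
theorem hasDeltaPoly_orthoPoly (hα : -1 < α) (hω : ∀ l, 0 ≤ ∑ k ∈ Finset.Iic l, ω k)
    (hω' : ω ≠ 0) (ht0 : ∀ k, 0 < t k) (ht : StrictMono t) (n : ℕ) :
    HasDeltaPoly (fun s => orthoPoly α ω s n)
      (∑ k, C (jump α ω t k * t k * (orthoPoly α ω t n).eval (t k)) *
        cdKernel (momentFunctional α ω t) (orthoPoly α ω t) n (t k)) t := by
  obtain ⟨q, hq⟩ := exists_hasDeltaPoly_orthoPoly hα hω hω' ht0 ht n
  have hP := isOrthoSeq_orthoPoly hα hω hω' ht0 ht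
  have hev := eventually_isOrthoSeq_orthoPoly hα hω hω' ht0 ht
  -- The leading coefficient is constantly 1 near t, so δ removes it.
  have hd : q.degree < n := by
    rw [degree_lt_iff_coeff_zero]
    intro i hi
    refine (hq.coeff i).unique ((HasDelta.const ((X ^ n : ℝ[X]).coeff i) t).congr ?_)
    filter_upwards [hev] with s hs
    rw [coeff_X_pow]
    rcases hi.eq_or_lt with rfl | h
    · simpa using hs.coeff_self n
    · rw [if_neg h.ne', hs.coeff_of_lt h]
  -- Differentiating L(P_n g) = 0 for fixed g gives L(δP_n · g) = ∑ r_k t_k P_n(t_k) g(t_k). The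
  -- coefficient of evaluation at 0 is 0, and the sign of the d_k matches the minus sign in the
  -- representation lemma.
  have h := hP.eq_cdKernel_of_map (momentFunctional_sq_pos hα hω hω' ht0 ht) 0
    (fun k => -(jump α ω t k * t k * (orthoPoly α ω t n).eval (t k))) t hd fun g hg => by
      have h1 := (hq.mul (HasDeltaPoly.const g t)).momentFunctional hα ω ht0
      have h2 := h1.unique ((HasDelta.const 0 t).congr (by
        filter_upwards [hev] with s hs
        exact hs.map_mul_of_degree_lt hg))
      rw [mul_zero, add_zero, sub_eq_zero] at h2
      rw [h2, zero_mul, zero_sub, ← Finset.sum_neg_distrib]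
      refine Finset.sum_congr rfl fun k _ => ?_
      rw [eval_mul]
      ring
  have h' : q = ∑ k, C (jump α ω t k * t k * (orthoPoly α ω t n).eval (t k)) *
      cdKernel (momentFunctional α ω t) (orthoPoly α ω t) n (t k) := by
    rw [h]
    simp
  rwa [← h']

/-- The variation of P_n has degree below n and is orthogonal to P_n, so only the variation of the
weight contributes. -/
theorem hasDelta_sqNorm (hα : -1 < α) (hω : ∀ l, 0 ≤ ∑ k ∈ Finset.Iic l, ω k)
    (hω' : ω ≠ 0) (ht0 : ∀ k, 0 < t k) (ht : StrictMono t) (n : ℕ) :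
    HasDelta (fun s => sqNorm n α ω s)
      (-∑ k, jump α ω t k * t k * (orthoPoly α ω t n).eval (t k) ^ 2) t := by
  have hP := isOrthoSeq_orthoPoly hα hω hω' ht0 ht
  have hq := hasDeltaPoly_orthoPoly hα hω hω' ht0 ht n
  have h := (hq.mul hq).momentFunctional hα ω ht0
  simp only [sqNorm_eq hα]
  refine h.congr_delta ?_
  have hd : (∑ k, C (jump α ω t k * t k * (orthoPoly α ω t n).eval (t k)) *
      cdKernel (momentFunctional α ω t) (orthoPoly α ω t) n (t k)).degree <
        ((n : ℕ) : WithBot ℕ) := by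
    rw [degree_lt_iff_coeff_zero]
    intro i hi
    rw [finsetSum_coeff]
    refine Finset.sum_eq_zero fun k _ => ?_
    rw [coeff_C_mul, (degree_lt_iff_coeff_zero _ _).1 (hP.degree_cdKernel_lt n _) i hi, mul_zero]
  rw [map_add, hP.map_mul_of_degree_lt hd, mul_comm _ (orthoPoly α ω t n),
    hP.map_mul_of_degree_lt hd, add_zero, zero_sub]
  simp only [eval_mul, pow_two]

theorem hankelDet_pos (hα : -1 < α) (hω : ∀ l, 0 ≤ ∑ k ∈ Finset.Iic l, ω k)
    (hω' : ω ≠ 0) (ht0 : ∀ k, 0 < t k) (ht : StrictMono t) (n : ℕ) : 0 < hankelDet n α ω t := by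
  have hP := isOrthoSeq_orthoPoly hα hω hω' ht0 ht
  rw [hankelDet_eq_det hα, hP.det_hankel]
  exact Finset.prod_pos fun j _ => momentFunctional_sq_pos hα hω hω' ht0 ht _ (hP.monic j).ne_zero

/-- The formula `δ ln D_n = -∑ t_k r_k K(t_k, t_k)`. -/
theorem hasDelta_log_hankelDet (hα : -1 < α) (hω : ∀ l, 0 ≤ ∑ k ∈ Finset.Iic l, ω k)
    (hω' : ω ≠ 0) (ht0 : ∀ k, 0 < t k) (ht : StrictMono t) (n : ℕ) :
    HasDelta (fun s => Real.log (hankelDet n α ω s))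
      (-∑ k, jump α ω t k * t k *
        (cdKernel (momentFunctional α ω t) (orthoPoly α ω t) n (t k)).eval (t k)) t := by
  have hh : ∀ s : Fin m → ℝ, (∀ k, 0 < s k) → StrictMono s → ∀ j, 0 < sqNorm j α ω s :=
    fun s hs0 hs j => by
      rw [sqNorm_eq hα]
      exact momentFunctional_sq_pos hα hω hω' hs0 hs _
        ((isOrthoSeq_orthoPoly hα hω hω' hs0 hs).monic j).ne_zero
  have h := HasDelta.sum (u := Finset.range n) fun j _ =>
    (hasDelta_sqNorm hα hω hω' ht0 ht j).log (hh t ht0 ht j).ne'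
  refine (h.congr ?_).congr_delta ?_
  · filter_upwards [isOpen_setOf_pos_strictMono.mem_nhds (show t ∈ {s : Fin m → ℝ |
      (∀ k, 0 < s k) ∧ StrictMono s} from ⟨ht0, ht⟩)] with s hs
    rw [hankelDet_eq_det hα, (isOrthoSeq_orthoPoly hα hω hω' hs.1 hs.2).det_hankel]
    simp only [← sqNorm_eq hα]
    exact Real.log_prod fun j _ => (hh s hs.1 hs.2 j).ne'
  · simp only [cdKernel, eval_finsetSum, eval_mul, eval_C, neg_div, Finset.sum_neg_distrib,
      Finset.sum_div, Finset.mul_sum]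
    rw [Finset.sum_comm]
    congr 1
    refine Finset.sum_congr rfl fun k _ => Finset.sum_congr rfl fun j _ => ?_
    rw [sqNorm_eq hα]
    ring

end
end LaguerreJump

/-! ### Pole cancellation under dilation, and the diagonal kernel sum. -/

namespace LaguerreJump
open Polynomial Finset MeasureTheory Set Filter Topology

noncomputable section

namespace IsOrthoSeq

variable {L : ℝ[X] →ₗ[ℝ] ℝ} {P : ℕ → ℝ[X]} {m : ℕ} {α : ℝ} {r t : Fin m → ℝ}

theorem sub_mul_eval_cdKernel (hP : IsOrthoSeq L P) (hL : ∀ p : ℝ[X], p ≠ 0 → 0 < L (p * p)) (n : ℕ)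
    (s x : ℝ) : (x - s) * (cdKernel L P (n + 1) s).eval x =
      (L (P n * P n))⁻¹ * ((P n).eval s * (P (n + 1)).eval x - (P (n + 1)).eval s * (P n).eval x) := by
  have h := congrArg (Polynomial.eval x) (hP.christoffel_darboux hL n s)
  simpa using h

/-- The confluent Christoffel-Darboux formula: differentiate the polynomial identity and set x = s.
-/
theorem eval_cdKernel_self (hP : IsOrthoSeq L P) (hL : ∀ p : ℝ[X], p ≠ 0 → 0 < L (p * p)) (n : ℕ)
    (s : ℝ) : (cdKernel L P (n + 1) s).eval s = (L (P n * P n))⁻¹ *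
      ((P n).eval s * (derivative (P (n + 1))).eval s -
        (P (n + 1)).eval s * (derivative (P n)).eval s) := by
  have h := congrArg (fun f => (derivative f).eval s) (hP.christoffel_darboux hL n s)
  simpa using h

theorem eval_cdKernel_comm (L : ℝ[X] →ₗ[ℝ] ℝ) (P : ℕ → ℝ[X]) (n : ℕ) (s x : ℝ) :
    (cdKernel L P n s).eval x = (cdKernel L P n x).eval s := by
  simp only [cdKernel, eval_finsetSum, eval_mul, eval_C]
  exact Finset.sum_congr rfl fun j _ => by ring

theorem cdKernel_succ (L : ℝ[X] →ₗ[ℝ] ℝ) (P : ℕ → ℝ[X]) (n : ℕ) (s : ℝ) :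
    cdKernel L P (n + 1) s = cdKernel L P n s + C ((P n).eval s / L (P n * P n)) * P n := by
  rw [cdKernel, Finset.sum_range_succ, cdKernel]

/-- The left side is (δ + x d/dx) P_{n+1}. The kernel at t_k occurs with the factor t_k - x and the
kernel at 0 with the factor x, so Christoffel-Darboux removes every denominator and a
constant-coefficient combination of P_{n+1} and P_n remains. -/
theorem sum_kernel_add_mul_derivative_succ (hP : IsOrthoSeq L P)
    (hL : ∀ p : ℝ[X], p ≠ 0 → 0 < L (p * p)) (hX : ∀ p : ℝ[X], p ≠ 0 → 0 < L (X * (p * p)))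
    (hD : IsPearson L α r t) (n : ℕ) (x : ℝ) :
    (∑ k, C (r k * t k * (P (n + 1)).eval (t k)) * cdKernel L P (n + 1) (t k)).eval x +
        x * (derivative (P (n + 1))).eval x =
      (n + 1) * (P (n + 1)).eval x +
        (-((P (n + 1)).eval 0 / (P n).eval 0) * ((n + 1) +
            (∑ k, r k * (P (n + 1)).eval (t k) * (P n).eval (t k)) / L (P n * P n)) +
          (∑ k, r k * (P (n + 1)).eval (t k) ^ 2) / L (P n * P n)) * (P n).eval x := by
  have hh : L (P n * P n) ≠ 0 := (hL _ (hP.monic n).ne_zero).ne'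
  have hq0 := hP.eval_zero_ne_zero hX n
  have hc := hP.coeff_derivative_succ hL hD n
  have hp := congrArg (Polynomial.eval x) (hP.derivative_succ_eq hL hD n)
  set c := L (derivative (P (n + 1))) + ∑ k, r k * (P (n + 1)).eval (t k) with hcdef
  simp only [eval_sub, eval_mul, eval_C, eval_finsetSum] at hp
  rw [hp]
  simp only [eval_mul, eval_C, eval_finsetSum]
  have hK0 := hP.sub_mul_eval_cdKernel hL n 0 x
  have hS : (∑ k, r k * t k * (P (n + 1)).eval (t k) * (cdKernel L P (n + 1) (t k)).eval x) -
      x * ∑ k, r k * (P (n + 1)).eval (t k) * (cdKernel L P (n + 1) (t k)).eval x =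
      -(∑ k, r k * (P (n + 1)).eval (t k) * (P n).eval (t k)) / L (P n * P n) * (P (n + 1)).eval x +
      (∑ k, r k * (P (n + 1)).eval (t k) ^ 2) / L (P n * P n) * (P n).eval x := by
    rw [Finset.mul_sum, ← Finset.sum_sub_distrib, neg_div, neg_mul, Finset.sum_div, Finset.sum_div,
      Finset.sum_mul, Finset.sum_mul, ← Finset.sum_neg_distrib, ← Finset.sum_add_distrib]
    refine Finset.sum_congr rfl fun k _ => ?_
    linear_combination -r k * (P (n + 1)).eval (t k) * hP.sub_mul_eval_cdKernel hL n (t k) x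
  have hc' : c = ((n + 1) * L (P n * P n) +
      ∑ k, r k * (P (n + 1)).eval (t k) * (P n).eval (t k)) / (P n).eval 0 := by
    rw [eq_div_iff hq0, hc]
  have hmain : x * (c * (cdKernel L P (n + 1) 0).eval x) = c * ((L (P n * P n))⁻¹ *
      ((P n).eval 0 * (P (n + 1)).eval x - (P (n + 1)).eval 0 * (P n).eval x)) := by
    rw [← hK0]
    ring
  rw [mul_sub, hmain, hc']
  rw [sub_eq_iff_eq_add] at hS
  rw [hS]
  field_simp
  ring

/-- The same cancellation for P_n. Its variation uses the kernel of degree below n while its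
derivative uses the one of degree n; the difference is a multiple of P_n, which produces the last
sum, equal to -δh / h for the weight. -/
theorem sum_kernel_add_mul_derivative_self (hP : IsOrthoSeq L P)
    (hL : ∀ p : ℝ[X], p ≠ 0 → 0 < L (p * p)) (hX : ∀ p : ℝ[X], p ≠ 0 → 0 < L (X * (p * p)))
    (hD : IsPearson L α r t) (n : ℕ) (x : ℝ) :
    (∑ k, C (r k * t k * (P n).eval (t k)) * cdKernel L P n (t k)).eval x +
        x * (derivative (P n)).eval x =
      (x - (n + 1 + α) - (∑ k, r k * t k * (P n).eval (t k) ^ 2) / L (P n * P n)) * (P n).eval x -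
        (P (n + 1)).eval x := by
  have hh : L (P n * P n) ≠ 0 := (hL _ (hP.monic n).ne_zero).ne'
  have hp0 := hP.eval_zero_ne_zero hX (n + 1)
  have hc1 := hP.coeff_derivative_sub_self hL hD n
  have hc2 := hP.derivative_sub_self_mul_succ hD n
  have hp := congrArg (Polynomial.eval x) (hP.derivative_sub_self_eq hL hD n)
  set c := L (derivative (P n) - P n) + ∑ k, r k * (P n).eval (t k) with hcdef
  simp only [eval_sub, eval_mul, eval_C, eval_finsetSum] at hp
  rw [sub_eq_iff_eq_add] at hp
  rw [hp]
  simp only [eval_mul, eval_C, eval_finsetSum]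
  have hK0 := hP.sub_mul_eval_cdKernel hL n 0 x
  have hmain : x * (c * (cdKernel L P (n + 1) 0).eval x) = (L (P n * P n))⁻¹ *
      ((c * (P n).eval 0) * (P (n + 1)).eval x - (c * (P (n + 1)).eval 0) * (P n).eval x) := by
    linear_combination c * hK0
  have hS : (∑ k, r k * t k * (P n).eval (t k) * (cdKernel L P n (t k)).eval x) -
      x * ∑ k, r k * (P n).eval (t k) * (cdKernel L P (n + 1) (t k)).eval x =
      -(∑ k, r k * (P n).eval (t k) * (P n).eval (t k)) / L (P n * P n) * (P (n + 1)).eval x +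
      (∑ k, r k * (P n).eval (t k) * (P (n + 1)).eval (t k)) / L (P n * P n) * (P n).eval x -
      (∑ k, r k * t k * (P n).eval (t k) ^ 2) / L (P n * P n) * (P n).eval x := by
    rw [Finset.mul_sum, ← Finset.sum_sub_distrib, neg_div, neg_mul, Finset.sum_div, Finset.sum_div,
      Finset.sum_div, Finset.sum_mul, Finset.sum_mul, Finset.sum_mul, ← Finset.sum_neg_distrib,
      ← Finset.sum_add_distrib, ← Finset.sum_sub_distrib]
    refine Finset.sum_congr rfl fun k _ => ?_
    have h1 : (cdKernel L P (n + 1) (t k)).eval x = (cdKernel L P n (t k)).eval x +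
        (P n).eval (t k) / L (P n * P n) * (P n).eval x := by
      rw [cdKernel_succ, eval_add, eval_mul, eval_C]
    linear_combination -r k * (P n).eval (t k) * hP.sub_mul_eval_cdKernel hL n (t k) x +
      (-r k * (P n).eval (t k) * t k) * h1
  rw [hc1, hc2] at hmain
  rw [sub_eq_iff_eq_add] at hS
  rw [mul_add, mul_sub, hmain, hS]
  field_simp
  ring

/-- Inserting the formulas for P_{n+1}' and P_n' in the confluent kernel leaves the double sum of
r_k r_j t_k (t_k - t_j) K(t_k, t_j)². The symmetry of K replaces t_k (t_k - t_j) by (t_k - t_j)² /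
2, and Christoffel-Darboux then eliminates K. -/
theorem sum_mul_eval_cdKernel_self (hP : IsOrthoSeq L P)
    (hL : ∀ p : ℝ[X], p ≠ 0 → 0 < L (p * p))
    (hD : IsPearson L α r t) (n : ℕ) :
    ∑ k, r k * t k * (cdKernel L P (n + 1) (t k)).eval (t k) =
      (∑ k, r k * (((L (derivative (P (n + 1))) + ∑ k, r k * (P (n + 1)).eval (t k)) *
            (P n).eval (t k) - (L (derivative (P n) - P n) + ∑ k, r k * (P n).eval (t k)) *
            (P (n + 1)).eval (t k)) *
          ((P n).eval 0 * (P (n + 1)).eval (t k) - (P (n + 1)).eval 0 * (P n).eval (t k)) /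
            L (P n * P n) ^ 2 - t k * (P n).eval (t k) * (P (n + 1)).eval (t k) / L (P n * P n))) +
      1 / 2 * ∑ k, ∑ j, r k * r j * ((P n).eval (t j) * (P (n + 1)).eval (t k) -
        (P (n + 1)).eval (t j) * (P n).eval (t k)) ^ 2 / L (P n * P n) ^ 2 := by
  have hh : L (P n * P n) ≠ 0 := (hL _ (hP.monic n).ne_zero).ne'
  set c := L (derivative (P (n + 1))) + ∑ k, r k * (P (n + 1)).eval (t k) with hcdef
  set c' := L (derivative (P n) - P n) + ∑ k, r k * (P n).eval (t k) with hcdef'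
  set h := L (P n * P n) with hhdef
  set K : Fin m → Fin m → ℝ := fun k j => (cdKernel L P (n + 1) (t j)).eval (t k) with hK
  have hCD : ∀ k j, (t k - t j) * K k j = h⁻¹ * ((P n).eval (t j) * (P (n + 1)).eval (t k) -
      (P (n + 1)).eval (t j) * (P n).eval (t k)) := fun k j =>
    hP.sub_mul_eval_cdKernel hL n (t j) (t k)
  have hterm : ∀ k, r k * t k * K k k =
      r k * ((c * (P n).eval (t k) - c' * (P (n + 1)).eval (t k)) *
          ((P n).eval 0 * (P (n + 1)).eval (t k) - (P (n + 1)).eval 0 * (P n).eval (t k)) /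
            h ^ 2 - t k * (P n).eval (t k) * (P (n + 1)).eval (t k) / h) +
      ∑ j, r k * r j * (t k * (t k - t j)) * K k j ^ 2 := by
    intro k
    have h1 := congrArg (Polynomial.eval (t k)) (hP.derivative_succ_eq hL hD n)
    have h2 := congrArg (Polynomial.eval (t k)) (hP.derivative_sub_self_eq hL hD n)
    simp only [eval_sub, eval_mul, eval_C, eval_finsetSum] at h1 h2
    rw [sub_eq_iff_eq_add] at h2
    have h0 := hP.sub_mul_eval_cdKernel hL n 0 (t k)
    have hkk : K k k = h⁻¹ * ((P n).eval (t k) * (derivative (P (n + 1))).eval (t k) -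
        (P (n + 1)).eval (t k) * (derivative (P n)).eval (t k)) := hP.eval_cdKernel_self hL n (t k)
    have hsum : ∑ j, r k * r j * (t k * (t k - t j)) * K k j ^ 2 =
        -(r k * t k * h⁻¹ * (P n).eval (t k)) * ∑ j, r j * (P (n + 1)).eval (t j) * K k j +
        (r k * t k * h⁻¹ * (P (n + 1)).eval (t k)) * ∑ j, r j * (P n).eval (t j) * K k j := by
      rw [Finset.mul_sum, Finset.mul_sum, ← Finset.sum_add_distrib]
      refine Finset.sum_congr rfl fun j _ => ?_
      linear_combination r k * r j * t k * K k j * hCD k j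
    rw [hsum, hkk, h1, h2]
    linear_combination h⁻¹ * r k * (c * (P n).eval (t k) - c' * (P (n + 1)).eval (t k)) * h0
  -- Interchanging j and k and averaging uses t_k (t_k - t_j) + t_j (t_j - t_k) = (t_k - t_j)². No
  -- division occurs, so the diagonal terms need no separate treatment.
  have hsym : ∑ k, ∑ j, r k * r j * (t k * (t k - t j)) * K k j ^ 2 =
      1 / 2 * ∑ k, ∑ j, r k * r j * ((P n).eval (t j) * (P (n + 1)).eval (t k) -
        (P (n + 1)).eval (t j) * (P n).eval (t k)) ^ 2 / h ^ 2 := by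
    have hswap : ∑ k, ∑ j, r k * r j * (t k * (t k - t j)) * K k j ^ 2 =
        ∑ k, ∑ j, r k * r j * (t j * (t j - t k)) * K k j ^ 2 := by
      rw [Finset.sum_comm]
      refine Finset.sum_congr rfl fun k _ => Finset.sum_congr rfl fun j _ => ?_
      have : K j k = K k j := eval_cdKernel_comm L P (n + 1) (t k) (t j)
      rw [this]
      ring
    have hadd : (∑ k, ∑ j, r k * r j * (t k * (t k - t j)) * K k j ^ 2) +
        ∑ k, ∑ j, r k * r j * (t j * (t j - t k)) * K k j ^ 2 =
        ∑ k, ∑ j, r k * r j * ((P n).eval (t j) * (P (n + 1)).eval (t k) -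
        (P (n + 1)).eval (t j) * (P n).eval (t k)) ^ 2 / h ^ 2 := by
      rw [← Finset.sum_add_distrib]
      refine Finset.sum_congr rfl fun k _ => ?_
      rw [← Finset.sum_add_distrib]
      refine Finset.sum_congr rfl fun j _ => ?_
      have h2 := congrArg (fun x => x ^ 2) (hCD k j)
      linear_combination r k * r j * h2
    rw [← hswap] at hadd
    linarith
  have hall := Finset.sum_congr (rfl : (Finset.univ : Finset (Fin m)) = Finset.univ)
    fun k _ => hterm k
  rw [Finset.sum_add_distrib, hsym] at hall
  exact hall

end IsOrthoSeq
end
end LaguerreJump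

/-! ### The parameters u, v, the coupled system and σ. -/

namespace LaguerreJump
open Polynomial Finset MeasureTheory Set Filter Topology

noncomputable section

variable {m : ℕ}

/-- The ratio `P_{n+1}(0) / P_n(0)`. -/
def ratioZero (n : ℕ) (α : ℝ) (ω : Fin (m + 1) → ℝ) (t : Fin m → ℝ) : ℝ :=
  (orthoPoly α ω t (n + 1)).eval 0 / (orthoPoly α ω t n).eval 0

/-- The functions `u_k` in terms of the orthogonal polynomials of degrees `n + 1` and `n`. -/
def paramU (n : ℕ) (α : ℝ) (ω : Fin (m + 1) → ℝ) (t : Fin m → ℝ) (k : Fin m) : ℝ :=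
  jump α ω t k * (orthoPoly α ω t (n + 1)).eval (t k) ^ 2 / (sqNorm n α ω t * ratioZero n α ω t)

/-- The functions `v_k` in terms of the orthogonal polynomials of degrees `n + 1` and `n`. -/
def paramV (n : ℕ) (α : ℝ) (ω : Fin (m + 1) → ℝ) (t : Fin m → ℝ) (k : Fin m) : ℝ :=
  (orthoPoly α ω t n).eval (t k) * ratioZero n α ω t / (orthoPoly α ω t (n + 1)).eval (t k)

theorem hasDelta_jump (α : ℝ) (ω : Fin (m + 1) → ℝ) {t : Fin m → ℝ} (ht0 : ∀ k, 0 < t k) (k : Fin m) :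
    HasDelta (fun s => jump α ω s k) ((α - t k) * jump α ω t k) t := by
  have hd : HasDerivAt (fun x => ω k.succ * laguerre α x)
      (ω k.succ * (α * t k ^ (α - 1) * Real.exp (-t k) + t k ^ α * (Real.exp (-t k) * -1))) (t k) :=
    ((Real.hasDerivAt_rpow_const (p := α) (Or.inl (ht0 k).ne')).mul
      (hasDerivAt_neg (t k)).exp).const_mul _
  refine ((HasDelta.coord t k).comp hd).congr_delta ?_
  rw [Real.rpow_sub_one (ht0 k).ne', jump, laguerre]
  have := (ht0 k).ne'
  field_simp
  ring

theorem sum_u_mul (u v : Fin m → ℝ) (c : ℝ) :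
    ∑ j, u j * (v j - 1) * (c + v j) =
      c * ((∑ j, u j * v j) - ∑ j, u j) + (∑ j, u j * v j ^ 2) - ∑ j, u j * v j := by
  rw [← Finset.sum_sub_distrib, Finset.mul_sum, ← Finset.sum_add_distrib, ← Finset.sum_sub_distrib]
  exact Finset.sum_congr rfl fun j _ => by ring

/-- The coupled Hamiltonian in terms of power sums. -/
theorem coupledHam_eq {n : ℕ} {α : ℝ} {t : Fin m → ℝ} (ht0 : ∀ k, t k ≠ 0) (u v : Fin m → ℝ) :
    coupledHam n α t u v = (∑ k, (t k * u k * v k + (n + α) * u k * (v k - 1) ^ 2 -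
      α * u k * v k * (v k - 1))) + (∑ k, u k * (v k - 1)) * ∑ k, u k * v k * (v k - 1) := by
  -- Symmetrizing the product of sums in j and k creates the factor (v_j + v_k) / 2; its diagonal
  -- terms are the u² v (v - 1)² contained in the single Hamiltonians.
  have h2 : (∑ k, u k * (v k - 1)) * ∑ k, u k * v k * (v k - 1) =
      1 / 2 * ∑ j, ∑ k, u j * u k * (v j + v k) * (v j - 1) * (v k - 1) := by
    have e1 : (∑ k, u k * (v k - 1)) * ∑ k, u k * v k * (v k - 1) =
        ∑ j, ∑ k, u j * u k * v k * (v j - 1) * (v k - 1) := by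
      rw [Finset.sum_mul_sum]
      exact Finset.sum_congr rfl fun j _ => Finset.sum_congr rfl fun k _ => by ring
    have e2 : (∑ k, u k * (v k - 1)) * ∑ k, u k * v k * (v k - 1) =
        ∑ j, ∑ k, u j * u k * v j * (v j - 1) * (v k - 1) := by
      rw [mul_comm, Finset.sum_mul_sum]
      exact Finset.sum_congr rfl fun j _ => Finset.sum_congr rfl fun k _ => by ring
    have e3 : ∑ j, ∑ k, u j * u k * (v j + v k) * (v j - 1) * (v k - 1) =
        (∑ j, ∑ k, u j * u k * v k * (v j - 1) * (v k - 1)) +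
          ∑ j, ∑ k, u j * u k * v j * (v j - 1) * (v k - 1) := by
      simp only [← Finset.sum_add_distrib]
      exact Finset.sum_congr rfl fun j _ => Finset.sum_congr rfl fun k _ => by ring
    rw [e3, ← e1, ← e2]
    ring
  have h3 : ∀ j, ∑ k, u j * u k * (v j + v k) * (v j - 1) * (v k - 1) =
      2 * (u j ^ 2 * v j * (v j - 1) ^ 2) +
        ∑ k ∈ Finset.univ.erase j, u j * u k * (v j + v k) * (v j - 1) * (v k - 1) := by
    intro j
    rw [← Finset.add_sum_erase _ _ (Finset.mem_univ j)]
    ring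
  rw [h2, Finset.sum_congr rfl fun j _ => h3 j, Finset.sum_add_distrib, ← Finset.mul_sum, coupledHam,
    mul_add, ← add_assoc]
  congr 1
  rw [← mul_assoc, one_div_mul_cancel two_ne_zero, one_mul, ← Finset.sum_add_distrib]
  refine Finset.sum_congr rfl fun k _ => ?_
  rw [hamV, mul_div_cancel₀ _ (ht0 k)]
  ring

variable [NeZero m] {α : ℝ} {ω : Fin (m + 1) → ℝ} {t : Fin m → ℝ}

theorem sqNorm_pos (hα : -1 < α) (hω : ∀ l, 0 ≤ ∑ k ∈ Finset.Iic l, ω k) (hω' : ω ≠ 0)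
    (ht0 : ∀ k, 0 < t k) (ht : StrictMono t) (n : ℕ) : 0 < sqNorm n α ω t := by
  rw [sqNorm_eq hα]
  exact momentFunctional_sq_pos hα hω hω' ht0 ht _
    ((isOrthoSeq_orthoPoly hα hω hω' ht0 ht).monic n).ne_zero

theorem orthoPoly_eval_zero_ne_zero (hα : -1 < α) (hω : ∀ l, 0 ≤ ∑ k ∈ Finset.Iic l, ω k)
    (hω' : ω ≠ 0) (ht0 : ∀ k, 0 < t k) (ht : StrictMono t) (n : ℕ) :
    (orthoPoly α ω t n).eval 0 ≠ 0 :=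
  (isOrthoSeq_orthoPoly hα hω hω' ht0 ht).eval_zero_ne_zero
    (momentFunctional_X_mul_sq_pos hα hω hω' ht0 ht) n

theorem ratioZero_ne_zero (hα : -1 < α) (hω : ∀ l, 0 ≤ ∑ k ∈ Finset.Iic l, ω k) (hω' : ω ≠ 0)
    (ht0 : ∀ k, 0 < t k) (ht : StrictMono t) (n : ℕ) : ratioZero n α ω t ≠ 0 :=
  div_ne_zero (orthoPoly_eval_zero_ne_zero hα hω hω' ht0 ht _)
    (orthoPoly_eval_zero_ne_zero hα hω hω' ht0 ht _)

theorem jump_mul_sq_succ (hα : -1 < α) (hω : ∀ l, 0 ≤ ∑ k ∈ Finset.Iic l, ω k) (hω' : ω ≠ 0)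
    (ht0 : ∀ k, 0 < t k) (ht : StrictMono t) (n : ℕ) (k : Fin m) :
    jump α ω t k * (orthoPoly α ω t (n + 1)).eval (t k) ^ 2 =
      sqNorm n α ω t * ratioZero n α ω t * paramU n α ω t k := by
  have h1 := (sqNorm_pos hα hω hω' ht0 ht n).ne'
  have h2 := ratioZero_ne_zero hα hω hω' ht0 ht n
  rw [paramU]
  field_simp

/-- This lemma and its two neighbours give the residue data r p², r p q, r q² at t_k in terms of u
and v. Recovering q(t_k) from v_k is where p(t_k) ≠ 0 is needed. -/
theorem jump_mul_mul (hα : -1 < α) (hω : ∀ l, 0 ≤ ∑ k ∈ Finset.Iic l, ω k) (hω' : ω ≠ 0)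
    (ht0 : ∀ k, 0 < t k) (ht : StrictMono t) (n : ℕ) {k : Fin m}
    (hk : (orthoPoly α ω t (n + 1)).eval (t k) ≠ 0) :
    jump α ω t k * (orthoPoly α ω t (n + 1)).eval (t k) * (orthoPoly α ω t n).eval (t k) =
      sqNorm n α ω t * (paramU n α ω t k * paramV n α ω t k) := by
  have h1 := (sqNorm_pos hα hω hω' ht0 ht n).ne'
  have h2 := ratioZero_ne_zero hα hω hω' ht0 ht n
  rw [paramU, paramV]
  field_simp

theorem jump_mul_sq_self (hα : -1 < α) (hω : ∀ l, 0 ≤ ∑ k ∈ Finset.Iic l, ω k) (hω' : ω ≠ 0)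
    (ht0 : ∀ k, 0 < t k) (ht : StrictMono t) (n : ℕ) {k : Fin m}
    (hk : (orthoPoly α ω t (n + 1)).eval (t k) ≠ 0) :
    ratioZero n α ω t * (jump α ω t k * (orthoPoly α ω t n).eval (t k) ^ 2) =
      sqNorm n α ω t * (paramU n α ω t k * paramV n α ω t k ^ 2) := by
  have h1 := (sqNorm_pos hα hω hω' ht0 ht n).ne'
  have h2 := ratioZero_ne_zero hα hω hω' ht0 ht n
  rw [paramU, paramV]
  field_simp

/-- The two formulas for the coefficient of K(·, 0) in q' - q, one multiplied by q(0) and the other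
by p(0), are compared through p(0) = ρ q(0). -/
theorem ratioZero_eq (hα : -1 < α) (hω : ∀ l, 0 ≤ ∑ k ∈ Finset.Iic l, ω k) (hω' : ω ≠ 0)
    (ht0 : ∀ k, 0 < t k) (ht : StrictMono t) (n : ℕ)
    (hP : ∀ k, (orthoPoly α ω t (n + 1)).eval (t k) ≠ 0) :
    ratioZero n α ω t = (∑ k, paramU n α ω t k * paramV n α ω t k ^ 2) -
      (∑ k, paramU n α ω t k * paramV n α ω t k) - (n + 1) - α := by
  have h1 := (sqNorm_pos hα hω hω' ht0 ht n).ne'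
  have hq0 := orthoPoly_eval_zero_ne_zero hα hω hω' ht0 ht n
  have hO := isOrthoSeq_orthoPoly hα hω hω' ht0 ht
  have hD := isPearson_momentFunctional hα ω ht0
  have e1 := hO.coeff_derivative_sub_self (momentFunctional_sq_pos hα hω hω' ht0 ht) hD n
  have e2 := hO.derivative_sub_self_mul_succ hD n
  set c := momentFunctional α ω t (derivative (orthoPoly α ω t n) - orthoPoly α ω t n) +
    ∑ k, jump α ω t k * (orthoPoly α ω t n).eval (t k)
  rw [← sqNorm_eq hα] at e1 e2
  have e3 : (orthoPoly α ω t (n + 1)).eval 0 = ratioZero n α ω t * (orthoPoly α ω t n).eval 0 := by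
    rw [ratioZero, div_mul_cancel₀ _ hq0]
  have e4 : ∑ k, jump α ω t k * (orthoPoly α ω t n).eval (t k) *
      (orthoPoly α ω t (n + 1)).eval (t k) =
      sqNorm n α ω t * ∑ k, paramU n α ω t k * paramV n α ω t k := by
    rw [Finset.mul_sum]
    refine Finset.sum_congr rfl fun k _ => ?_
    rw [← jump_mul_mul hα hω hω' ht0 ht n (hP k)]
    ring
  have e5 : ratioZero n α ω t * ∑ k, jump α ω t k * (orthoPoly α ω t n).eval (t k) *
      (orthoPoly α ω t n).eval (t k) =
      sqNorm n α ω t * ∑ k, paramU n α ω t k * paramV n α ω t k ^ 2 := by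
    rw [Finset.mul_sum, Finset.mul_sum]
    refine Finset.sum_congr rfl fun k _ => ?_
    rw [← jump_mul_sq_self hα hω hω' ht0 ht n (hP k)]
    ring
  rw [e4, e3] at e2
  have e6 := congrArg (fun x => ratioZero n α ω t * x) e1
  simp only [mul_add, e5] at e6
  have e7 : sqNorm n α ω t * (ratioZero n α ω t - ((∑ k, paramU n α ω t k * paramV n α ω t k ^ 2) -
      (∑ k, paramU n α ω t k * paramV n α ω t k) - (n + 1) - α)) = 0 := by
    linear_combination e6 - e2
  exact sub_eq_zero.1 ((mul_eq_zero.1 e7).resolve_left h1)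

/-- The condition on x means δx = x at t, which covers both evaluation points needed: x = t_k and
the constant 0. -/
theorem hasDelta_eval_orthoPoly_succ (hα : -1 < α) (hω : ∀ l, 0 ≤ ∑ k ∈ Finset.Iic l, ω k)
    (hω' : ω ≠ 0) (ht0 : ∀ k, 0 < t k) (ht : StrictMono t) (n : ℕ)
    (hP : ∀ k, (orthoPoly α ω t (n + 1)).eval (t k) ≠ 0) {x : (Fin m → ℝ) → ℝ}
    (hx : HasDelta x (x t) t) :
    HasDelta (fun s => (orthoPoly α ω s (n + 1)).eval (x s))
      ((n + 1) * (orthoPoly α ω t (n + 1)).eval (x t) +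
        ratioZero n α ω t * ((∑ k, paramU n α ω t k) - (∑ k, paramU n α ω t k * paramV n α ω t k) -
          (n + 1)) * (orthoPoly α ω t n).eval (x t)) t := by
  have h1 := (sqNorm_pos hα hω hω' ht0 ht n).ne'
  refine ((hasDeltaPoly_orthoPoly hα hω hω' ht0 ht (n + 1)).eval hx).congr_delta ?_
  rw [(isOrthoSeq_orthoPoly hα hω hω' ht0 ht).sum_kernel_add_mul_derivative_succ
    (momentFunctional_sq_pos hα hω hω' ht0 ht) (momentFunctional_X_mul_sq_pos hα hω hω' ht0 ht)
    (isPearson_momentFunctional hα ω ht0) n (x t), ← sqNorm_eq hα, ← ratioZero]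
  simp only [jump_mul_mul hα hω hω' ht0 ht n (hP _), jump_mul_sq_succ hα hω hω' ht0 ht n,
    ← Finset.mul_sum]
  field_simp
  ring

theorem hasDelta_eval_orthoPoly_self (hα : -1 < α) (hω : ∀ l, 0 ≤ ∑ k ∈ Finset.Iic l, ω k)
    (hω' : ω ≠ 0) (ht0 : ∀ k, 0 < t k) (ht : StrictMono t) (n : ℕ) {x : (Fin m → ℝ) → ℝ}
    (hx : HasDelta x (x t) t) :
    HasDelta (fun s => (orthoPoly α ω s n).eval (x s))
      ((x t - (n + 1 + α) + delta (sqNorm n α ω) t / sqNorm n α ω t) *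
        (orthoPoly α ω t n).eval (x t) - (orthoPoly α ω t (n + 1)).eval (x t)) t := by
  refine ((hasDeltaPoly_orthoPoly hα hω hω' ht0 ht n).eval hx).congr_delta ?_
  rw [(isOrthoSeq_orthoPoly hα hω hω' ht0 ht).sum_kernel_add_mul_derivative_self
    (momentFunctional_sq_pos hα hω hω' ht0 ht) (momentFunctional_X_mul_sq_pos hα hω hω' ht0 ht)
    (isPearson_momentFunctional hα ω ht0) n (x t), ← sqNorm_eq hα,
    (hasDelta_sqNorm hα hω hω' ht0 ht n).delta_eq]
  ring

theorem hasDelta_ratioZero (hα : -1 < α) (hω : ∀ l, 0 ≤ ∑ k ∈ Finset.Iic l, ω k)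
    (hω' : ω ≠ 0) (ht0 : ∀ k, 0 < t k) (ht : StrictMono t) (n : ℕ)
    (hP : ∀ k, (orthoPoly α ω t (n + 1)).eval (t k) ≠ 0) :
    HasDelta (fun s => ratioZero n α ω s)
      (ratioZero n α ω t * ((n + 1) + ((∑ k, paramU n α ω t k) -
        (∑ k, paramU n α ω t k * paramV n α ω t k) - (n + 1)) + (n + 1 + α) -
          delta (sqNorm n α ω) t / sqNorm n α ω t + ratioZero n α ω t)) t := by
  have hq0 := orthoPoly_eval_zero_ne_zero hα hω hω' ht0 ht n
  refine ((hasDelta_eval_orthoPoly_succ hα hω hω' ht0 ht n hP (HasDelta.const 0 t)).div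
    (hasDelta_eval_orthoPoly_self hα hω hω' ht0 ht n (HasDelta.const 0 t)) hq0).congr_delta ?_
  have hr : (orthoPoly α ω t (n + 1)).eval 0 = ratioZero n α ω t * (orthoPoly α ω t n).eval 0 := by
    rw [ratioZero, div_mul_cancel₀ _ hq0]
  rw [hr]
  field_simp
  ring

theorem hasDelta_paramV (hα : -1 < α) (hω : ∀ l, 0 ≤ ∑ k ∈ Finset.Iic l, ω k)
    (hω' : ω ≠ 0) (ht0 : ∀ k, 0 < t k) (ht : StrictMono t) (n : ℕ)
    (hP : ∀ k, (orthoPoly α ω t (n + 1)).eval (t k) ≠ 0) (k : Fin m) :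
    HasDelta (fun s => paramV n α ω s k)
      (t k * paramV n α ω t k + (paramV n α ω t k - 1) * (ratioZero n α ω t -
        ((∑ k, paramU n α ω t k) - (∑ k, paramU n α ω t k * paramV n α ω t k) - (n + 1)) *
          paramV n α ω t k)) t := by
  have hp := hasDelta_eval_orthoPoly_succ hα hω hω' ht0 ht n hP (HasDelta.coord t k)
  have hq := hasDelta_eval_orthoPoly_self hα hω hω' ht0 ht n (HasDelta.coord t k)
  refine ((hq.mul (hasDelta_ratioZero hα hω hω' ht0 ht n hP)).div hp (hP k)).congr_delta ?_
  have hv : (orthoPoly α ω t n).eval (t k) * ratioZero n α ω t =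
      paramV n α ω t k * (orthoPoly α ω t (n + 1)).eval (t k) := by
    rw [paramV, div_mul_cancel₀ _ (hP k)]
  have hρ := ratioZero_ne_zero hα hω hω' ht0 ht n
  have hv' : (orthoPoly α ω t n).eval (t k) =
      paramV n α ω t k * (orthoPoly α ω t (n + 1)).eval (t k) / ratioZero n α ω t := by
    rw [eq_div_iff hρ, hv]
  have hpk := hP k
  rw [hv']
  generalize (∑ k, paramU n α ω t k) - (∑ k, paramU n α ω t k * paramV n α ω t k) - (n + 1) = β
  -- The logarithmic derivative of h enters δq and δρ with opposite signs and cancels, so its value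
  -- is irrelevant.
  generalize delta (sqNorm n α ω) t / sqNorm n α ω t = η
  field_simp
  ring

theorem hasDelta_paramU (hα : -1 < α) (hω : ∀ l, 0 ≤ ∑ k ∈ Finset.Iic l, ω k)
    (hω' : ω ≠ 0) (ht0 : ∀ k, 0 < t k) (ht : StrictMono t) (n : ℕ)
    (hP : ∀ k, (orthoPoly α ω t (n + 1)).eval (t k) ≠ 0) (k : Fin m) :
    HasDelta (fun s => paramU n α ω s k)
      (paramU n α ω t k * (-t k + 2 * ((∑ k, paramU n α ω t k) -
        (∑ k, paramU n α ω t k * paramV n α ω t k) - (n + 1)) * paramV n α ω t k -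
        ratioZero n α ω t - ((∑ k, paramU n α ω t k) -
        (∑ k, paramU n α ω t k * paramV n α ω t k) - (n + 1)))) t := by
  have hp := hasDelta_eval_orthoPoly_succ hα hω hω' ht0 ht n hP (HasDelta.coord t k)
  have hh := (hasDelta_sqNorm hα hω hω' ht0 ht n)
  rw [← hh.delta_eq] at hh
  have h1 := (sqNorm_pos hα hω hω' ht0 ht n).ne'
  have hρ := ratioZero_ne_zero hα hω hω' ht0 ht n
  refine (((hasDelta_jump α ω ht0 k).mul (hp.pow 2)).div
    (hh.mul (hasDelta_ratioZero hα hω hω' ht0 ht n hP)) (mul_ne_zero h1 hρ)).congr_delta ?_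
  have hv' : (orthoPoly α ω t n).eval (t k) =
      paramV n α ω t k * (orthoPoly α ω t (n + 1)).eval (t k) / ratioZero n α ω t := by
    rw [eq_div_iff hρ, paramV, div_mul_cancel₀ _ (hP k)]
  have hu : jump α ω t k = paramU n α ω t k * (sqNorm n α ω t * ratioZero n α ω t) /
      (orthoPoly α ω t (n + 1)).eval (t k) ^ 2 := by
    rw [eq_div_iff (pow_ne_zero 2 (hP k)), jump_mul_sq_succ hα hω hω' ht0 ht]
    ring
  have hpk := hP k
  rw [hv', hu]
  generalize (∑ k, paramU n α ω t k) - (∑ k, paramU n α ω t k * paramV n α ω t k) - (n + 1) = β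
  -- In the product h ρ the contribution of δh again cancels.
  generalize delta (sqNorm n α ω) t = η
  field_simp
  ring

theorem coupledPVAt_param (hα : -1 < α) (hω : ∀ l, 0 ≤ ∑ k ∈ Finset.Iic l, ω k)
    (hω' : ω ≠ 0) (ht0 : ∀ k, 0 < t k) (ht : StrictMono t) (n : ℕ)
    (hP : ∀ k, (orthoPoly α ω t (n + 1)).eval (t k) ≠ 0) :
    CoupledPVAt (n + 1) α (paramU n α ω) (paramV n α ω) t := by
  have hu := hasDelta_paramU hα hω hω' ht0 ht n hP
  have hv := hasDelta_paramV hα hω hω' ht0 ht n hP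
  have hr := ratioZero_eq hα hω hω' ht0 ht n hP
  refine ⟨differentiableAt_pi.2 fun k => (hu k).differentiableAt,
    differentiableAt_pi.2 fun k => (hv k).differentiableAt, fun k => ⟨?_, ?_⟩⟩
  · have e : ∀ j, paramU n α ω t j * (paramV n α ω t j - 1) *
        (2 * paramV n α ω t k + paramV n α ω t j - 1) = paramU n α ω t j * (paramV n α ω t j - 1) *
        ((2 * paramV n α ω t k - 1) + paramV n α ω t j) := fun j => by ring
    rw [(hu k).delta_eq, Finset.sum_congr rfl fun j _ => e j, sum_u_mul, hr]
    push_cast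
    ring
  · rw [(hv k).delta_eq, sum_u_mul, hr]
    push_cast
    ring

theorem sigma_eq_coupledHam (hα : -1 < α) (hω : ∀ l, 0 ≤ ∑ k ∈ Finset.Iic l, ω k)
    (hω' : ω ≠ 0) (ht0 : ∀ k, 0 < t k) (ht : StrictMono t) (n : ℕ)
    (hP : ∀ k, (orthoPoly α ω t (n + 1)).eval (t k) ≠ 0) :
    sigma (n + 1) α ω t = coupledHam (n + 1) α t (paramU n α ω t) (paramV n α ω t) := by
  have hO := isOrthoSeq_orthoPoly hα hω hω' ht0 ht
  have hD := isPearson_momentFunctional hα ω ht0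
  have hL := momentFunctional_sq_pos hα hω hω' ht0 ht
  have hh := (sqNorm_pos hα hω hω' ht0 ht n).ne'
  have hq0 := orthoPoly_eval_zero_ne_zero hα hω hω' ht0 ht n
  have hp0 := orthoPoly_eval_zero_ne_zero hα hω hω' ht0 ht (n + 1)
  have e1 := hO.coeff_derivative_succ hL hD n
  have e2 := hO.derivative_sub_self_mul_succ hD n
  rw [sigma, (hasDelta_log_hankelDet hα hω hω' ht0 ht (n + 1)).delta_eq,
    hO.sum_mul_eval_cdKernel_self hL hD n, coupledHam_eq fun k => (ht0 k).ne']
  set c := momentFunctional α ω t (derivative (orthoPoly α ω t (n + 1))) +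
    ∑ k, jump α ω t k * (orthoPoly α ω t (n + 1)).eval (t k)
  set c' := momentFunctional α ω t (derivative (orthoPoly α ω t n) - orthoPoly α ω t n) +
    ∑ k, jump α ω t k * (orthoPoly α ω t n).eval (t k)
  rw [← sqNorm_eq hα] at e1 e2 ⊢
  simp only [jump_mul_mul hα hω hω' ht0 ht n (hP _), ← Finset.mul_sum] at e1
  have e2' : ∑ k, jump α ω t k * (orthoPoly α ω t n).eval (t k) *
      (orthoPoly α ω t (n + 1)).eval (t k) =
      sqNorm n α ω t * ∑ k, paramU n α ω t k * paramV n α ω t k := by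
    rw [Finset.mul_sum]
    refine Finset.sum_congr rfl fun k _ => ?_
    rw [← jump_mul_mul hα hω hω' ht0 ht n (hP k)]
    ring
  rw [e2'] at e2
  have hr : (orthoPoly α ω t (n + 1)).eval 0 = ratioZero n α ω t * (orthoPoly α ω t n).eval 0 := by
    rw [ratioZero, div_mul_cancel₀ _ hq0]
  have hρ := ratioZero_ne_zero hα hω hω' ht0 ht n
  have hv' : ∀ k, (orthoPoly α ω t n).eval (t k) =
      paramV n α ω t k * (orthoPoly α ω t (n + 1)).eval (t k) / ratioZero n α ω t := fun k => by
    rw [eq_div_iff hρ, paramV, div_mul_cancel₀ _ (hP k)]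
  have hu : ∀ k, jump α ω t k = paramU n α ω t k * (sqNorm n α ω t * ratioZero n α ω t) /
      (orthoPoly α ω t (n + 1)).eval (t k) ^ 2 := fun k => by
    rw [eq_div_iff (pow_ne_zero 2 (hP k)), jump_mul_sq_succ hα hω hω' ht0 ht]
    ring
  set S := ∑ k, paramU n α ω t k * paramV n α ω t k with hS
  -- The coefficients of K(·, 0) in p' and q' - q, through S = ∑ u_k v_k.
  have hc : c = sqNorm n α ω t * (n + 1 + S) / (orthoPoly α ω t n).eval 0 := by
    rw [eq_div_iff hq0, e1]
    ring
  have hc' : c' = sqNorm n α ω t * (n + 1 + α + S) /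
      (ratioZero n α ω t * (orthoPoly α ω t n).eval 0) := by
    rw [← hr, eq_div_iff hp0, e2]
    ring
  have f1 : ∀ k, jump α ω t k * ((c * (orthoPoly α ω t n).eval (t k) -
      c' * (orthoPoly α ω t (n + 1)).eval (t k)) * ((orthoPoly α ω t n).eval 0 *
        (orthoPoly α ω t (n + 1)).eval (t k) - (orthoPoly α ω t (n + 1)).eval 0 *
          (orthoPoly α ω t n).eval (t k)) / sqNorm n α ω t ^ 2 -
      t k * (orthoPoly α ω t n).eval (t k) * (orthoPoly α ω t (n + 1)).eval (t k) /
        sqNorm n α ω t) =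
      (n + 1 + S) * (paramU n α ω t k * paramV n α ω t k - paramU n α ω t k * paramV n α ω t k ^ 2) -
      (n + 1 + α + S) * (paramU n α ω t k - paramU n α ω t k * paramV n α ω t k) -
      t k * paramU n α ω t k * paramV n α ω t k := by
    intro k
    have hpk := hP k
    rw [hu, hv', hr, hc, hc']
    field_simp
  have f2 : ∀ k j, jump α ω t k * jump α ω t j * ((orthoPoly α ω t n).eval (t j) *
      (orthoPoly α ω t (n + 1)).eval (t k) - (orthoPoly α ω t (n + 1)).eval (t j) *
        (orthoPoly α ω t n).eval (t k)) ^ 2 / sqNorm n α ω t ^ 2 =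
      paramU n α ω t k * (paramU n α ω t j * paramV n α ω t j ^ 2) +
      (paramU n α ω t k * paramV n α ω t k ^ 2) * paramU n α ω t j -
      2 * ((paramU n α ω t k * paramV n α ω t k) * (paramU n α ω t j * paramV n α ω t j)) := by
    intro k j
    have hpk := hP k
    have hpj := hP j
    rw [hu k, hv' k, hu j, hv' j]
    field_simp
    ring
  simp only [f1, f2, Finset.sum_sub_distrib, Finset.sum_add_distrib, ← Finset.mul_sum,
    ← Finset.sum_mul, ← hS]
  have g1 : ∑ k, paramU n α ω t k * (paramV n α ω t k - 1) = S - ∑ k, paramU n α ω t k := by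
    rw [hS, ← Finset.sum_sub_distrib]
    exact Finset.sum_congr rfl fun k _ => by ring
  have g2 : ∑ k, paramU n α ω t k * paramV n α ω t k * (paramV n α ω t k - 1) =
      (∑ k, paramU n α ω t k * paramV n α ω t k ^ 2) - S := by
    rw [hS, ← Finset.sum_sub_distrib]
    exact Finset.sum_congr rfl fun k _ => by ring
  have g3 : ∑ k, (((n + 1 : ℕ) : ℝ) + α) * paramU n α ω t k * (paramV n α ω t k - 1) ^ 2 =
      (n + 1 + α) * ((∑ k, paramU n α ω t k * paramV n α ω t k ^ 2) - 2 * S +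
        ∑ k, paramU n α ω t k) := by
    rw [hS, Finset.mul_sum, ← Finset.sum_sub_distrib, ← Finset.sum_add_distrib, Finset.mul_sum]
    refine Finset.sum_congr rfl fun k _ => ?_
    push_cast
    ring
  have g4 : ∑ k, α * paramU n α ω t k * paramV n α ω t k * (paramV n α ω t k - 1) =
      α * ((∑ k, paramU n α ω t k * paramV n α ω t k ^ 2) - S) := by
    rw [← g2, Finset.mul_sum]
    exact Finset.sum_congr rfl fun k _ => by ring
  rw [g1, g2, g3, g4]
  ring

end
end LaguerreJump

/-! ### The differential system in z for polynomials and Cauchy transforms. -/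

namespace LaguerreJump
open Polynomial Finset MeasureTheory Set Filter Topology

noncomputable section

variable {m : ℕ}

/-- Differentiability of a column of the Lax pair, in terms of unnormalized entries `A`, `B`. The
number `ε` is `0` for the first and `1` for the second column. -/
theorem hasDerivAt_lax_column [NeZero m] {n : ℕ} {α : ℝ} {t u v : Fin m → ℝ} (ht : t 0 ≠ 0)
    {ρ K₁ K₂ y ε : ℂ} (hρ : ρ ≠ 0) (hy : y * K₂ = ρ * K₁) (hy0 : y ≠ 0) {A B E : ℂ → ℂ}
    {z : ℂ} (hz : z ≠ 0) (hζ : ∀ k, (t 0 : ℂ) * z - t k ≠ 0)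
    (hA : HasDerivAt A (((t 0 : ℂ) * z)⁻¹ * ((∑ k, (u k : ℂ) * v k) + n) *
        (A (t 0 * z) - ρ * B (t 0 * z)) -
      ((∑ k, ((t 0 : ℂ) * z - t k)⁻¹ * (u k * v k)) * A (t 0 * z) -
        (∑ k, ((t 0 : ℂ) * z - t k)⁻¹ * u k) * (ρ * B (t 0 * z))) +
      ε * (α * ((t 0 : ℂ) * z)⁻¹ - 1) * A (t 0 * z)) (t 0 * z))
    (hB : HasDerivAt B (B (t 0 * z) + ((t 0 : ℂ) * z)⁻¹ * ((∑ k, (u k : ℂ) * v k) + n + α) *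
        (ρ⁻¹ * A (t 0 * z) - B (t 0 * z)) -
      ((∑ k, ((t 0 : ℂ) * z - t k)⁻¹ * (u k * v k ^ 2)) * (ρ⁻¹ * A (t 0 * z)) -
        (∑ k, ((t 0 : ℂ) * z - t k)⁻¹ * (u k * v k)) * B (t 0 * z)) +
      ε * (α * ((t 0 : ℂ) * z)⁻¹ - 1) * B (t 0 * z)) (t 0 * z))
    (hE : HasDerivAt E ((1 - 2 * ε) * (α / 2 * ((t 0 : ℂ) * z)⁻¹ - 1 / 2) * t 0 * E z) z) :
    HasDerivAt (fun z => K₁ * A (t 0 * z) * E z)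
      (laxMatrix n α t u v y z 0 0 * (K₁ * A (t 0 * z) * E z) +
        laxMatrix n α t u v y z 0 1 * (K₂ * B (t 0 * z) * E z)) z ∧
    HasDerivAt (fun z => K₂ * B (t 0 * z) * E z)
      (laxMatrix n α t u v y z 1 0 * (K₁ * A (t 0 * z) * E z) +
        laxMatrix n α t u v y z 1 1 * (K₂ * B (t 0 * z) * E z)) z := by
  have ht' : (t 0 : ℂ) ≠ 0 := by exact_mod_cast ht
  have hlin : HasDerivAt (fun z : ℂ => (t 0 : ℂ) * z) (t 0) z := by
    simpa using (hasDerivAt_id z).const_mul (t 0 : ℂ)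
  -- With s = α / ζ - 1 and ζ = t₁ z, the scalar ε s from A or B and (1 - 2 ε) s / 2 from E add up
  -- to s / 2 for every ε. Both columns therefore have the same Lax matrix.
  have hA' := ((hA.comp z hlin).const_mul K₁).mul hE
  have hB' := ((hB.comp z hlin).const_mul K₂).mul hE
  have hinv : ∀ k, (z - (t k : ℂ) / t 0)⁻¹ = t 0 * ((t 0 : ℂ) * z - t k)⁻¹ := by
    intro k
    have h1 := hζ k
    have h2 : z - (t k : ℂ) / t 0 = ((t 0 : ℂ) * z - t k) / t 0 := by
      field_simp
    rw [h2, inv_div, div_eq_mul_inv]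
  have hK₂ : K₂ = ρ * K₁ / y := by
    rw [eq_div_iff hy0, ← hy]
    ring
  set X₁ := ∑ k, ((t 0 : ℂ) * z - t k)⁻¹ * (u k * v k) with hX₁
  set X₂ := ∑ k, ((t 0 : ℂ) * z - t k)⁻¹ * u k with hX₂
  set X₃ := ∑ k, ((t 0 : ℂ) * z - t k)⁻¹ * (u k * v k ^ 2) with hX₃
  set S := ∑ k, (u k : ℂ) * v k with hS
  have ha : (laxA n α u v : ℂ) = S + n + α / 2 := by
    rw [laxA, hS]
    push_cast
    rfl
  have l00 : laxMatrix n α t u v y z 0 0 = -(t 0 / 2) + z⁻¹ * (S + n + α / 2) - t 0 * X₁ := by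
    simp only [laxMatrix, Matrix.add_apply, Matrix.sum_apply, Matrix.smul_apply, resZero, resJump,
      hinv, ha, smul_eq_mul, Matrix.of_apply, Matrix.cons_val', Matrix.cons_val_zero,
      Matrix.cons_val_fin_one]
    rw [hX₁, Finset.mul_sum, sub_eq_add_neg, ← Finset.sum_neg_distrib]
    congr 1
    refine Finset.sum_congr rfl fun k _ => ?_
    push_cast
    ring
  have l01 : laxMatrix n α t u v y z 0 1 = -(z⁻¹ * (S + n) * y) + t 0 * X₂ * y := by
    simp only [laxMatrix, Matrix.add_apply, Matrix.sum_apply, Matrix.smul_apply, resZero, resJump,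
      hinv, Complex.ofReal_sub, ha, smul_eq_mul, Matrix.of_apply, Matrix.cons_val', Matrix.cons_val_zero,
      Matrix.cons_val_one, Matrix.cons_val_fin_one]
    rw [hX₂, Finset.mul_sum, Finset.sum_mul]
    congr 1
    · push_cast
      ring
    · refine Finset.sum_congr rfl fun k _ => ?_
      ring
  have l10 : laxMatrix n α t u v y z 1 0 = z⁻¹ * (S + n + α) / y - t 0 * X₃ / y := by
    simp only [laxMatrix, Matrix.add_apply, Matrix.sum_apply, Matrix.smul_apply, resZero, resJump,
      hinv, Complex.ofReal_add, ha, smul_eq_mul, Matrix.of_apply, Matrix.cons_val', Matrix.cons_val_zero,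
      Matrix.cons_val_one, Matrix.cons_val_fin_one]
    rw [hX₃, Finset.mul_sum, Finset.sum_div, sub_eq_add_neg, ← Finset.sum_neg_distrib]
    congr 1
    · push_cast
      ring
    · refine Finset.sum_congr rfl fun k _ => ?_
      push_cast
      ring
  have l11 : laxMatrix n α t u v y z 1 1 = t 0 / 2 - z⁻¹ * (S + n + α / 2) + t 0 * X₁ := by
    simp only [laxMatrix, Matrix.add_apply, Matrix.sum_apply, Matrix.smul_apply, resZero, resJump,
      hinv, ha, smul_eq_mul, Matrix.of_apply, Matrix.cons_val', Matrix.cons_val_one, Matrix.cons_val_fin_one]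
    rw [hX₁, Finset.mul_sum]
    congr 1
    · ring
    · refine Finset.sum_congr rfl fun k _ => ?_
      push_cast
      ring
  constructor
  · refine hA'.congr_deriv ?_
    rw [l00, l01, hK₂]
    simp only [Function.comp_apply]
    field_simp
    ring
  · refine hB'.congr_deriv ?_
    rw [l10, l11, hK₂]
    simp only [Function.comp_apply]
    field_simp
    ring

variable [NeZero m] {α : ℝ} {ω : Fin (m + 1) → ℝ} {t : Fin m → ℝ}

/-- Stated for arbitrary A and B so that it applies both to the polynomials and to their Cauchy
transforms; only the coefficients are translated into u, v and ρ. -/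
theorem sum_kernel_eq_succ (hα : -1 < α) (hω : ∀ l, 0 ≤ ∑ k ∈ Finset.Iic l, ω k) (hω' : ω ≠ 0)
    (ht0 : ∀ k, 0 < t k) (ht : StrictMono t) (n : ℕ)
    (hP : ∀ k, (orthoPoly α ω t (n + 1)).eval (t k) ≠ 0) (ζ A B : ℂ) :
    ((momentFunctional α ω t (derivative (orthoPoly α ω t (n + 1))) +
      ∑ k, jump α ω t k * (orthoPoly α ω t (n + 1)).eval (t k) : ℝ) : ℂ) *
      (ζ⁻¹ * ((sqNorm n α ω t : ℂ)⁻¹ * (((orthoPoly α ω t n).eval 0 : ℝ) * A -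
        ((orthoPoly α ω t (n + 1)).eval 0 : ℝ) * B))) -
    ∑ k, ((jump α ω t k * (orthoPoly α ω t (n + 1)).eval (t k) : ℝ) : ℂ) *
      ((ζ - t k)⁻¹ * ((sqNorm n α ω t : ℂ)⁻¹ * (((orthoPoly α ω t n).eval (t k) : ℝ) * A -
        ((orthoPoly α ω t (n + 1)).eval (t k) : ℝ) * B))) =
    ζ⁻¹ * ((∑ k, (paramU n α ω t k : ℂ) * paramV n α ω t k) + (n + 1 : ℕ)) *
        (A - ratioZero n α ω t * B) -
      ((∑ k, (ζ - t k)⁻¹ * (paramU n α ω t k * paramV n α ω t k)) * A -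
        (∑ k, (ζ - t k)⁻¹ * paramU n α ω t k) * (ratioZero n α ω t * B)) := by
  have hO := isOrthoSeq_orthoPoly hα hω hω' ht0 ht
  have hD := isPearson_momentFunctional hα ω ht0
  have hL := momentFunctional_sq_pos hα hω hω' ht0 ht
  have hh := (sqNorm_pos hα hω hω' ht0 ht n).ne'
  have hq0 := orthoPoly_eval_zero_ne_zero hα hω hω' ht0 ht n
  have e1 := hO.coeff_derivative_succ hL hD n
  rw [← sqNorm_eq hα] at e1
  simp only [jump_mul_mul hα hω hω' ht0 ht n (hP _), ← Finset.mul_sum] at e1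
  set c := momentFunctional α ω t (derivative (orthoPoly α ω t (n + 1))) +
    ∑ k, jump α ω t k * (orthoPoly α ω t (n + 1)).eval (t k)
  have hr : (orthoPoly α ω t (n + 1)).eval 0 = ratioZero n α ω t * (orthoPoly α ω t n).eval 0 := by
    rw [ratioZero, div_mul_cancel₀ _ hq0]
  have e1' : (c : ℂ) * ((orthoPoly α ω t n).eval 0 : ℝ) = sqNorm n α ω t *
      ((∑ k, (paramU n α ω t k : ℂ) * paramV n α ω t k) + (n + 1 : ℕ)) := by
    have := congrArg (fun x : ℝ => (x : ℂ)) e1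
    push_cast at this ⊢
    rw [this]
    ring
  have hh' : (sqNorm n α ω t : ℂ) ≠ 0 := by exact_mod_cast hh
  have hsum : ∑ k, ((jump α ω t k * (orthoPoly α ω t (n + 1)).eval (t k) : ℝ) : ℂ) *
      ((ζ - t k)⁻¹ * ((sqNorm n α ω t : ℂ)⁻¹ * (((orthoPoly α ω t n).eval (t k) : ℝ) * A -
        ((orthoPoly α ω t (n + 1)).eval (t k) : ℝ) * B))) =
      (∑ k, (ζ - t k)⁻¹ * (paramU n α ω t k * paramV n α ω t k)) * A -
        (∑ k, (ζ - t k)⁻¹ * paramU n α ω t k) * (ratioZero n α ω t * B) := by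
    rw [Finset.sum_mul, Finset.sum_mul, ← Finset.sum_sub_distrib]
    refine Finset.sum_congr rfl fun k _ => ?_
    have j1 := congrArg (fun x : ℝ => (x : ℂ)) (jump_mul_mul hα hω hω' ht0 ht n (hP k))
    have j2 := congrArg (fun x : ℝ => (x : ℂ)) (jump_mul_sq_succ hα hω hω' ht0 ht n k)
    push_cast at j1 j2 ⊢
    have i1 := mul_inv_cancel₀ hh'
    linear_combination (ζ - t k)⁻¹ * (sqNorm n α ω t : ℂ)⁻¹ * (A * j1 - B * j2) +
      (ζ - t k)⁻¹ * (paramU n α ω t k * paramV n α ω t k * A -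
        ratioZero n α ω t * paramU n α ω t k * B) * i1
  rw [hsum, hr]
  push_cast at e1' ⊢
  have i1 := mul_inv_cancel₀ hh'
  linear_combination ζ⁻¹ * (sqNorm n α ω t : ℂ)⁻¹ * (A - ratioZero n α ω t * B) * e1' +
    ζ⁻¹ * ((∑ k, (paramU n α ω t k : ℂ) * paramV n α ω t k) + (n + 1)) *
        (A - ratioZero n α ω t * B) * i1

theorem sum_kernel_eq_self (hα : -1 < α) (hω : ∀ l, 0 ≤ ∑ k ∈ Finset.Iic l, ω k) (hω' : ω ≠ 0)
    (ht0 : ∀ k, 0 < t k) (ht : StrictMono t) (n : ℕ)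
    (hP : ∀ k, (orthoPoly α ω t (n + 1)).eval (t k) ≠ 0) (ζ A B : ℂ) :
    ((momentFunctional α ω t (derivative (orthoPoly α ω t n) - orthoPoly α ω t n) +
      ∑ k, jump α ω t k * (orthoPoly α ω t n).eval (t k) : ℝ) : ℂ) *
      (ζ⁻¹ * ((sqNorm n α ω t : ℂ)⁻¹ * (((orthoPoly α ω t n).eval 0 : ℝ) * A -
        ((orthoPoly α ω t (n + 1)).eval 0 : ℝ) * B))) -
    ∑ k, ((jump α ω t k * (orthoPoly α ω t n).eval (t k) : ℝ) : ℂ) *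
      ((ζ - t k)⁻¹ * ((sqNorm n α ω t : ℂ)⁻¹ * (((orthoPoly α ω t n).eval (t k) : ℝ) * A -
        ((orthoPoly α ω t (n + 1)).eval (t k) : ℝ) * B))) =
    ζ⁻¹ * ((∑ k, (paramU n α ω t k : ℂ) * paramV n α ω t k) + (n + 1 : ℕ) + α) *
        ((ratioZero n α ω t : ℂ)⁻¹ * A - B) -
      ((∑ k, (ζ - t k)⁻¹ * (paramU n α ω t k * paramV n α ω t k ^ 2)) *
          ((ratioZero n α ω t : ℂ)⁻¹ * A) -
        (∑ k, (ζ - t k)⁻¹ * (paramU n α ω t k * paramV n α ω t k)) * B) := by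
  have hO := isOrthoSeq_orthoPoly hα hω hω' ht0 ht
  have hD := isPearson_momentFunctional hα ω ht0
  have hh := (sqNorm_pos hα hω hω' ht0 ht n).ne'
  have hq0 := orthoPoly_eval_zero_ne_zero hα hω hω' ht0 ht n
  have e1 := hO.derivative_sub_self_mul_succ hD n
  rw [← sqNorm_eq hα] at e1
  have e2 : ∑ k, jump α ω t k * (orthoPoly α ω t n).eval (t k) *
      (orthoPoly α ω t (n + 1)).eval (t k) =
      sqNorm n α ω t * ∑ k, paramU n α ω t k * paramV n α ω t k := by
    rw [Finset.mul_sum]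
    refine Finset.sum_congr rfl fun k _ => ?_
    rw [← jump_mul_mul hα hω hω' ht0 ht n (hP k)]
    ring
  rw [e2] at e1
  set c := momentFunctional α ω t (derivative (orthoPoly α ω t n) - orthoPoly α ω t n) +
    ∑ k, jump α ω t k * (orthoPoly α ω t n).eval (t k)
  have hρ := ratioZero_ne_zero hα hω hω' ht0 ht n
  have hρ' : (ratioZero n α ω t : ℂ) ≠ 0 := by exact_mod_cast hρ
  have hr : (((orthoPoly α ω t n).eval 0 : ℝ) : ℂ) =
      (ratioZero n α ω t : ℂ)⁻¹ * ((orthoPoly α ω t (n + 1)).eval 0 : ℝ) := by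
    rw [eq_inv_mul_iff_mul_eq₀ hρ', ← Complex.ofReal_mul, ratioZero, div_mul_cancel₀ _ hq0]
  have e1' : (c : ℂ) * ((orthoPoly α ω t (n + 1)).eval 0 : ℝ) = sqNorm n α ω t *
      ((∑ k, (paramU n α ω t k : ℂ) * paramV n α ω t k) + (n + 1 : ℕ) + α) := by
    have := congrArg (fun x : ℝ => (x : ℂ)) e1
    push_cast at this ⊢
    rw [this]
    ring
  have hh' : (sqNorm n α ω t : ℂ) ≠ 0 := by exact_mod_cast hh
  have i1 := mul_inv_cancel₀ hh'
  have i2 := mul_inv_cancel₀ hρ'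
  have hsum : ∑ k, ((jump α ω t k * (orthoPoly α ω t n).eval (t k) : ℝ) : ℂ) *
      ((ζ - t k)⁻¹ * ((sqNorm n α ω t : ℂ)⁻¹ * (((orthoPoly α ω t n).eval (t k) : ℝ) * A -
        ((orthoPoly α ω t (n + 1)).eval (t k) : ℝ) * B))) =
      (∑ k, (ζ - t k)⁻¹ * (paramU n α ω t k * paramV n α ω t k ^ 2)) *
          ((ratioZero n α ω t : ℂ)⁻¹ * A) -
        (∑ k, (ζ - t k)⁻¹ * (paramU n α ω t k * paramV n α ω t k)) * B := by
    rw [Finset.sum_mul, Finset.sum_mul, ← Finset.sum_sub_distrib]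
    refine Finset.sum_congr rfl fun k _ => ?_
    have j1 := congrArg (fun x : ℝ => (x : ℂ)) (jump_mul_mul hα hω hω' ht0 ht n (hP k))
    have j2 := congrArg (fun x : ℝ => (x : ℂ)) (jump_mul_sq_self hα hω hω' ht0 ht n (hP k))
    push_cast at j1 j2 ⊢
    have j3 : (jump α ω t k : ℂ) * ((orthoPoly α ω t n).eval (t k) : ℝ) ^ 2 =
        (ratioZero n α ω t : ℂ)⁻¹ * (sqNorm n α ω t * (paramU n α ω t k * paramV n α ω t k ^ 2)) := by
      rw [← j2, inv_mul_cancel_left₀ hρ']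
    linear_combination (ζ - t k)⁻¹ * (sqNorm n α ω t : ℂ)⁻¹ * (A * j3 - B * j1) +
      (ζ - t k)⁻¹ * (paramU n α ω t k * paramV n α ω t k ^ 2 * (ratioZero n α ω t : ℂ)⁻¹ * A -
        paramU n α ω t k * paramV n α ω t k * B) * i1
  rw [hsum, hr]
  push_cast at e1' ⊢
  linear_combination ζ⁻¹ * (sqNorm n α ω t : ℂ)⁻¹ * ((ratioZero n α ω t : ℂ)⁻¹ * A - B) * e1' +
    ζ⁻¹ * ((∑ k, (paramU n α ω t k : ℂ) * paramV n α ω t k) + (n + 1) + α) *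
        ((ratioZero n α ω t : ℂ)⁻¹ * A - B) * i1

theorem aeval_cdKernel (hα : -1 < α) (hω : ∀ l, 0 ≤ ∑ k ∈ Finset.Iic l, ω k) (hω' : ω ≠ 0)
    (ht0 : ∀ k, 0 < t k) (ht : StrictMono t) (n : ℕ) (s : ℝ) {ζ : ℂ} (hζ : ζ - s ≠ 0) :
    aeval ζ (cdKernel (momentFunctional α ω t) (orthoPoly α ω t) (n + 1) s) =
      (ζ - s)⁻¹ * ((sqNorm n α ω t : ℂ)⁻¹ *
        (((orthoPoly α ω t n).eval s : ℝ) * aeval ζ (orthoPoly α ω t (n + 1)) -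
          ((orthoPoly α ω t (n + 1)).eval s : ℝ) * aeval ζ (orthoPoly α ω t n))) := by
  rw [eq_inv_mul_iff_mul_eq₀ hζ]
  have h := congrArg (aeval ζ) ((isOrthoSeq_orthoPoly hα hω hω' ht0 ht).christoffel_darboux
    (momentFunctional_sq_pos hα hω hω' ht0 ht) n s)
  rw [← sqNorm_eq hα] at h
  simpa using h

/-- The Cauchy transform turns (X - s) K into (ζ - s) times the transform of K plus L(K(·, s)), and
L(K(·, s)) = 1 because K reproduces the constant 1. This accounts for the extra -1. -/
theorem polyCauchy_cdKernel (hα : -1 < α) (hω : ∀ l, 0 ≤ ∑ k ∈ Finset.Iic l, ω k) (hω' : ω ≠ 0)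
    (ht0 : ∀ k, 0 < t k) (ht : StrictMono t) (n : ℕ) (s : ℝ) {ζ : ℂ} (hζ : ζ.im ≠ 0) :
    polyCauchy α ω t (cdKernel (momentFunctional α ω t) (orthoPoly α ω t) (n + 1) s) ζ =
      (ζ - s)⁻¹ * ((sqNorm n α ω t : ℂ)⁻¹ *
        (((orthoPoly α ω t n).eval s : ℝ) * polyCauchy α ω t (orthoPoly α ω t (n + 1)) ζ -
          ((orthoPoly α ω t (n + 1)).eval s : ℝ) * polyCauchy α ω t (orthoPoly α ω t n) ζ) - 1) := by
  have hO := isOrthoSeq_orthoPoly hα hω hω' ht0 ht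
  have hL := momentFunctional_sq_pos hα hω hω' ht0 ht
  have hζs : ζ - s ≠ 0 := by
    rw [← neg_sub]
    exact neg_ne_zero.2 (sub_ne_zero_of_im_ne_zero hζ s)
  rw [eq_inv_mul_iff_mul_eq₀ hζs]
  have h1 := hO.cdKernel_reproducing hL (n := n + 1) s (f := 1)
    (by rw [degree_one]; exact_mod_cast Nat.succ_pos n)
  rw [mul_one, eval_one] at h1
  have h := congrArg (fun f => polyCauchy α ω t f ζ) (hO.christoffel_darboux hL n s)
  simp only [polyCauchy_X_sub_C_mul hα ω t s _ hζ, polyCauchy_C_mul, polyCauchy_sub hα ω t _ _ hζ,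
    h1, ← sqNorm_eq hα] at h
  push_cast at h
  linear_combination h

/-- The derivative of the Cauchy transform of a polynomial `f` for which `f' - ε f` is a combination
of Christoffel-Darboux kernels. -/
theorem hasDerivAt_polyCauchy_of_derivative_eq (hα : -1 < α)
    (hω : ∀ l, 0 ≤ ∑ k ∈ Finset.Iic l, ω k) (hω' : ω ≠ 0) (ht0 : ∀ k, 0 < t k) (ht : StrictMono t)
    (n : ℕ) {f : ℝ[X]} {ε c : ℝ} (hc : c = momentFunctional α ω t (derivative f - f) +
      ∑ k, jump α ω t k * f.eval (t k))
    (hf : derivative f - C ε * f = C c *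
        cdKernel (momentFunctional α ω t) (orthoPoly α ω t) (n + 1) 0 -
      ∑ k, C (jump α ω t k * f.eval (t k)) *
        cdKernel (momentFunctional α ω t) (orthoPoly α ω t) (n + 1) (t k)) {ζ : ℂ} (hζ : ζ.im ≠ 0) :
    HasDerivAt (polyCauchy α ω t f) (ε * polyCauchy α ω t f ζ +
      (c * (ζ⁻¹ * ((sqNorm n α ω t : ℂ)⁻¹ *
        (((orthoPoly α ω t n).eval 0 : ℝ) * polyCauchy α ω t (orthoPoly α ω t (n + 1)) ζ -
          ((orthoPoly α ω t (n + 1)).eval 0 : ℝ) * polyCauchy α ω t (orthoPoly α ω t n) ζ))) -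
      ∑ k, ((jump α ω t k * f.eval (t k) : ℝ) : ℂ) * ((ζ - t k)⁻¹ * ((sqNorm n α ω t : ℂ)⁻¹ *
        (((orthoPoly α ω t n).eval (t k) : ℝ) * polyCauchy α ω t (orthoPoly α ω t (n + 1)) ζ -
          ((orthoPoly α ω t (n + 1)).eval (t k) : ℝ) *
            polyCauchy α ω t (orthoPoly α ω t n) ζ)))) +
      (α * ζ⁻¹ - 1) * polyCauchy α ω t f ζ) ζ := by
  have hζ0 : ζ ≠ 0 := by
    rintro rfl
    simp at hζ
  refine (hasDerivAt_polyCauchy hα ω t f hζ).congr_deriv ?_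
  have hp := polyCauchy_pearson hα ω ht0 f hζ
  have hX : ∀ g : ℝ[X], polyCauchy α ω t (X * g) ζ =
      (momentFunctional α ω t g : ℂ) + ζ * polyCauchy α ω t g ζ := fun g => by
    simpa using polyCauchy_X_sub_C_mul hα ω t 0 g hζ
  have hf' := congrArg (fun g => polyCauchy α ω t g ζ) hf
  simp only [polyCauchy_sub hα ω t _ _ hζ, polyCauchy_sum hα ω t _ _ hζ, polyCauchy_C_mul,
    polyCauchy_cdKernel hα hω hω' ht0 ht n _ hζ, Complex.ofReal_zero, sub_zero] at hf'
  rw [hX, hX] at hp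
  refine mul_left_cancel₀ hζ0 ?_
  rw [hp, sub_eq_iff_eq_add.1 hf']
  have hc' := congrArg (fun x : ℝ => (x : ℂ)) hc
  simp only [map_sub] at hc'
  push_cast at hc' ⊢
  generalize polyCauchy α ω t (orthoPoly α ω t (n + 1)) ζ = A at *
  generalize polyCauchy α ω t (orthoPoly α ω t n) ζ = B at *
  -- The extra -1 of each kernel transform at t_k combines with the jump term of the Pearson
  -- equation to the constant r_k f(t_k). By the choice of c, these constants, L(f' - f) and -c add
  -- up to 0, so the system is homogeneous.
  have hsum : (∑ k, (jump α ω t k * t k * f.eval (t k) : ℂ) / ((t k : ℂ) - ζ)) -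
      ζ * ∑ k, (jump α ω t k * f.eval (t k) : ℂ) * ((ζ - t k)⁻¹ * ((sqNorm n α ω t : ℂ)⁻¹ *
        (((orthoPoly α ω t n).eval (t k) : ℝ) * A -
          ((orthoPoly α ω t (n + 1)).eval (t k) : ℝ) * B) - 1)) =
      (∑ k, (jump α ω t k * f.eval (t k) : ℂ)) -
      ζ * ∑ k, (jump α ω t k * f.eval (t k) : ℂ) * ((ζ - t k)⁻¹ * ((sqNorm n α ω t : ℂ)⁻¹ *
        (((orthoPoly α ω t n).eval (t k) : ℝ) * A -
          ((orthoPoly α ω t (n + 1)).eval (t k) : ℝ) * B))) := by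
    rw [Finset.mul_sum, Finset.mul_sum, ← Finset.sum_sub_distrib, ← Finset.sum_sub_distrib]
    refine Finset.sum_congr rfl fun k _ => ?_
    have h1 := sub_ne_zero_of_im_ne_zero hζ (t k)
    have h2 : ζ - t k ≠ 0 := by
      rw [← neg_sub]
      exact neg_ne_zero.2 h1
    have h3 : ((t k : ℂ) - ζ)⁻¹ = -(ζ - t k)⁻¹ := by
      rw [← inv_neg, neg_sub]
    rw [div_eq_mul_inv, h3]
    linear_combination (jump α ω t k * f.eval (t k) : ℂ) * mul_inv_cancel₀ h2
  have i := mul_inv_cancel₀ hζ0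
  linear_combination hsum - hc' +
    (c * ((sqNorm n α ω t : ℂ)⁻¹ *
        (((orthoPoly α ω t n).eval 0 : ℝ) * A - ((orthoPoly α ω t (n + 1)).eval 0 : ℝ) * B) - 1) -
      c * ((sqNorm n α ω t : ℂ)⁻¹ *
        (((orthoPoly α ω t n).eval 0 : ℝ) * A - ((orthoPoly α ω t (n + 1)).eval 0 : ℝ) * B)) -
      α * polyCauchy α ω t f ζ) * i

end
end LaguerreJump

/-! ### The Lax equation for Ψ. -/

namespace LaguerreJump
open Polynomial Finset MeasureTheory Set Filter Topology

noncomputable section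

variable {m : ℕ}

theorem hasDerivAt_cpow_mul_exp {τ : ℝ} (hτ : τ ≠ 0) (c d : ℂ) {z : ℂ} (hz : z.im ≠ 0) :
    HasDerivAt (fun z : ℂ => ((τ : ℂ) * z) ^ c * Complex.exp (d * (τ * z)))
      ((c * ((τ : ℂ) * z)⁻¹ + d) * τ * (((τ : ℂ) * z) ^ c * Complex.exp (d * (τ * z)))) z := by
  have him : ((τ : ℂ) * z).im ≠ 0 := by
    simpa using ⟨hτ, hz⟩
  have h0 : (τ : ℂ) * z ≠ 0 := by
    intro h
    rw [h] at him
    simp at him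
  have hlin : HasDerivAt (fun z : ℂ => (τ : ℂ) * z) τ z := by
    simpa using (hasDerivAt_id z).const_mul (τ : ℂ)
  have h1 := hlin.cpow_const (c := c) (Or.inr him)
  have h2 := (hlin.const_mul d).cexp
  refine (h1.mul h2).congr_deriv ?_
  rw [Complex.cpow_sub _ _ h0, Complex.cpow_one]
  ring

theorem aeval_C_mul_sub_sum {ι : Type*} [Fintype ι] (ζ : ℂ) (c : ℝ) (d : ι → ℝ) (f : ℝ[X])
    (g : ι → ℝ[X]) : aeval ζ (C c * f - ∑ k, C (d k) * g k) =
      c * aeval ζ f - ∑ k, (d k : ℂ) * aeval ζ (g k) := by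
  simp

section Psi

variable [NeZero m]

/-- The entries of `Ψ` in terms of those of `Y`. -/
theorem matPsi_apply (n : ℕ) (α : ℝ) (ω : Fin (m + 1) → ℝ) (t : Fin m → ℝ) (z : ℂ) :
    matPsi n α ω t z 0 0 = ((t 0 ^ (-((n : ℝ) + α / 2)) : ℝ) : ℂ) * matY n α ω t (t 0 * z) 0 0 *
        (((t 0 : ℂ) * z) ^ ((α : ℂ) / 2) * Complex.exp (-(1 / 2) * ((t 0 : ℂ) * z))) ∧
    matPsi n α ω t z 0 1 = ((t 0 ^ (-((n : ℝ) + α / 2)) : ℝ) : ℂ) * matY n α ω t (t 0 * z) 0 1 *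
        (((t 0 : ℂ) * z) ^ (-((α : ℂ) / 2)) * Complex.exp (1 / 2 * ((t 0 : ℂ) * z))) ∧
    matPsi n α ω t z 1 0 = ((t 0 ^ ((n : ℝ) + α / 2) : ℝ) : ℂ) * matY n α ω t (t 0 * z) 1 0 *
        (((t 0 : ℂ) * z) ^ ((α : ℂ) / 2) * Complex.exp (-(1 / 2) * ((t 0 : ℂ) * z))) ∧
    matPsi n α ω t z 1 1 = ((t 0 ^ ((n : ℝ) + α / 2) : ℝ) : ℂ) * matY n α ω t (t 0 * z) 1 1 *
        (((t 0 : ℂ) * z) ^ (-((α : ℂ) / 2)) * Complex.exp (1 / 2 * ((t 0 : ℂ) * z))) := by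
  have e1 : -((t 0 : ℂ) * z / 2) = -(1 / 2) * ((t 0 : ℂ) * z) := by ring
  have e2 : (t 0 : ℂ) * z / 2 = 1 / 2 * ((t 0 : ℂ) * z) := by ring
  refine ⟨?_, ?_, ?_, ?_⟩ <;>
  · rw [matPsi, e1, e2]
    simp only [Matrix.mul_apply, Fin.sum_univ_two, Matrix.of_apply, Matrix.cons_val',
      Matrix.cons_val_zero, Matrix.cons_val_one, Matrix.cons_val_fin_one, mul_zero, zero_mul,
      add_zero, zero_add]
    ring

/-- The parameter `y` in terms of the orthogonal polynomials of degrees `n + 1` and `n`. -/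
def paramY (n : ℕ) (α : ℝ) (ω : Fin (m + 1) → ℝ) (t : Fin m → ℝ) : ℂ :=
  ratioZero n α ω t * ((t 0 ^ (-(((n + 1 : ℕ) : ℝ) + α / 2)) : ℝ) : ℂ) /
    (((t 0 ^ (((n + 1 : ℕ) : ℝ) + α / 2) : ℝ) : ℂ) *
      (-(2 * Real.pi * Complex.I) / (sqNorm n α ω t : ℂ)))

variable {α : ℝ} {ω : Fin (m + 1) → ℝ} {t : Fin m → ℝ}

theorem isLaxParam_param (hα : -1 < α) (hω : ∀ l, 0 ≤ ∑ k ∈ Finset.Iic l, ω k)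
    (hω' : ω ≠ 0) (ht0 : ∀ k, 0 < t k) (ht : StrictMono t) (n : ℕ)
    (hP : ∀ k, (orthoPoly α ω t (n + 1)).eval (t k) ≠ 0) :
    IsLaxParam (n + 1) α ω t (paramU n α ω t) (paramV n α ω t) (paramY n α ω t) := by
  have hO := isOrthoSeq_orthoPoly hα hω hω' ht0 ht
  have hD := isPearson_momentFunctional hα ω ht0
  have hL := momentFunctional_sq_pos hα hω hω' ht0 ht
  have hh : (sqNorm n α ω t : ℂ) ≠ 0 := by
    exact_mod_cast (sqNorm_pos hα hω hω' ht0 ht n).ne'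
  have hρ : (ratioZero n α ω t : ℂ) ≠ 0 := by
    exact_mod_cast ratioZero_ne_zero hα hω hω' ht0 ht n
  have hs₁ : ((t 0 ^ (-(((n + 1 : ℕ) : ℝ) + α / 2)) : ℝ) : ℂ) ≠ 0 := by
    exact_mod_cast (Real.rpow_pos_of_pos (ht0 0) _).ne'
  have hs₂ : ((t 0 ^ (((n + 1 : ℕ) : ℝ) + α / 2) : ℝ) : ℂ) ≠ 0 := by
    exact_mod_cast (Real.rpow_pos_of_pos (ht0 0) _).ne'
  have hpi := Complex.two_pi_I_ne_zero
  have hκ : -(2 * Real.pi * Complex.I) / (sqNorm n α ω t : ℂ) ≠ 0 :=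
    div_ne_zero (neg_ne_zero.2 hpi) hh
  have hy0 : paramY n α ω t ≠ 0 := div_ne_zero (mul_ne_zero hρ hs₁) (mul_ne_zero hs₂ hκ)
  have hy : paramY n α ω t * (((t 0 ^ (((n + 1 : ℕ) : ℝ) + α / 2) : ℝ) : ℂ) *
      (-(2 * Real.pi * Complex.I) / (sqNorm n α ω t : ℂ))) =
      ratioZero n α ω t * ((t 0 ^ (-(((n + 1 : ℕ) : ℝ) + α / 2)) : ℝ) : ℂ) :=
    div_mul_cancel₀ _ (mul_ne_zero hs₂ hκ)
  refine ⟨hy0, fun z hz => ?_⟩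
  have ht00 := (ht0 0).ne'
  have hz0 : z ≠ 0 := by
    rintro rfl
    simp at hz
  have him : ((t 0 : ℂ) * z).im ≠ 0 := by
    simpa using ⟨ht00, hz⟩
  have hζ0 : (t 0 : ℂ) * z ≠ 0 := mul_ne_zero (by exact_mod_cast ht00) hz0
  have hζ : ∀ k, (t 0 : ℂ) * z - t k ≠ 0 := fun k => by
    rw [← neg_sub]
    exact neg_ne_zero.2 (sub_ne_zero_of_im_ne_zero him (t k))
  have c1 := hasDerivAt_lax_column (n := n + 1) (α := α) (u := paramU n α ω t)
    (v := paramV n α ω t) (ε := 0)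
    (A := fun ζ => aeval ζ (orthoPoly α ω t (n + 1))) (B := fun ζ => aeval ζ (orthoPoly α ω t n))
    ht00 hρ hy hy0 hz0 hζ
    (by
      refine ((orthoPoly α ω t (n + 1)).hasDerivAt_aeval _).congr_deriv ?_
      rw [hO.derivative_succ_eq hL hD n]
      simp only [aeval_C_mul_sub_sum, aeval_cdKernel hα hω hω' ht0 ht n _ (hζ _),
        aeval_cdKernel hα hω hω' ht0 ht n 0 (by simpa using hζ0 : (t 0 : ℂ) * z - (0 : ℝ) ≠ 0),
        Complex.ofReal_zero, sub_zero]
      have := sum_kernel_eq_succ hα hω hω' ht0 ht n hP ((t 0 : ℂ) * z)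
        (aeval ((t 0 : ℂ) * z) (orthoPoly α ω t (n + 1)))
        (aeval ((t 0 : ℂ) * z) (orthoPoly α ω t n))
      linear_combination this)
    (by
      refine ((orthoPoly α ω t n).hasDerivAt_aeval _).congr_deriv ?_
      rw [sub_eq_iff_eq_add.1 (hO.derivative_sub_self_eq hL hD n)]
      rw [map_add, aeval_C_mul_sub_sum]
      simp only [aeval_cdKernel hα hω hω' ht0 ht n _ (hζ _),
        aeval_cdKernel hα hω hω' ht0 ht n 0 (by simpa using hζ0 : (t 0 : ℂ) * z - (0 : ℝ) ≠ 0),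
        Complex.ofReal_zero, sub_zero]
      have := sum_kernel_eq_self hα hω hω' ht0 ht n hP ((t 0 : ℂ) * z)
        (aeval ((t 0 : ℂ) * z) (orthoPoly α ω t (n + 1)))
        (aeval ((t 0 : ℂ) * z) (orthoPoly α ω t n))
      linear_combination this)
    ((hasDerivAt_cpow_mul_exp ht00 ((α : ℂ) / 2) (-(1 / 2)) hz).congr_deriv (by ring))
  have c2 := hasDerivAt_lax_column (n := n + 1) (α := α) (u := paramU n α ω t)
    (v := paramV n α ω t) (ε := 1) (y := paramY n α ω t)
    (K₁ := ((t 0 ^ (-(((n + 1 : ℕ) : ℝ) + α / 2)) : ℝ) : ℂ) * (1 / (2 * Real.pi * Complex.I)))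
    (K₂ := ((t 0 ^ (((n + 1 : ℕ) : ℝ) + α / 2) : ℝ) : ℂ) * (-1 / (sqNorm n α ω t : ℂ)))
    (A := polyCauchy α ω t (orthoPoly α ω t (n + 1))) (B := polyCauchy α ω t (orthoPoly α ω t n))
    ht00 hρ
    (by
      -- The constants of the second column are those of the first times 1 / (2πi), so the same y
      -- fits both columns.
      have e : -1 / (sqNorm n α ω t : ℂ) = -(2 * Real.pi * Complex.I) / (sqNorm n α ω t : ℂ) *
          (1 / (2 * Real.pi * Complex.I)) := by
        rw [div_mul_div_comm, mul_one, mul_comm (sqNorm n α ω t : ℂ), neg_div, neg_div,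
          div_mul_cancel_left₀ hpi, one_div]
      rw [e, ← mul_assoc, ← mul_assoc, ← mul_assoc, ← hy, mul_assoc (paramY n α ω t)])
    hy0 hz0 hζ
    (by
      have hf := hO.derivative_succ_eq hL hD n
      refine (hasDerivAt_polyCauchy_of_derivative_eq hα hω hω' ht0 ht n (ε := 0)
        (f := orthoPoly α ω t (n + 1)) ?_
        ((by rw [C_0, zero_mul, sub_zero] : _ = _).trans hf) him).congr_deriv ?_
      -- The constant c was required with f' - f, whereas for p it is known with p' alone; they
      -- agree because L(p) = 0.
      · have := hO.map_mul_of_degree_lt (n := n + 1) (f := 1)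
          (by rw [degree_one]; exact_mod_cast Nat.succ_pos n)
        rw [mul_one] at this
        rw [map_sub, this, sub_zero]
      · rw [sum_kernel_eq_succ hα hω hω' ht0 ht n hP]
        push_cast
        ring)
    (by
      refine (hasDerivAt_polyCauchy_of_derivative_eq hα hω hω' ht0 ht n (ε := 1) rfl
        (by rw [C_1, one_mul]; exact hO.derivative_sub_self_eq hL hD n) him).congr_deriv ?_
      rw [sum_kernel_eq_self hα hω hω' ht0 ht n hP]
      push_cast
      ring)
    ((hasDerivAt_cpow_mul_exp ht00 (-((α : ℂ) / 2)) (1 / 2) hz).congr_deriv (by ring))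
  have hY00 : ∀ ζ, matY (n + 1) α ω t ζ 0 0 = aeval ζ (orthoPoly α ω t (n + 1)) := fun ζ => rfl
  have hY01 : ∀ ζ, matY (n + 1) α ω t ζ 0 1 = 1 / (2 * Real.pi * Complex.I) *
      polyCauchy α ω t (orthoPoly α ω t (n + 1)) ζ := fun ζ => rfl
  have hY10 : ∀ ζ, matY (n + 1) α ω t ζ 1 0 = -(2 * Real.pi * Complex.I) / (sqNorm n α ω t : ℂ) *
      aeval ζ (orthoPoly α ω t n) := fun ζ => rfl
  have hY11 : ∀ ζ, matY (n + 1) α ω t ζ 1 1 = -1 / (sqNorm n α ω t : ℂ) *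
      polyCauchy α ω t (orthoPoly α ω t n) ζ := fun ζ => rfl
  have hψ := matPsi_apply (n + 1) α ω t
  simp only [hY00, hY01, hY10, hY11, ← mul_assoc] at hψ
  intro i j
  fin_cases i <;> fin_cases j <;>
  simp only [Fin.zero_eta, Fin.mk_one, Matrix.mul_apply, Fin.sum_univ_two, (hψ _).1, (hψ _).2.1,
    (hψ _).2.2.1, (hψ _).2.2.2, Fin.isValue]
  · simpa only [← mul_assoc] using c1.1
  · simpa only [← mul_assoc] using c2.1
  · simpa only [← mul_assoc] using c1.2
  · simpa only [← mul_assoc] using c2.2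

end Psi

/-! ### Partial derivatives of the coupled Hamiltonian. -/

theorem hasDerivAt_update_apply (u : Fin m → ℝ) (k j : Fin m) :
    HasDerivAt (fun x => Function.update u k x j) (if j = k then 1 else 0) (u k) := by
  have h := hasDerivAt_pi.1 (hasDerivAt_update u k (u k)) j
  simpa [Pi.single_apply] using h

theorem deriv_coupledHam_left (n : ℕ) (α : ℝ) {t : Fin m → ℝ} (ht0 : ∀ k, t k ≠ 0)
    (u v : Fin m → ℝ) (k : Fin m) :
    deriv (fun x => coupledHam n α t (Function.update u k x) v) (u k) =
      t k * v k + (v k - 1) * ∑ j, u j * (v j - 1) * (v k + v j) + (n + α) * (v k - 1) ^ 2 -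
        α * v k * (v k - 1) := by
  simp only [coupledHam_eq ht0]
  have hu := hasDerivAt_update_apply u k
  have h := (HasDerivAt.fun_sum (u := Finset.univ) fun j _ =>
    ((((hu j).const_mul (t j)).mul_const (v j)).add
      (((hu j).const_mul ((n : ℝ) + α)).mul_const ((v j - 1) ^ 2))).sub
      ((((hu j).const_mul α).mul_const (v j)).mul_const (v j - 1))).add
    ((HasDerivAt.fun_sum (u := Finset.univ) fun j _ => (hu j).mul_const (v j - 1)).mul
      (HasDerivAt.fun_sum (u := Finset.univ) fun j _ =>
        ((hu j).mul_const (v j)).mul_const (v j - 1)))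
  refine h.deriv.trans ?_
  simp only [mul_ite, ite_mul, mul_one, one_mul, mul_zero, zero_mul, Finset.sum_add_distrib,
    Finset.sum_sub_distrib, Finset.sum_ite_eq', Finset.mem_univ, if_true, Function.update_eq_self]
  have e1 : ∑ j, u j * (v j - 1) * (v k + v j) =
      v k * ∑ j, u j * (v j - 1) + ∑ j, u j * v j * (v j - 1) := by
    rw [Finset.mul_sum, ← Finset.sum_add_distrib]
    exact Finset.sum_congr rfl fun j _ => by ring
  rw [e1]
  ring

theorem deriv_coupledHam_right (n : ℕ) (α : ℝ) {t : Fin m → ℝ} (ht0 : ∀ k, t k ≠ 0)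
    (u v : Fin m → ℝ) (k : Fin m) :
    -deriv (fun x => coupledHam n α t u (Function.update v k x)) (v k) =
      -(t k * u k) - u k * ∑ j, u j * (v j - 1) * (2 * v k + v j - 1) - 2 * n * u k * v k +
        (2 * n + α) * u k := by
  simp only [coupledHam_eq ht0]
  have hv := hasDerivAt_update_apply v k
  have h := (HasDerivAt.fun_sum (u := Finset.univ) fun j _ =>
    (((hv j).const_mul (t j * u j)).add
      ((((hv j).sub_const 1).pow 2).const_mul (((n : ℝ) + α) * u j))).sub
      (((hv j).const_mul (α * u j)).mul ((hv j).sub_const 1))).add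
    ((HasDerivAt.fun_sum (u := Finset.univ) fun j _ => ((hv j).sub_const 1).const_mul (u j)).mul
      (HasDerivAt.fun_sum (u := Finset.univ) fun j _ =>
        ((hv j).const_mul (u j)).mul ((hv j).sub_const 1)))
  simp only [Pi.mul_apply] at h
  have h' := h.deriv
  rw [neg_eq_iff_eq_neg]
  refine h'.trans ?_
  simp only [mul_ite, ite_mul, mul_one, mul_zero, zero_mul, Finset.sum_add_distrib,
    Finset.sum_sub_distrib, Finset.sum_ite_eq', Finset.mem_univ, if_true, Function.update_eq_self]
  have e1 : ∑ j, u j * (v j - 1) * (2 * v k + v j - 1) =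
      (2 * v k - 1) * ∑ j, u j * (v j - 1) + ∑ j, u j * v j * (v j - 1) := by
    rw [Finset.mul_sum, ← Finset.sum_add_distrib]
    exact Finset.sum_congr rfl fun j _ => by ring
  rw [e1]
  push_cast
  ring

theorem coupledPVAt_iff_hamiltonianAt (n : ℕ) (α : ℝ) (u v : (Fin m → ℝ) → Fin m → ℝ)
    {t : Fin m → ℝ} (ht0 : ∀ k, t k ≠ 0) :
    CoupledPVAt n α u v t ↔ HamiltonianAt n α u v t := by
  simp only [CoupledPVAt, HamiltonianAt, deriv_coupledHam_left n α ht0,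
    deriv_coupledHam_right n α ht0]
  simp only [and_comm (a := delta (fun s => u s _) t = _)]

end
end LaguerreJump

theorem theorem1p2 (m : ℕ) [NeZero m] (n : ℕ) (hn : 1 ≤ n) (α : ℝ) (hα : -1 < α)
    (ω : Fin (m + 1) → ℝ) (hω : ∀ l : Fin (m + 1), 0 ≤ ∑ k ∈ Finset.Iic l, ω k) (hω' : ω ≠ 0) :
    (∀ t : Fin m → ℝ, (∀ k, 0 < t k) → StrictMono t →
      0 < LaguerreJump.hankelDet n α ω t ∧
      DifferentiableAt ℝ (fun s => Real.log (LaguerreJump.hankelDet n α ω s)) t) ∧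
    (∃ (u v : (Fin m → ℝ) → Fin m → ℝ) (y : (Fin m → ℝ) → ℂ),
      ∀ t : Fin m → ℝ, (∀ k, 0 < t k) → StrictMono t →
        (∀ k, (LaguerreJump.orthoPoly α ω t n).eval (t k) ≠ 0) →
        LaguerreJump.IsLaxParam n α ω t (u t) (v t) (y t) ∧
        LaguerreJump.sigma n α ω t = LaguerreJump.coupledHam n α t (u t) (v t) ∧
        LaguerreJump.CoupledPVAt n α u v t) ∧
    (∀ (u v : (Fin m → ℝ) → Fin m → ℝ) (t : Fin m → ℝ), (∀ k, 0 < t k) → StrictMono t →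
      (LaguerreJump.CoupledPVAt n α u v t ↔ LaguerreJump.HamiltonianAt n α u v t)) := by
  -- Since n ≥ 1, the degrees n and n - 1 occurring in Y become n + 1 and n.
  obtain ⟨n, rfl⟩ : ∃ l, n = l + 1 := ⟨n - 1, by omega⟩
  refine ⟨fun t ht0 ht => ⟨LaguerreJump.hankelDet_pos hα hω hω' ht0 ht _,
    (LaguerreJump.hasDelta_log_hankelDet hα hω hω' ht0 ht _).differentiableAt⟩,
    ⟨LaguerreJump.paramU n α ω, LaguerreJump.paramV n α ω, LaguerreJump.paramY n α ω,
      fun t ht0 ht hP => ⟨LaguerreJump.isLaxParam_param hα hω hω' ht0 ht n hP,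
        LaguerreJump.sigma_eq_coupledHam hα hω hω' ht0 ht n hP,
        LaguerreJump.coupledPVAt_param hα hω hω' ht0 ht n hP⟩⟩,
    fun u v t ht0 _ => LaguerreJump.coupledPVAt_iff_hamiltonianAt _ α u v fun k => (ht0 k).ne'⟩
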